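/- Let $d\ge 1$ be an integer, $0<a\le b<+\infty$ and $p\in(1,+\infty)$. Let $E$ be the set of nearest-neighbour edges of $\mathbb{Z}^d$, let $\nu=\frac12\delta_a+\frac12\delta_b$, and let $r=(r_e)_{e\in E}$ have law $\mu=\nu^{\otimes E}$. A unit flow from $x$ to $y$ ($x\ne y$) is an antisymmetric function $\theta$ on oriented edges with $\sum_{w\sim z}\theta(\overrightarrow{zw})=0$ for every $z\notin\{x,y\}$, $\sum_{w\sim x}\theta(\overrightarrow{xw})=1$ and $\sum_{w\sim y}\theta(\overrightarrow{wy})=1$. The $p$-resistance is $$\mathcal{R}^p_r(x\leftrightarrow y)=\inf_{\theta}\ \sum_{e\in E} r_e|\theta(e)|^p,$$ the infimum being over all unit flows $\theta$ from $x$ to $y$. Let $|v|$ be the $\ell^1$-norm of $v\in\mathbb{Z}^d$ and, with the convention $d/(d-1)=+\infty$ when $d=1$, put $$a_d(n,p)=\begin{cases} n^{1-(d-1)(p-1)} & \text{if } p<\frac{d}{d-1},\\ \log n & \text{if } p=\frac{d}{d-1},\\ 1 & \text{if } p>\frac{d}{d-1}.\end{cases}$$ Then $\mathcal{R}^p_r(0\leftrightarrow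 v)$ is square-integrable for every $v\neq 0$ and, as $v$ goes to infinity in $\mathbb{Z}^d$ (with $a,b,d,p$ fixed), $$\mathbb{E}\big(\mathcal{R}^p_r(0\leftrightarrow v)\big)=\Theta\big(a_d(|v|,p)\big).$$ Moreover, if $d\ge 2$ and $p\le\frac{d}{d-1}$, then $$\mathrm{Var}_\mu\big(\mathcal{R}^p_r(0\leftrightarrow v)\big)=O\left(\frac{a_d(|v|,p)}{\log a_d(|v|,p)}\right),$$ and if $d\ge 2$ and $p>\frac{d}{d-1}$, then $\mathrm{Var}_\mu\big(\mathcal{R}^p_r(0\leftrightarrow v)\big)=O(1)$. -/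

import Mathlib

open MeasureTheory ProbabilityTheory Filter Asymptotics
open scoped ENNReal

namespace PResistance

/-- Vertices of the lattice `ℤ^d`. -/
abbrev Vertex (d : ℕ) : Type := Fin d → ℤ

/-- The (unoriented) nearest-neighbour edges of `ℤ^d`: the pair `(x, i)` stands for the edge joining
`x` and `x + e_i`. Every edge is represented exactly once. -/
abbrev Edge (d : ℕ) : Type := Vertex d × Fin d

/-- The `i`-th vector of the canonical basis. -/
def basisVec {d : ℕ} (i : Fin d) : Vertex d := Pi.single i 1

/-- An antisymmetric function on oriented edges is determined by its values on the edges oriented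
from `x` to `x + e_i`, so it is represented by `θ : Edge d → ℝ`; its value from `x` to `x + e_i` is
`θ (x, i)`, and its value from `x` to `x - e_i` is `-θ (x - e_i, i)`. This is the sum of the values
over all `2d` oriented edges leaving `x`. -/
def outflow {d : ℕ} (θ : Edge d → ℝ) (x : Vertex d) : ℝ :=
  ∑ i : Fin d, (θ (x, i) + -θ (x - basisVec i, i))

/-- `θ` is a flow of strength `1` from `x` to `y`: the node law holds off `{x, y}`, the flow out of
the source `x` is `1` and the flow into the sink `y` is `1`. -/
structure IsUnitFlow {d : ℕ} (x y : Vertex d) (θ : Edge d → ℝ) : Prop where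
  node_law : ∀ z, z ≠ x → z ≠ y → outflow θ z = 0
  source : outflow θ x = 1
  sink : -outflow θ y = 1

/-- The `p`-energy `∑ₑ rₑ |θ(e)|^p`, possibly infinite. -/
noncomputable def energy {d : ℕ} (p : ℝ) (r θ : Edge d → ℝ) : ℝ≥0∞ :=
  ∑' e : Edge d, ENNReal.ofReal (r e * |θ e| ^ p)

/-- The `p`-resistance between `x` and `y`: the infimum of the `p`-energy over all unit flows from
`x` to `y` (flows of infinite energy are allowed and do not affect the infimum). -/
noncomputable def resistance {d : ℕ} (p : ℝ) (r : Edge d → ℝ) (x y : Vertex d) : ℝ :=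
  (⨅ θ : {θ : Edge d → ℝ // IsUnitFlow x y θ}, energy p r θ.1).toReal

/-- The symmetric Bernoulli law `½ δ_a + ½ δ_b`. -/
noncomputable def bernoulliLaw (a b : ℝ) : Measure ℝ :=
  (2⁻¹ : ℝ≥0∞) • Measure.dirac a + (2⁻¹ : ℝ≥0∞) • Measure.dirac b

instance (a b : ℝ) : IsProbabilityMeasure (bernoulliLaw a b) :=
  ⟨by simp [bernoulliLaw, ENNReal.inv_two_add_inv_two]⟩

/-- The law of i.i.d. resistances on the edges of `ℤ^d` with common law `½ δ_a + ½ δ_b`. -/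
noncomputable def resistanceLaw (d : ℕ) (a b : ℝ) : Measure (Edge d → ℝ) :=
  Measure.infinitePi fun _ : Edge d => bernoulliLaw a b

/-- The `ℓ¹`-norm on `ℤ^d`. -/
def l1norm {d : ℕ} (v : Vertex d) : ℕ := ∑ i : Fin d, (v i).natAbs

/-- The order `a_d(n, p)`. The comparison of `p` with `d / (d - 1)` is written without division, so
that for `d = 1` (where `d / (d - 1) = +∞`) the first case applies. -/
noncomputable def rate (d n : ℕ) (p : ℝ) : ℝ :=
  open Classical in
  if ((d : ℝ) - 1) * p < d then (n : ℝ) ^ (1 - ((d : ℝ) - 1) * (p - 1))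
  else if ((d : ℝ) - 1) * p = d then Real.log n
  else 1

end PResistance

/-! Put `s = (d-1)(p-1)`, `n = |v|` and `Z(n) = ∑_{j ≤ n} j^{-s}`; `Z(n)` is comparable with
`a_d(n,p)` (`exists_rate_bounds`). For any resistances in `[a,b]`, the resistance lies between
constant multiples of `Z(n)` (`exists_resistance_bounds`). Below: the edges leaving the balls of
radius `N` are disjoint cutsets of `O(N^{d-1})` edges, each crossed by a unit of flow, and Hölder
gives energy of order at least `N^{-s}` on each (`partialZeta_le_tsum`). Above: spread the mass at
`0` over growing cubes, slide the final cube to `v`, and gather it there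
(`exists_unitFlow_energy_le`). These bounds are deterministic, so they settle integrability, the
expectation, and the variance when `p > d/(d-1)`, where `Z` is bounded.

For `p ≤ d/(d-1)` the argument is that of Benjamini, Kalai and Schramm. Flipping `r_e` from `a` to
`b` costs at most `(b-a)|θ(e)|^p`, with `θ` the minimal flow, so the total influence is `O(ρ)` with
`ρ = a_d(n,p)`. Poincaré would only give variance `O(ρ)`; hypercontractivity gains a logarithm
provided that every single influence is small (`variance_le_of_influences`). Edges near `0` and `v`
can violate this, so the resistance is averaged over `m^d` translates of its endpoints (`avgRes`).
An edge then has influence at most of order `m^{-d}` times the minimal energy in a ball of radius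
`O(m)`.

Two estimates remain: this local energy is `O(m)`, and averaging moves the resistance by `O(m)`.
Both come from the recurrent regime, where a flow of finite energy has arbitrarily small flux
through some large ball (`exists_sum_boxBdry_lt`). A truncated potential can then be used as a test
function: the energy dissipated between two levels of the potential is at most their difference
(`IsMinFlow.sum_le_of_potential`). For one edge this gives `|θ(e)| ≤ 1`; hence the potential is
`b`-Lipschitz, and the energy in a ball is linear in its radius. Taking `m` of order `ρ^{1/4}` and
cutting frequencies at order `log ρ` finishes the proof.

The probability takes place on the infinite Boolean cube over the edges, where the resistance is
continuous (`continuous_coinRes`), so Walsh analysis needs only finite sums and uniform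
approximation. -/

namespace PResistance

/-! ### Walsh analysis and hypercontractivity on an infinite Boolean cube. -/

section Walsh

set_option linter.unusedSectionVars false

variable {ι : Type*} [DecidableEq ι]

/-- Flip the `i`-th coordinate of a point of the cube. -/
def flip (i : ι) (ω : ι → Bool) : ι → Bool := Function.update ω i (!ω i)

lemma flip_same (i : ι) (ω : ι → Bool) : flip i ω i = !ω i := by simp [flip]

lemma flip_of_ne {i j : ι} (h : j ≠ i) (ω : ι → Bool) : flip i ω j = ω j := by simp [flip, h]

lemma flip_flip (i : ι) (ω : ι → Bool) : flip i (flip i ω) = ω := by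
  ext j; by_cases h : j = i
  · subst h; simp [flip]
  · simp [flip, h]

lemma continuous_flip (i : ι) : Continuous (flip i : (ι → Bool) → ι → Bool) :=
  continuous_id.update i
    ((continuous_of_discreteTopology (f := fun b : Bool => !b)).comp (continuous_apply i))

/-- The sign attached to a bit. -/
def bitSign (b : Bool) : ℝ := if b then -1 else 1

lemma bitSign_mul_self (b : Bool) : bitSign b * bitSign b = 1 := by cases b <;> simp [bitSign]

/-- The Walsh character indexed by a finite set of coordinates. -/
def walsh (S : Finset ι) (ω : ι → Bool) : ℝ := ∏ i ∈ S, bitSign (ω i)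

lemma continuous_bitSign_apply (i : ι) : Continuous fun ω : ι → Bool => bitSign (ω i) :=
  (continuous_of_discreteTopology (f := bitSign)).comp (continuous_apply i)

@[fun_prop]
lemma continuous_walsh (S : Finset ι) : Continuous (walsh S) :=
  continuous_finsetProd _ fun i _ => continuous_bitSign_apply i

lemma walsh_mul_self (S : Finset ι) (ω : ι → Bool) : walsh S ω * walsh S ω = 1 := by
  simp [walsh, ← Finset.prod_mul_distrib, bitSign_mul_self]

lemma walsh_flip (S : Finset ι) (i : ι) (ω : ι → Bool) :
    walsh S (flip i ω) = (if i ∈ S then -1 else 1) * walsh S ω := by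
  unfold walsh
  split_ifs with h
  · rw [← Finset.mul_prod_erase _ _ h, ← Finset.mul_prod_erase S (fun j => bitSign (ω j)) h,
      flip_same, Finset.prod_congr rfl (g := fun j => bitSign (ω j))]
    · cases ω i <;> simp [bitSign]
    · intro j hj; rw [flip_of_ne (Finset.ne_of_mem_erase hj)]
  · rw [one_mul]
    refine Finset.prod_congr rfl fun j hj => ?_
    rw [flip_of_ne (by rintro rfl; exact h hj)]

lemma walsh_insert {S : Finset ι} {i : ι} (h : i ∉ S) (ω : ι → Bool) :
    walsh (insert i S) ω = bitSign (ω i) * walsh S ω := by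
  simp [walsh, Finset.prod_insert h]

lemma bitSign_mul_walsh (S : Finset ι) (i : ι) :
    ∃ T : Finset ι, ∀ ω, bitSign (ω i) * walsh S ω = walsh T ω := by
  by_cases h : i ∈ S
  · refine ⟨S.erase i, fun ω => ?_⟩
    rw [walsh, ← Finset.mul_prod_erase _ _ h, ← mul_assoc, bitSign_mul_self, one_mul, walsh]
  · exact ⟨insert i S, fun ω => (walsh_insert h ω).symm⟩

variable [Countable ι] {P : Measure (ι → Bool)} [IsProbabilityMeasure P]

lemma integrable_of_continuous {f : (ι → Bool) → ℝ} (hf : Continuous f) : Integrable f P :=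
  hf.integrable_of_hasCompactSupport (HasCompactSupport.of_compactSpace f)

/-- Cauchy–Schwarz, from the discriminant of `t ↦ ∫ (f + t g)²`. -/
lemma sq_integral_mul_le {f g : (ι → Bool) → ℝ} (hf : Continuous f) (hg : Continuous g) :
    (∫ ω, f ω * g ω ∂P) ^ 2 ≤ (∫ ω, f ω ^ 2 ∂P) * ∫ ω, g ω ^ 2 ∂P := by
  classical
  have key : ∀ t : ℝ, 0 ≤ (∫ ω, g ω ^ 2 ∂P) * (t * t) + (2 * ∫ ω, f ω * g ω ∂P) * t
      + ∫ ω, f ω ^ 2 ∂P := by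
    intro t
    have h1 : Integrable (fun ω => g ω ^ 2 * (t * t)) P := integrable_of_continuous (by fun_prop)
    have h2 : Integrable (fun ω => f ω * g ω * (2 * t)) P :=
      integrable_of_continuous (by fun_prop)
    have h3 : Integrable (fun ω => f ω ^ 2) P := integrable_of_continuous (by fun_prop)
    have h : 0 ≤ ∫ ω, (g ω ^ 2 * (t * t) + f ω * g ω * (2 * t) + f ω ^ 2) ∂P :=
      integral_nonneg fun ω => by
        have := sq_nonneg (f ω + t * g ω)
        simp only [Pi.zero_apply]; nlinarith
    have h12 : Integrable (fun ω => g ω ^ 2 * (t * t) + f ω * g ω * (2 * t)) P := h1.add h2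
    rw [integral_add h12 h3, integral_add h1 h2, integral_mul_const,
      integral_mul_const] at h
    linarith
  have := discrim_le_zero key
  unfold discrim at this
  nlinarith

lemma integral_comp_flip (hP : ∀ i, MeasurePreserving (flip i) P P) (i : ι)
    {f : (ι → Bool) → ℝ} (hf : Continuous f) : ∫ ω, f (flip i ω) ∂P = ∫ ω, f ω ∂P := by
  conv_rhs => rw [← (hP i).map_eq]
  rw [integral_map (hP i).measurable.aemeasurable hf.aestronglyMeasurable]

lemma integral_eq_zero_of_flip_neg (hP : ∀ i, MeasurePreserving (flip i) P P) (i : ι)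
    {f : (ι → Bool) → ℝ} (hf : Continuous f) (h : ∀ ω, f (flip i ω) = -f ω) :
    ∫ ω, f ω ∂P = 0 := by
  have := integral_comp_flip hP i hf
  simp only [h, integral_neg] at this
  linarith

/-- Flipping a coordinate that lies in exactly one of `S` and `T` changes the sign of the product.
Invariance under flips is the only property of the measure used for orthonormality. -/
lemma integral_walsh_mul_walsh (hP : ∀ i, MeasurePreserving (flip i) P P) (S T : Finset ι) :
    ∫ ω, walsh S ω * walsh T ω ∂P = if S = T then 1 else 0 := by
  split_ifs with h
  · subst h; simp [walsh_mul_self]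
  · obtain ⟨i, hi⟩ : ∃ i, ¬(i ∈ S ↔ i ∈ T) := by
      by_contra hcon; push Not at hcon; exact h (Finset.ext hcon)
    refine integral_eq_zero_of_flip_neg hP i (by fun_prop) fun ω => ?_
    rw [walsh_flip, walsh_flip]
    by_cases h1 : i ∈ S <;> by_cases h2 : i ∈ T <;> simp_all

/-- The Walsh coefficients of a function on the cube. -/
noncomputable def walshCoeff (P : Measure (ι → Bool)) (f : (ι → Bool) → ℝ) (S : Finset ι) : ℝ :=
  ∫ ω, f ω * walsh S ω ∂P

/-- Finite Walsh sums. -/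
def walshSum (A : Finset (Finset ι)) (c : Finset ι → ℝ) (ω : ι → Bool) : ℝ :=
  ∑ S ∈ A, c S * walsh S ω

@[fun_prop]
lemma continuous_walshSum (A : Finset (Finset ι)) (c : Finset ι → ℝ) :
    Continuous (walshSum A c) :=
  continuous_finsetSum _ fun _ _ => by fun_prop

lemma integral_mul_walshSum {f : (ι → Bool) → ℝ} (hf : Continuous f)
    (A : Finset (Finset ι)) (c : Finset ι → ℝ) :
    ∫ ω, f ω * walshSum A c ω ∂P = ∑ S ∈ A, c S * walshCoeff P f S := by
  simp only [walshSum, Finset.mul_sum]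
  rw [integral_finsetSum _ fun S _ => integrable_of_continuous (by fun_prop)]
  refine Finset.sum_congr rfl fun S _ => ?_
  rw [walshCoeff, ← integral_const_mul]
  congr 1; ext ω; ring

lemma walshCoeff_walshSum (hP : ∀ i, MeasurePreserving (flip i) P P) (A : Finset (Finset ι))
    (c : Finset ι → ℝ) (S : Finset ι) :
    walshCoeff P (walshSum A c) S = if S ∈ A then c S else 0 := by
  have h := integral_mul_walshSum (P := P) (continuous_walsh S) A c
  simp only [walshCoeff, integral_walsh_mul_walsh hP] at h ⊢
  simp only [mul_comm (walsh S _)] at h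
  rw [h]; simp

/-- Pythagoras around the orthogonal projection; it yields both Bessel's inequality and the
approximate Parseval identity. -/
lemma integral_sq_sub_walshSum (hP : ∀ i, MeasurePreserving (flip i) P P)
    {f : (ι → Bool) → ℝ} (hf : Continuous f) (A : Finset (Finset ι)) (c : Finset ι → ℝ) :
    ∫ ω, (f ω - walshSum A c ω) ^ 2 ∂P = ∫ ω, f ω ^ 2 ∂P - ∑ S ∈ A, walshCoeff P f S ^ 2
      + ∑ S ∈ A, (c S - walshCoeff P f S) ^ 2 := by
  have h1 : Integrable (fun ω => f ω ^ 2) P := integrable_of_continuous (by fun_prop)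
  have h2 : Integrable (fun ω => 2 * (f ω * walshSum A c ω)) P :=
    integrable_of_continuous (by fun_prop)
  have h3 : Integrable (fun ω => walshSum A c ω * walshSum A c ω) P :=
    integrable_of_continuous (by fun_prop)
  have e : ∀ ω, (f ω - walshSum A c ω) ^ 2 = f ω ^ 2 - 2 * (f ω * walshSum A c ω)
      + walshSum A c ω * walshSum A c ω := fun ω => by ring
  simp only [e]
  have h12 : Integrable (fun ω => f ω ^ 2 - 2 * (f ω * walshSum A c ω)) P := h1.sub h2
  rw [integral_add h12 h3, integral_sub h1 h2, integral_const_mul,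
    integral_mul_walshSum hf, integral_mul_walshSum (continuous_walshSum A c)]
  have : ∑ S ∈ A, c S * walshCoeff P (walshSum A c) S = ∑ S ∈ A, c S ^ 2 :=
    Finset.sum_congr rfl fun S hS => by rw [walshCoeff_walshSum hP, if_pos hS]; ring
  rw [this]
  have : ∑ S ∈ A, (c S - walshCoeff P f S) ^ 2
      = ∑ S ∈ A, c S ^ 2 - 2 * ∑ S ∈ A, c S * walshCoeff P f S
        + ∑ S ∈ A, walshCoeff P f S ^ 2 := by
    rw [Finset.mul_sum, ← Finset.sum_sub_distrib, ← Finset.sum_add_distrib]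
    exact Finset.sum_congr rfl fun S _ => by ring
  rw [this]; ring

lemma sum_sq_walshCoeff_le (hP : ∀ i, MeasurePreserving (flip i) P P)
    {f : (ι → Bool) → ℝ} (hf : Continuous f) (A : Finset (Finset ι)) :
    ∑ S ∈ A, walshCoeff P f S ^ 2 ≤ ∫ ω, f ω ^ 2 ∂P := by
  have h := integral_sq_sub_walshSum hP hf A (walshCoeff P f)
  have h0 : 0 ≤ ∫ ω, (f ω - walshSum A (walshCoeff P f) ω) ^ 2 ∂P :=
    integral_nonneg fun _ => sq_nonneg _
  simp at h; linarith

/-- Uniform density of finite Walsh sums. -/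
lemma exists_walshSum_near {f : (ι → Bool) → ℝ} (hf : Continuous f) {ε : ℝ} (hε : 0 < ε) :
    ∃ (A : Finset (Finset ι)) (c : Finset ι → ℝ), ∀ ω, |walshSum A c ω - f ω| < ε := by
  classical
  let x : ι → C(ι → Bool, ℝ) := fun i => ⟨_, continuous_bitSign_apply i⟩
  let W : Finset ι → C(ι → Bool, ℝ) := fun S => ⟨_, continuous_walsh S⟩
  -- Stone–Weierstrass: the coordinate signs separate points of the cube.
  have hsep : (Algebra.adjoin ℝ (Set.range x)).SeparatesPoints := by
    intro ω ω' hne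
    obtain ⟨i, hi⟩ := Function.ne_iff.mp hne
    refine ⟨_, ⟨x i, Algebra.subset_adjoin ⟨i, rfl⟩, rfl⟩, ?_⟩
    simp only [x, ContinuousMap.coe_mk, bitSign]
    revert hi; cases ω i <;> cases ω' i <;> norm_num
  obtain ⟨⟨g, hg⟩, hgf⟩ :=
    ContinuousMap.exists_mem_subalgebra_near_continuous_of_separatesPoints _ hsep f hf ε hε
  have hspan : g ∈ Submodule.span ℝ (Set.range W) := by
    -- Multiplying a character by a sign gives a character again, so the algebra generated by the
    -- signs is spanned by characters.
    have h1 : (Submonoid.closure (Set.range x) : Set C(ι → Bool, ℝ)) ⊆ Set.range W := by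
      intro y hy
      induction hy using Submonoid.closure_induction_left with
      | one => exact ⟨∅, by ext ω; simp [W, walsh]⟩
      | mul_left y hy z _ hz =>
        obtain ⟨i, rfl⟩ := hy
        obtain ⟨S, rfl⟩ := hz
        obtain ⟨T, hT⟩ := bitSign_mul_walsh S i
        exact ⟨T, by ext ω; exact (hT ω).symm⟩
    have h2 : g ∈ Submodule.span ℝ (Submonoid.closure (Set.range x) : Set C(ι → Bool, ℝ)) := by
      rw [← Algebra.adjoin_eq_span]; exact hg
    exact Submodule.span_mono h1 h2
  obtain ⟨c, hc⟩ := (Finsupp.mem_span_range_iff_exists_finsupp).1 hspan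
  refine ⟨c.support, c, fun ω => ?_⟩
  have : walshSum c.support c ω = g ω := by
    rw [← hc, Finsupp.sum, ContinuousMap.sum_apply]
    rfl
  rw [this]; exact hgf ω

/-- Approximate Parseval identity. -/
lemma exists_integral_sq_le (hP : ∀ i, MeasurePreserving (flip i) P P)
    {f : (ι → Bool) → ℝ} (hf : Continuous f) {ε : ℝ} (hε : 0 < ε) :
    ∃ A : Finset (Finset ι), ∫ ω, f ω ^ 2 ∂P ≤ ∑ S ∈ A, walshCoeff P f S ^ 2 + ε ^ 2 := by
  obtain ⟨A, c, h⟩ := exists_walshSum_near hf hε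
  refine ⟨A, ?_⟩
  have h1 := integral_sq_sub_walshSum hP hf A c
  have h2 : ∫ ω, (f ω - walshSum A c ω) ^ 2 ∂P ≤ ∫ _, ε ^ 2 ∂P := by
    refine integral_mono (integrable_of_continuous (by fun_prop)) (integrable_const _) fun ω => ?_
    rw [← sq_abs, abs_sub_comm]
    exact pow_le_pow_left₀ (abs_nonneg _) (h ω).le 2
  have h3 : 0 ≤ ∑ S ∈ A, (c S - walshCoeff P f S) ^ 2 := Finset.sum_nonneg fun _ _ => sq_nonneg _
  simp at h2; linarith

/-- Bonami's hypercontractive inequality from `L²` to `L⁴`. -/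
lemma integral_walshSum_pow_four_le (hP : ∀ i, MeasurePreserving (flip i) P P) (A : Finset ι) :
    ∀ c : Finset ι → ℝ, ∫ ω, walshSum A.powerset c ω ^ 4 ∂P
      ≤ (∑ S ∈ A.powerset, 3 ^ S.card * c S ^ 2) ^ 2 := by
  induction A using Finset.induction_on with
  | empty => intro c; simp [walshSum, walsh]; ring_nf; rfl
  | insert i A hi ih =>
    intro c
    set g := walshSum A.powerset c with hg
    set h := walshSum A.powerset (fun S => c (insert i S)) with hh
    set u := ∑ S ∈ A.powerset, 3 ^ S.card * c S ^ 2 with hu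
    set w := ∑ S ∈ A.powerset, 3 ^ S.card * c (insert i S) ^ 2 with hw
    have u0 : 0 ≤ u := Finset.sum_nonneg fun _ _ => by positivity
    have w0 : 0 ≤ w := Finset.sum_nonneg fun _ _ => by positivity
    have hgu : ∫ ω, g ω ^ 4 ∂P ≤ u ^ 2 := ih c
    have hhw : ∫ ω, h ω ^ 4 ∂P ≤ w ^ 2 := ih _
    have cg : Continuous g := continuous_walshSum _ _
    have ch : Continuous h := continuous_walshSum _ _
    have cx := continuous_bitSign_apply i
    have hi' : ∀ S ∈ A.powerset, i ∉ S := fun S hS hiS => hi (Finset.mem_powerset.1 hS hiS)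
    have e1 : ∀ ω, walshSum (insert i A).powerset c ω = g ω + bitSign (ω i) * h ω := by
      intro ω
      rw [walshSum, Finset.sum_powerset_insert hi, hg, hh, walshSum, walshSum, Finset.mul_sum]
      congr 1
      refine Finset.sum_congr rfl fun S hS => ?_
      rw [walsh_insert (hi' S hS)]; ring
    have e2 : ∑ S ∈ (insert i A).powerset, (3 : ℝ) ^ S.card * c S ^ 2 = u + 3 * w := by
      rw [Finset.sum_powerset_insert hi, hu, hw, Finset.mul_sum]
      congr 1
      refine Finset.sum_congr rfl fun S hS => ?_
      rw [Finset.card_insert_of_notMem (hi' S hS)]; ring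
    have inv : ∀ d : Finset ι → ℝ, ∀ ω,
        walshSum A.powerset d (flip i ω) = walshSum A.powerset d ω := by
      intro d ω
      refine Finset.sum_congr rfl fun S hS => ?_
      rw [walsh_flip, if_neg (hi' S hS), one_mul]
    -- Terms odd in the new sign are collected separately: `g` and `h` do not depend on coordinate
    -- `i`, so these terms integrate to zero.
    have e3 : ∀ ω, (g ω + bitSign (ω i) * h ω) ^ 4 = g ω ^ 4 + 6 * (g ω ^ 2 * h ω ^ 2) + h ω ^ 4
        + bitSign (ω i) * (4 * (g ω ^ 3 * h ω + g ω * h ω ^ 3)) := by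
      intro ω; cases ω i <;> simp [bitSign] <;> ring
    have i1 : Integrable (fun ω => g ω ^ 4) P := integrable_of_continuous (by fun_prop)
    have i2 : Integrable (fun ω => 6 * (g ω ^ 2 * h ω ^ 2)) P :=
      integrable_of_continuous (by fun_prop)
    have i3 : Integrable (fun ω => h ω ^ 4) P := integrable_of_continuous (by fun_prop)
    have c4 : Continuous (fun ω => bitSign (ω i) * (4 * (g ω ^ 3 * h ω + g ω * h ω ^ 3))) := by
      fun_prop
    have z4 : ∫ ω, bitSign (ω i) * (4 * (g ω ^ 3 * h ω + g ω * h ω ^ 3)) ∂P = 0 := by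
      refine integral_eq_zero_of_flip_neg hP i c4 fun ω => ?_
      rw [flip_same, hg, hh, inv, inv]
      cases ω i <;> simp [bitSign]
    have cs : (∫ ω, g ω ^ 2 * h ω ^ 2 ∂P) ≤ u * w := by
      have := sq_integral_mul_le (P := P) (f := fun ω => g ω ^ 2) (g := fun ω => h ω ^ 2)
        (by fun_prop) (by fun_prop)
      simp only [← pow_mul, show 2 * 2 = 4 from rfl] at this
      have h4 : (∫ ω, g ω ^ 4 ∂P) * ∫ ω, h ω ^ 4 ∂P ≤ u ^ 2 * w ^ 2 :=
        mul_le_mul hgu hhw (integral_nonneg fun ω => by positivity) (by positivity)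
      refine le_of_abs_le (abs_le_of_sq_le_sq ?_ (by positivity))
      nlinarith
    simp only [e1, e2, e3]
    have i12 : Integrable (fun ω => g ω ^ 4 + 6 * (g ω ^ 2 * h ω ^ 2)) P := i1.add i2
    have i123 : Integrable (fun ω => g ω ^ 4 + 6 * (g ω ^ 2 * h ω ^ 2) + h ω ^ 4) P := i12.add i3
    rw [integral_add i123 (integrable_of_continuous c4), z4,
      integral_add i12 i3, integral_add i1 i2, integral_const_mul]
    -- `u² + 6uw + w² ≤ (u + 3w)²`: the cross term is what forces the factor `3` per coordinate.
    nlinarith [mul_nonneg u0 w0]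

/-- The low-frequency part of a bounded function is controlled by its `L¹` norm. -/
lemma sq_sum_walshCoeff_le (hP : ∀ i, MeasurePreserving (flip i) P P)
    {g : (ι → Bool) → ℝ} (hg : Continuous g) (hg1 : ∀ ω, |g ω| ≤ 1) (A : Finset (Finset ι)) :
    (∑ S ∈ A, ((3 : ℝ) ^ S.card)⁻¹ * walshCoeff P g S ^ 2) ^ 2 ≤ (∫ ω, |g ω| ∂P) ^ 3 := by
  set a := ∑ S ∈ A, ((3 : ℝ) ^ S.card)⁻¹ * walshCoeff P g S ^ 2 with ha
  have a0 : 0 ≤ a := Finset.sum_nonneg fun _ _ => by positivity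
  set B : Finset ι := A.biUnion id
  have hAB : A ⊆ B.powerset := fun S hS =>
    Finset.mem_powerset.2 fun i hi => Finset.mem_biUnion.2 ⟨S, hS, hi⟩
  -- Duality: with these coefficients `∫ g u = a`, and since `3^|S| · 3^{-2|S|} = 3^{-|S|}`,
  -- Bonami's inequality bounds `∫ u⁴` by `a²` as well.
  set c : Finset ι → ℝ := fun S => if S ∈ A then ((3 : ℝ) ^ S.card)⁻¹ * walshCoeff P g S else 0
    with hc
  set u := walshSum B.powerset c with hu
  have cu : Continuous u := continuous_walshSum _ _
  have e1 : ∫ ω, g ω * u ω ∂P = a := by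
    rw [hu, integral_mul_walshSum hg, ha, ← Finset.sum_subset hAB]
    · refine Finset.sum_congr rfl fun S hS => ?_
      simp only [hc, if_pos hS]; ring
    · intro S _ hS; simp [hc, hS]
  have e2 : ∫ ω, u ω ^ 4 ∂P ≤ a ^ 2 := by
    refine (integral_walshSum_pow_four_le hP B c).trans (le_of_eq ?_)
    rw [ha, ← Finset.sum_subset hAB]
    · congr 1
      refine Finset.sum_congr rfl fun S hS => ?_
      simp only [hc, if_pos hS]; field_simp
    · intro S _ hS; simp [hc, hS]
  set I := ∫ ω, |g ω| ∂P with hI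
  have I0 : 0 ≤ I := integral_nonneg fun _ => abs_nonneg _
  have s1 : a ≤ ∫ ω, |g ω| * |u ω| ∂P := by
    rw [← e1]
    refine integral_mono (integrable_of_continuous (by fun_prop))
      (integrable_of_continuous (by fun_prop)) fun ω => ?_
    rw [← abs_mul]; exact le_abs_self _
  -- Two Cauchy–Schwarz inequalities replace Hölder with exponents `4/3` and `4`; `g² ≤ |g|` is used
  -- in the second, and together they give `a⁴ ≤ I³ a²`.
  have s2 : (∫ ω, |g ω| * |u ω| ∂P) ^ 2 ≤ I * ∫ ω, |g ω| * u ω ^ 2 ∂P := by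
    have := sq_integral_mul_le (P := P) (f := fun ω => √|g ω|) (g := fun ω => √|g ω| * |u ω|)
      (by fun_prop) (by fun_prop)
    simpa only [mul_pow, Real.sq_sqrt (abs_nonneg _), sq_abs, ← mul_assoc,
      Real.mul_self_sqrt (abs_nonneg _)] using this
  have s3 : (∫ ω, |g ω| * u ω ^ 2 ∂P) ^ 2 ≤ I * a ^ 2 := by
    have := sq_integral_mul_le (P := P) (f := fun ω => |g ω|) (g := fun ω => u ω ^ 2)
      (by fun_prop) (by fun_prop)
    simp only [← pow_mul, show 2 * 2 = 4 from rfl] at this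
    refine this.trans (mul_le_mul ?_ e2 (integral_nonneg fun ω => by positivity) I0)
    refine integral_mono (integrable_of_continuous (by fun_prop))
      (integrable_of_continuous (by fun_prop)) fun ω => ?_
    have := hg1 ω
    have := abs_nonneg (g ω)
    simp only; nlinarith
  have s4 : a ^ 4 ≤ I ^ 3 * a ^ 2 := by
    have h1 : a ^ 2 ≤ I * ∫ ω, |g ω| * u ω ^ 2 ∂P :=
      (pow_le_pow_left₀ a0 s1 2).trans s2
    have h2 := pow_le_pow_left₀ (sq_nonneg a) h1 2
    rw [mul_pow] at h2
    nlinarith [mul_le_mul_of_nonneg_left s3 (sq_nonneg I)]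
  rcases a0.eq_or_lt with h | h
  · rw [← h, zero_pow two_ne_zero]; positivity
  · have : a ^ 2 * a ^ 2 ≤ I ^ 3 * a ^ 2 := by nlinarith
    exact le_of_mul_le_mul_right this (by positivity)

/-- The difference along coordinate `i` kills the frequencies avoiding `i` and doubles the others.
This is how influences control Walsh coefficients. -/
lemma walshCoeff_sub_flip (hP : ∀ i, MeasurePreserving (flip i) P P)
    {f : (ι → Bool) → ℝ} (hf : Continuous f) (i : ι) (S : Finset ι) :
    walshCoeff P (fun ω => f ω - f (flip i ω)) S = if i ∈ S then 2 * walshCoeff P f S else 0 := by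
  have hcf := hf.comp (continuous_flip i)
  have h1 : walshCoeff P (fun ω => f (flip i ω)) S
      = (if i ∈ S then -1 else 1) * walshCoeff P f S := by
    rw [walshCoeff, walshCoeff, ← integral_const_mul,
      ← integral_comp_flip hP i (f := fun ω => (if i ∈ S then -1 else 1) * (f ω * walsh S ω))
        (by fun_prop)]
    congr 1; ext ω; rw [walsh_flip]; split_ifs <;> ring
  have h2 : walshCoeff P (fun ω => f ω - f (flip i ω)) S
      = walshCoeff P f S - walshCoeff P (fun ω => f (flip i ω)) S := by
    simp only [walshCoeff, sub_mul]
    exact integral_sub (integrable_of_continuous (by fun_prop))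
      (integrable_of_continuous (hcf.mul (continuous_walsh S)))
  rw [h2, h1]; split_ifs <;> ring

/-- A variance bound that improves on the Poincaré inequality when all influences are small. -/
theorem variance_le_of_influences (hP : ∀ i, MeasurePreserving (flip i) P P)
    {f : (ι → Bool) → ℝ} (hf : Continuous f) {T δ : ℝ}
    (h1 : ∀ i ω, |f ω - f (flip i ω)| ≤ 1)
    (hT : ∀ A : Finset ι, ∑ i ∈ A, ∫ ω, |f ω - f (flip i ω)| ∂P ≤ T)
    (hδ : ∀ i, ∫ ω, |f ω - f (flip i ω)| ∂P ≤ δ) {k : ℕ} (hk : 1 ≤ k) :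
    variance f P ≤ T / k + 3 ^ k * √δ * T := by
  set J : ι → ℝ := fun i => ∫ ω, |f ω - f (flip i ω)| ∂P with hJ
  have J0 : ∀ i, 0 ≤ J i := fun i => integral_nonneg fun _ => abs_nonneg _
  have T0 : 0 ≤ T := by simpa using hT ∅
  have hk0 : (0 : ℝ) < k := by exact_mod_cast hk
  have cG : ∀ i, Continuous fun ω => f ω - f (flip i ω) := fun i =>
    hf.sub (hf.comp (continuous_flip i))
  have hmain : ∀ A : Finset (Finset ι),
      ∑ S ∈ A, (if S = ∅ then 0 else walshCoeff P f S ^ 2) ≤ T / k + 3 ^ k * √δ * T := by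
    intro A
    set B : Finset ι := A.biUnion id
    have hB : ∀ S ∈ A, S ⊆ B := fun S hS i hi => Finset.mem_biUnion.2 ⟨S, hS, hi⟩
    have swap : ∀ φ : Finset ι → ℝ, ∑ S ∈ A, (S.card : ℝ) * φ S
        = ∑ i ∈ B, ∑ S ∈ A, if i ∈ S then φ S else 0 := by
      intro φ
      rw [Finset.sum_comm]
      refine Finset.sum_congr rfl fun S hS => ?_
      rw [← Finset.sum_filter, Finset.sum_const, Finset.filter_mem_eq_inter,
        Finset.inter_eq_right.2 (hB S hS), nsmul_eq_mul]
    -- Bessel for each difference `f - f ∘ flip i`, whose square is at most its absolute value by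
    -- `h1`.
    have high : ∑ S ∈ A, (S.card : ℝ) * walshCoeff P f S ^ 2 ≤ T := by
      rw [swap]
      refine le_trans (Finset.sum_le_sum fun i _ => ?_) (hT B)
      have hb := sum_sq_walshCoeff_le hP (cG i) A
      calc ∑ S ∈ A, (if i ∈ S then walshCoeff P f S ^ 2 else 0)
          ≤ ∑ S ∈ A, walshCoeff P (fun ω => f ω - f (flip i ω)) S ^ 2 := by
            refine Finset.sum_le_sum fun S _ => ?_
            rw [walshCoeff_sub_flip hP hf]
            split_ifs
            · nlinarith [sq_nonneg (walshCoeff P f S)]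
            · simp
        _ ≤ _ := hb
        _ ≤ _ := by
            refine integral_mono (integrable_of_continuous ((cG i).pow 2))
              (integrable_of_continuous (cG i).abs) fun ω => ?_
            have := h1 i ω
            have := abs_nonneg (f ω - f (flip i ω))
            simp only; rw [← sq_abs]; nlinarith
    -- The same sum damped by `3^{-|S|}`: the low-frequency inequality bounds the contribution of
    -- `i` by `J i ^ (3/2) ≤ √δ * J i`.
    have low : ∑ S ∈ A, (S.card : ℝ) * (((3 : ℝ) ^ S.card)⁻¹ * walshCoeff P f S ^ 2)
        ≤ √δ * T := by
      rw [swap]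
      calc _ ≤ ∑ i ∈ B, √δ * J i := by
            refine Finset.sum_le_sum fun i _ => ?_
            have hb := sq_sum_walshCoeff_le hP (cG i) (h1 i) A
            have hle : ∑ S ∈ A, (if i ∈ S then ((3 : ℝ) ^ S.card)⁻¹ * walshCoeff P f S ^ 2 else 0)
                ≤ ∑ S ∈ A, ((3 : ℝ) ^ S.card)⁻¹
                  * walshCoeff P (fun ω => f ω - f (flip i ω)) S ^ 2 := by
              refine Finset.sum_le_sum fun S _ => ?_
              rw [walshCoeff_sub_flip hP hf]
              split_ifs
              · refine mul_le_mul_of_nonneg_left ?_ (by positivity)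
                nlinarith [sq_nonneg (walshCoeff P f S)]
              · simp
            refine hle.trans (le_of_abs_le (abs_le_of_sq_le_sq (hb.trans ?_)
              (mul_nonneg (Real.sqrt_nonneg _) (J0 i))))
            rw [mul_pow, Real.sq_sqrt ((J0 i).trans (hδ i)), pow_succ']
            exact mul_le_mul_of_nonneg_right (hδ i) (sq_nonneg _)
        _ ≤ _ := by
            rw [← Finset.mul_sum]
            exact mul_le_mul_of_nonneg_left (hT B) (Real.sqrt_nonneg _)
    have : ∑ S ∈ A, (if S = ∅ then 0 else walshCoeff P f S ^ 2)
        ≤ (∑ S ∈ A, (S.card : ℝ) * walshCoeff P f S ^ 2) / k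
          + 3 ^ k * ∑ S ∈ A, (S.card : ℝ) * (((3 : ℝ) ^ S.card)⁻¹ * walshCoeff P f S ^ 2) := by
      rw [Finset.sum_div, Finset.mul_sum, ← Finset.sum_add_distrib]
      refine Finset.sum_le_sum fun S _ => ?_
      set q := walshCoeff P f S ^ 2
      have q0 : 0 ≤ q := sq_nonneg _
      split_ifs with hS
      · positivity
      have hc : (1 : ℝ) ≤ S.card := by
        exact_mod_cast Finset.card_pos.2 (Finset.nonempty_iff_ne_empty.2 hS)
      -- Frequencies up to level `k` lose `3^k` against the damped sum; those above gain `|S| / k ≥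
      -- 1` in the undamped one.
      by_cases hle : S.card ≤ k
      · have h3 : 1 ≤ (3 : ℝ) ^ k * ((3 : ℝ) ^ S.card)⁻¹ := by
          rw [← div_eq_mul_inv, one_le_div (by positivity)]
          exact pow_le_pow_right₀ (by norm_num) hle
        have h4 : q ≤ 3 ^ k * ((S.card : ℝ) * (((3 : ℝ) ^ S.card)⁻¹ * q)) := by
          have := mul_le_mul hc h3 zero_le_one (by positivity)
          nlinarith
        have : 0 ≤ (S.card : ℝ) * q / k := by positivity
        linarith
      · have h3 : (k : ℝ) ≤ S.card := by exact_mod_cast (not_le.1 hle).le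
        have h4 : q ≤ (S.card : ℝ) * q / k := by
          rw [le_div_iff₀ hk0]; nlinarith
        have : 0 ≤ 3 ^ k * ((S.card : ℝ) * (((3 : ℝ) ^ S.card)⁻¹ * q)) := by positivity
        linarith
    refine this.trans ?_
    have := div_le_div_of_nonneg_right high hk0.le
    have := mul_le_mul_of_nonneg_left low (by positivity : (0 : ℝ) ≤ 3 ^ k)
    nlinarith
  have hvar : variance f P = ∫ ω, f ω ^ 2 ∂P - (∫ ω, f ω ∂P) ^ 2 := by
    rw [variance_eq_sub]
    · simp
    · exact MemLp.of_bound hf.aestronglyMeasurable _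
        (Eventually.of_forall (fun ω => (ContinuousMap.norm_coe_le_norm ⟨f, hf⟩ ω)))
  refine le_of_forall_pos_le_add fun ε hε => ?_
  obtain ⟨A, hA⟩ := exists_integral_sq_le hP hf (Real.sqrt_pos.2 hε)
  rw [Real.sq_sqrt hε.le] at hA
  have h0 : walshCoeff P f ∅ = ∫ ω, f ω ∂P := by simp [walshCoeff, walsh]
  have : ∑ S ∈ A, walshCoeff P f S ^ 2
      ≤ ∑ S ∈ A, (if S = ∅ then 0 else walshCoeff P f S ^ 2) + (∫ ω, f ω ∂P) ^ 2 := by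
    have h2 : ∑ S ∈ A, walshCoeff P f S ^ 2
        = ∑ S ∈ A, (if S = ∅ then 0 else walshCoeff P f S ^ 2)
          + ∑ S ∈ A, (if S = ∅ then (∫ ω, f ω ∂P) ^ 2 else 0) := by
      rw [← Finset.sum_add_distrib]
      refine Finset.sum_congr rfl fun S _ => ?_
      split_ifs with h
      · rw [h, h0]; ring
      · ring
    rw [h2, Finset.sum_ite_eq']
    split_ifs
    · rfl
    · nlinarith [sq_nonneg (∫ ω, f ω ∂P)]
  have := hmain A
  rw [hvar]; linarith

end Walsh

/-! ### Flows on the lattice, summation by parts, and boundaries of balls. -/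

section Lattice

variable {d : ℕ}

lemma basisVec_same (i : Fin d) : basisVec i i = 1 := by simp [basisVec]

lemma basisVec_of_ne {i j : Fin d} (h : j ≠ i) : basisVec i j = 0 := by simp [basisVec, h]

lemma outflow_add (θ φ : Edge d → ℝ) (x : Vertex d) :
    outflow (θ + φ) x = outflow θ x + outflow φ x := by
  simp only [outflow, ← Finset.sum_add_distrib]
  exact Finset.sum_congr rfl fun i _ => by simp; ring

lemma outflow_smul (c : ℝ) (θ : Edge d → ℝ) (x : Vertex d) :
    outflow (c • θ) x = c * outflow θ x := by
  simp only [outflow, Finset.mul_sum]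
  exact Finset.sum_congr rfl fun i _ => by simp; ring

lemma outflow_neg (θ : Edge d → ℝ) (x : Vertex d) : outflow (-θ) x = -outflow θ x := by
  have := outflow_smul (-1) θ x; simpa using this

lemma outflow_sub (θ φ : Edge d → ℝ) (x : Vertex d) :
    outflow (θ - φ) x = outflow θ x - outflow φ x := by
  rw [sub_eq_add_neg, outflow_add, outflow_neg]; ring

lemma outflow_sum {κ : Type*} (A : Finset κ) (θ : κ → Edge d → ℝ) (x : Vertex d) :
    outflow (∑ k ∈ A, θ k) x = ∑ k ∈ A, outflow (θ k) x := by
  classical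
  induction A using Finset.induction_on with
  | empty => simp [outflow]
  | insert k A hk ih => rw [Finset.sum_insert hk, Finset.sum_insert hk, outflow_add, ih]

/-- The point mass at `x`. -/
def pointMass (x z : Vertex d) : ℝ := if z = x then 1 else 0

/-- In divergence form the flow conditions are linear, so flows can be concatenated, reversed and
perturbed by adding functions. -/
lemma isUnitFlow_iff {x y : Vertex d} (hxy : x ≠ y) {θ : Edge d → ℝ} :
    IsUnitFlow x y θ ↔ ∀ z, outflow θ z = pointMass x z - pointMass y z := by
  constructor
  · intro h z
    by_cases hx : z = x
    · subst hx; simp [pointMass, hxy, h.source]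
    by_cases hy : z = y
    · subst hy; simp [pointMass, hx]; linarith [h.sink]
    simp [pointMass, hx, hy, h.node_law z hx hy]
  · intro h
    refine ⟨fun z hx hy => by simp [h, pointMass, hx, hy], by simp [h, pointMass, hxy], ?_⟩
    simp [h, pointMass, hxy.symm]

/-- Summation by parts. -/
lemma tsum_mul_outflow (θ : Edge d → ℝ) {k : Vertex d → ℝ} (hk : k.support.Finite) :
    ∑' x, k x * outflow θ x = ∑ i, ∑' x, θ (x, i) * (k x - k (x + basisVec i)) := by
  have s1 : ∀ φ : Vertex d → ℝ, Summable fun x => k x * φ x := fun φ =>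
    summable_of_hasFiniteSupport (hk.subset fun x hx => by
      simp only [Function.mem_support] at hx ⊢; exact left_ne_zero_of_mul hx)
  have s2 : ∀ (i) (φ : Vertex d → ℝ), Summable fun x => k (x + basisVec i) * φ x := fun i φ => by
    rw [← (Equiv.subRight (basisVec i)).summable_iff]
    simpa [Function.comp_def] using s1 fun x => φ (x - basisVec i)
  have e1 : ∀ x, k x * outflow θ x
      = ∑ i, (k x * θ (x, i) - k x * θ (x - basisVec i, i)) := fun x => by
    rw [outflow, Finset.mul_sum]
    exact Finset.sum_congr rfl fun i _ => by ring
  simp only [e1]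
  rw [Summable.tsum_finsetSum fun i _ => (s1 _).sub (s1 _)]
  refine Finset.sum_congr rfl fun i _ => ?_
  rw [(s1 _).tsum_sub (s1 _)]
  have e2 : ∑' x, k x * θ (x - basisVec i, i) = ∑' x, k (x + basisVec i) * θ (x, i) := by
    rw [← (Equiv.addRight (basisVec i)).tsum_eq]; simp
  rw [e2, ← (s1 _).tsum_sub (s2 i _)]
  exact tsum_congr fun x => by ring

/-- The sup-norm ball of radius `N`. -/
noncomputable def box (d N : ℕ) : Finset (Vertex d) := Fintype.piFinset fun _ => Finset.Icc (-(N : ℤ)) N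

lemma mem_box {N : ℕ} {x : Vertex d} : x ∈ box d N ↔ ∀ j, -(N : ℤ) ≤ x j ∧ x j ≤ N := by
  simp [box]

lemma box_mono {N M : ℕ} (h : N ≤ M) : box d N ⊆ box d M := fun x hx => by
  rw [mem_box] at hx ⊢
  intro j; have := hx j; omega

lemma add_basisVec_mem_box {N : ℕ} {x : Vertex d} (i : Fin d) (h : x ∈ box d N) :
    x + basisVec i ∈ box d (N + 1) := by
  rw [mem_box] at h ⊢
  intro j
  have := h j
  by_cases hj : j = i
  · subst hj; simp only [Pi.add_apply, basisVec_same]; push_cast; omega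
  · simp only [Pi.add_apply, basisVec_of_ne hj]; push_cast; omega

lemma mem_box_of_add_basisVec {N : ℕ} {x : Vertex d} (i : Fin d) (h : x + basisVec i ∈ box d N) :
    x ∈ box d (N + 1) := by
  rw [mem_box] at h ⊢
  intro j
  have := h j
  by_cases hj : j = i
  · subst hj; simp only [Pi.add_apply, basisVec_same] at this; push_cast; omega
  · simp only [Pi.add_apply, basisVec_of_ne hj] at this; push_cast; omega

/-- The edges with exactly one endpoint in the ball of radius `N`. -/
noncomputable def boxBdry (d N : ℕ) : Finset (Edge d) :=
  {e ∈ box d (N + 1) ×ˢ Finset.univ | ¬(e.1 ∈ box d N ↔ e.1 + basisVec e.2 ∈ box d N)}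

lemma mem_boxBdry {N : ℕ} {e : Edge d} :
    e ∈ boxBdry d N ↔ ¬(e.1 ∈ box d N ↔ e.1 + basisVec e.2 ∈ box d N) := by
  simp only [boxBdry, Finset.mem_filter, Finset.mem_product, Finset.mem_univ, and_true,
    and_iff_right_iff_imp]
  intro h
  by_cases h1 : e.1 ∈ box d N
  · exact box_mono (Nat.le_succ N) h1
  · exact mem_box_of_add_basisVec e.2 (by tauto)

/-- Both endpoints of an edge leaving the smaller ball lie in the next ball, hence in the larger
one. Disjointness lets the energies of the cutsets be added. -/
lemma disjoint_boxBdry {N M : ℕ} (h : N ≠ M) : Disjoint (boxBdry d N) (boxBdry d M) := by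
  have key : ∀ {N M : ℕ}, N < M → Disjoint (boxBdry d N) (boxBdry d M) := by
    intro N M hNM
    rw [Finset.disjoint_left]
    intro e he he'
    rw [mem_boxBdry] at he he'
    have hM : box d (N + 1) ⊆ box d M := box_mono hNM
    apply he'
    by_cases h1 : e.1 ∈ box d N
    · exact iff_of_true (hM (box_mono (Nat.le_succ N) h1)) (hM (add_basisVec_mem_box _ h1))
    · have h2 : e.1 + basisVec e.2 ∈ box d N := by tauto
      exact iff_of_true (hM (mem_box_of_add_basisVec _ h2)) (hM (box_mono (Nat.le_succ N) h2))
  rcases lt_or_gt_of_ne h with h | h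
  · exact key h
  · exact (key h).symm

lemma card_piFinset_ite (i : Fin d) (t : ℤ) (I : Fin d → Finset ℤ) {K : ℕ}
    (hI : ∀ j, (I j).card = K) :
    (Fintype.piFinset fun j => if j = i then {t} else I j).card = K ^ (d - 1) := by
  rw [Fintype.card_piFinset, ← Finset.mul_prod_erase _ _ (Finset.mem_univ i),
    Finset.prod_congr rfl (g := fun _ => K)]
  · simp [Finset.card_erase_of_mem]
  · intro j hj; simp [Finset.ne_of_mem_erase hj, hI]

lemma card_boxBdry_le (d N : ℕ) :
    ((boxBdry d N).card : ℝ) ≤ d * 2 ^ d * ((N : ℝ) + 1) ^ (d - 1) := by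
  -- A boundary edge in direction `i` starts at `i`-th coordinate `N` or `-N - 1`: these are two
  -- faces, with `(2N+1)^{d-1}` edges each.
  let Q : Fin d → ℤ → Finset (Edge d) := fun i t =>
    (Fintype.piFinset fun j => if j = i then {t} else Finset.Icc (-(N : ℤ)) N).image (·, i)
  have hsub : boxBdry d N ⊆ Finset.univ.biUnion fun i => Q i N ∪ Q i (-(N : ℤ) - 1) := by
    intro ⟨x, i⟩ he
    rw [mem_boxBdry] at he
    simp only [Finset.mem_biUnion, Finset.mem_univ, true_and]
    refine ⟨i, ?_⟩
    simp only [Finset.mem_union, Q, Finset.mem_image, Fintype.mem_piFinset, Prod.mk.injEq,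
      and_true, exists_eq_right]
    simp only [mem_box] at he
    have hj : ∀ j, j ≠ i → (x + basisVec i) j = x j := fun j hj => by simp [basisVec_of_ne hj]
    have hi : (x + basisVec i) i = x i + 1 := by simp [basisVec_same]
    by_cases h1 : ∀ j, -(N : ℤ) ≤ x j ∧ x j ≤ N
    · left
      have h2 : ¬∀ j, -(N : ℤ) ≤ (x + basisVec i) j ∧ (x + basisVec i) j ≤ N := by tauto
      intro j
      split_ifs with hji
      · subst hji
        by_contra hne
        apply h2
        intro l
        have := h1 l
        by_cases hl : l = j
        · subst hl; rw [hi]; simp at hne; omega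
        · rw [hj l hl]; exact this
      · simpa using h1 j
    · right
      have h2 : ∀ j, -(N : ℤ) ≤ (x + basisVec i) j ∧ (x + basisVec i) j ≤ N := by
        by_contra h2; exact he (iff_of_false h1 h2)
      intro j
      split_ifs with hji
      · subst hji
        by_contra hne
        apply h1
        intro l
        have := h2 l
        by_cases hl : l = j
        · subst hl; rw [hi] at this; simp at hne; omega
        · rwa [hj l hl] at this
      · have := h2 j
        rw [hj j hji] at this
        simpa using this
  have hQ : ∀ i t, (Q i t).card ≤ (2 * N + 1) ^ (d - 1) := fun i t => by
    refine Finset.card_image_le.trans (le_of_eq ?_)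
    rw [card_piFinset_ite i t (fun _ => Finset.Icc (-(N : ℤ)) N) fun _ => rfl]
    congr 1; rw [Int.card_Icc]; omega
  have h1 : (boxBdry d N).card ≤ d * (2 * (2 * N + 1) ^ (d - 1)) := by
    refine (Finset.card_le_card hsub).trans ((Finset.card_biUnion_le_card_mul _ _
      (2 * (2 * N + 1) ^ (d - 1)) fun i _ => ?_).trans (by simp))
    refine (Finset.card_union_le _ _).trans ?_
    have := hQ i N
    have := hQ i (-(N : ℤ) - 1)
    omega
  have h2 : 2 * (2 * N + 1) ^ (d - 1) ≤ 2 * (2 * (N + 1)) ^ (d - 1) := by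
    gcongr; omega
  rcases Nat.eq_zero_or_pos d with hd | hd
  · subst hd; simp at h1; simp [h1]
  have h3 : (boxBdry d N).card ≤ d * 2 ^ d * (N + 1) ^ (d - 1) := by
    refine h1.trans ((Nat.mul_le_mul_left d h2).trans (le_of_eq ?_))
    obtain ⟨m, rfl⟩ : ∃ m, d = m + 1 := ⟨d - 1, by omega⟩
    simp only [Nat.add_sub_cancel, mul_pow, pow_succ]; ring
  exact_mod_cast h3

/-- Testing a flow against a bounded function cut off outside a ball. -/
lemma sum_box_mul_outflow_ge (θ : Edge d → ℝ) {k : Vertex d → ℝ} {K : ℝ} (h0 : ∀ x, 0 ≤ k x)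
    (hK : ∀ x, k x ≤ K) (N : ℕ) {A : Finset (Edge d)}
    (hA : ∀ e ∈ A, e.1 ∈ box d N ∧ e.1 + basisVec e.2 ∈ box d N)
    (hpos : ∀ e : Edge d, 0 ≤ θ e * (k e.1 - k (e.1 + basisVec e.2))) :
    ∑ e ∈ A, θ e * (k e.1 - k (e.1 + basisVec e.2)) - K * ∑ e ∈ boxBdry d N, |θ e|
      ≤ ∑ x ∈ box d N, k x * outflow θ x := by
  classical
  -- After summation by parts with the truncated function, interior edges give the nonnegative terms
  -- of `hpos`, exterior edges give zero, and a boundary edge costs at most `K |θ e|`.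
  let k' : Vertex d → ℝ := fun x => if x ∈ box d N then k x else 0
  have hfin : k'.support.Finite := (box d N).finite_toSet.subset fun x hx => by
    by_contra h
    simp only [Finset.mem_coe] at h
    exact hx (if_neg h)
  have e0 : ∑ x ∈ box d N, k x * outflow θ x = ∑' x, k' x * outflow θ x := by
    rw [tsum_eq_sum (s := box d N)]
    · exact Finset.sum_congr rfl fun x hx => by simp [k', hx]
    · intro x hx; simp [k', hx]
  rw [e0, tsum_mul_outflow θ hfin]
  have e1 : ∀ i, ∑' x, θ (x, i) * (k' x - k' (x + basisVec i))
      = ∑ x ∈ box d (N + 1), θ (x, i) * (k' x - k' (x + basisVec i)) := fun i => by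
    refine tsum_eq_sum fun x hx => ?_
    have h1 : x ∉ box d N := fun h => hx (box_mono (Nat.le_succ N) h)
    have h2 : x + basisVec i ∉ box d N := fun h => hx (mem_box_of_add_basisVec i h)
    simp [k', h1, h2]
  simp only [e1]
  rw [Finset.sum_comm, ← Finset.sum_product' (box d (N + 1)) Finset.univ
    (fun x i => θ (x, i) * (k' x - k' (x + basisVec i)))]
  have hA' : A ⊆ box d (N + 1) ×ˢ Finset.univ := fun e he => by
    simpa using box_mono (Nat.le_succ N) (hA e he).1
  have hB' : boxBdry d N ⊆ box d (N + 1) ×ˢ Finset.univ := Finset.filter_subset _ _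
  have r1 : ∑ e ∈ A, θ e * (k e.1 - k (e.1 + basisVec e.2))
      = ∑ e ∈ box d (N + 1) ×ˢ Finset.univ,
        if e ∈ A then θ e * (k e.1 - k (e.1 + basisVec e.2)) else 0 := by
    rw [← Finset.sum_filter, Finset.filter_mem_eq_inter, Finset.inter_eq_right.2 hA']
  have r2 : K * ∑ e ∈ boxBdry d N, |θ e|
      = ∑ e ∈ box d (N + 1) ×ˢ Finset.univ, if e ∈ boxBdry d N then K * |θ e| else 0 := by
    rw [← Finset.sum_filter, Finset.filter_mem_eq_inter, Finset.inter_eq_right.2 hB',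
      Finset.mul_sum]
  rw [r1, r2, ← Finset.sum_sub_distrib]
  refine Finset.sum_le_sum fun e _ => ?_
  have hp := hpos e
  have hKK : 0 ≤ K := (h0 0).trans (hK 0)
  by_cases hb : e ∈ boxBdry d N
  · have hnA : e ∉ A := fun h => mem_boxBdry.1 hb (iff_of_true (hA e h).1 (hA e h).2)
    rw [if_neg hnA, if_pos hb, zero_sub]
    refine (neg_le_neg ?_).trans (neg_abs_le _)
    rw [abs_mul, mul_comm K]
    refine mul_le_mul_of_nonneg_left ?_ (abs_nonneg _)
    rw [mem_boxBdry] at hb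
    by_cases h1 : e.1 ∈ box d N
    · have h2 : e.1 + basisVec e.2 ∉ box d N := by tauto
      simp only [k', h1, h2, if_true, if_false, sub_zero]
      rw [abs_of_nonneg (h0 _)]; exact hK _
    · have h2 : e.1 + basisVec e.2 ∈ box d N := by tauto
      simp only [k', h1, h2, if_true, if_false, zero_sub, abs_neg]
      rw [abs_of_nonneg (h0 _)]; exact hK _
  · rw [if_neg hb, sub_zero]
    rw [mem_boxBdry, not_not] at hb
    by_cases h1 : e.1 ∈ box d N
    · simp only [k', h1, hb.1 h1, if_true]
      split_ifs
      · exact le_rfl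
      · exact hp
    · have h2 : e.1 + basisVec e.2 ∉ box d N := fun h => h1 (hb.2 h)
      have hnA : e ∉ A := fun h => h1 (hA e h).1
      simp [k', h1, h2, hnA]

lemma sum_box_mul_pointMass {N : ℕ} {x : Vertex d} (hx : x ∈ box d N) (k : Vertex d → ℝ) :
    ∑ z ∈ box d N, k z * pointMass x z = k x := by
  simp [pointMass, hx]

/-- A constant test function sees only the boundary edges. The flow is reversed because the test
inequality is a lower bound on the total divergence, which is then `-1`. -/
lemma one_le_sum_boxBdry {v : Vertex d} {θ : Edge d → ℝ} (hv : (0 : Vertex d) ≠ v)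
    (hθ : IsUnitFlow 0 v θ) {N : ℕ} (hN : v ∉ box d N) : 1 ≤ ∑ e ∈ boxBdry d N, |θ e| := by
  have h := sum_box_mul_outflow_ge (-θ) (k := fun _ => 1) (K := 1) (fun _ => zero_le_one)
    (fun _ => le_rfl) N (A := ∅) (by simp) (by simp)
  have h0 : (0 : Vertex d) ∈ box d N := by simp [mem_box]
  have e1 : ∑ x ∈ box d N, (1 : ℝ) * outflow (-θ) x = -1 := by
    simp only [one_mul, outflow_neg, (isUnitFlow_iff hv).1 hθ, Finset.sum_neg_distrib,
      Finset.sum_sub_distrib]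
    simp [pointMass, h0, hN]
  rw [e1] at h
  simp at h; linarith

end Lattice

/-! ### Lower bounds on the energy from disjoint cutsets. -/

section Cutsets

variable {d : ℕ} {p : ℝ}

/-- Hölder on a cutset of at most `d 2^d (N+1)^{d-1}` edges: a given flux costs least when spread
evenly. -/
lemma sum_boxBdry_rpow_ge (hd : 1 ≤ d) (hp : 1 < p) (θ : Edge d → ℝ) (N : ℕ) :
    ((d : ℝ) * 2 ^ d) ^ (-(p - 1)) * ((N : ℝ) + 1) ^ (-(((d : ℝ) - 1) * (p - 1)))
      * (∑ e ∈ boxBdry d N, |θ e|) ^ p ≤ ∑ e ∈ boxBdry d N, |θ e| ^ p := by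
  have hd0 : (0 : ℝ) < d := by exact_mod_cast hd
  have h1 := Real.rpow_sum_le_const_mul_sum_rpow (boxBdry d N) θ hp.le
  have hS : 0 ≤ ∑ e ∈ boxBdry d N, |θ e| ^ p :=
    Finset.sum_nonneg fun _ _ => Real.rpow_nonneg (abs_nonneg _) _
  have hX : (0 : ℝ) < d * 2 ^ d * ((N : ℝ) + 1) ^ (d - 1) := by positivity
  have h2 : (∑ e ∈ boxBdry d N, |θ e|) ^ p
      ≤ (d * 2 ^ d * ((N : ℝ) + 1) ^ (d - 1)) ^ (p - 1) * ∑ e ∈ boxBdry d N, |θ e| ^ p := by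
    refine h1.trans (mul_le_mul_of_nonneg_right ?_ hS)
    exact Real.rpow_le_rpow (Nat.cast_nonneg _) (card_boxBdry_le d N) (by linarith)
  have h3 : ((d : ℝ) * 2 ^ d) ^ (-(p - 1)) * ((N : ℝ) + 1) ^ (-(((d : ℝ) - 1) * (p - 1)))
      = (d * 2 ^ d * ((N : ℝ) + 1) ^ (d - 1)) ^ (-(p - 1)) := by
    rw [Real.mul_rpow (x := (d : ℝ) * 2 ^ d) (by positivity) (by positivity),
      ← Real.rpow_natCast ((N : ℝ) + 1),
      ← Real.rpow_mul (by positivity)]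
    congr 2; rw [Nat.cast_sub hd]; push_cast; ring
  rw [h3, Real.rpow_neg hX.le, inv_mul_le_iff₀ (Real.rpow_pos_of_pos hX _)]
  exact h2

lemma sum_sum_boxBdry_le {θ : Edge d → ℝ} (hs : Summable fun e => |θ e| ^ p) (I : Finset ℕ) :
    ∑ N ∈ I, ∑ e ∈ boxBdry d N, |θ e| ^ p ≤ ∑' e, |θ e| ^ p := by
  classical
  rw [← Finset.sum_biUnion]
  · exact hs.sum_le_tsum _ fun _ _ => Real.rpow_nonneg (abs_nonneg _) _
  · intro N _ M _ h; exact disjoint_boxBdry h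

/-- The partial sums `∑_{j=1}^n j^{-s}`. -/
noncomputable def partialZeta (s : ℝ) (n : ℕ) : ℝ := ∑ j ∈ Finset.range n, ((j : ℝ) + 1) ^ (-s)

/-- The energy of a flow is at least the sum of the contributions of disjoint cutsets. -/
lemma partialZeta_le_tsum (hd : 1 ≤ d) (hp : 1 < p) {v : Vertex d} (hv : (0 : Vertex d) ≠ v)
    {θ : Edge d → ℝ} (hθ : IsUnitFlow 0 v θ) (hs : Summable fun e => |θ e| ^ p) {M : ℕ}
    (hM : ∀ N < M, v ∉ box d N) :
    ((d : ℝ) * 2 ^ d) ^ (-(p - 1)) * partialZeta (((d : ℝ) - 1) * (p - 1)) M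
      ≤ ∑' e, |θ e| ^ p := by
  refine le_trans ?_ (sum_sum_boxBdry_le hs (Finset.range M))
  rw [partialZeta, Finset.mul_sum]
  refine Finset.sum_le_sum fun N hN => ?_
  refine le_trans ?_ (sum_boxBdry_rpow_ge hd hp θ N)
  have h1 := one_le_sum_boxBdry hv hθ (hM N (Finset.mem_range.1 hN))
  have h2 : 1 ≤ (∑ e ∈ boxBdry d N, |θ e|) ^ p := Real.one_le_rpow h1 (by linarith)
  have h3 : 0 ≤ ((d : ℝ) * 2 ^ d) ^ (-(p - 1)) * ((N : ℝ) + 1) ^ (-(((d : ℝ) - 1) * (p - 1))) :=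
    by positivity
  nlinarith

/-- In the recurrent regime a flow of finite energy has small flux through some large box. -/
lemma exists_sum_boxBdry_lt (hd : 1 ≤ d) (hp : 1 < p) (hdp : ((d : ℝ) - 1) * p ≤ d)
    {θ : Edge d → ℝ} (hs : Summable fun e => |θ e| ^ p) {ε : ℝ} (hε : 0 < ε) (N₀ : ℕ) :
    ∃ N, N₀ ≤ N ∧ ∑ e ∈ boxBdry d N, |θ e| < ε := by
  -- If the flux stayed at least `ε` from radius `N₀` on, the cutsets would dissipate a multiple of
  -- `∑ (N+1)^{-s}`, which diverges because `s ≤ 1`.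
  by_contra! hcon
  have hd0 : (0 : ℝ) < d := by exact_mod_cast hd
  set s := ((d : ℝ) - 1) * (p - 1) with hs'
  have hs1 : s ≤ 1 := by rw [hs']; linarith
  set c := ((d : ℝ) * 2 ^ d) ^ (-(p - 1)) * ε ^ p with hc
  have c0 : 0 < c := by positivity
  have hsum : Summable fun n : ℕ => c * (((n + N₀ : ℕ) : ℝ) + 1) ^ (-s) := by
    refine summable_of_sum_range_le (c := ∑' e, |θ e| ^ p) (fun n => by positivity) fun n => ?_
    refine le_trans ?_ (sum_sum_boxBdry_le hs (Finset.Ico N₀ (N₀ + n)))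
    rw [Finset.sum_Ico_eq_sum_range, Nat.add_sub_cancel_left]
    refine Finset.sum_le_sum fun j _ => ?_
    rw [add_comm j N₀]
    refine le_trans ?_ (sum_boxBdry_rpow_ge hd hp θ (N₀ + j))
    rw [hc, mul_right_comm]
    exact mul_le_mul_of_nonneg_left
      (Real.rpow_le_rpow hε.le (hcon _ (Nat.le_add_right _ _)) (by linarith)) (by positivity)
  rw [summable_mul_left_iff c0.ne'] at hsum
  have h2 : Summable fun n : ℕ => ((n : ℝ)) ^ (-s) := by
    rw [← summable_nat_add_iff (N₀ + 1)]
    refine hsum.congr fun n => ?_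
    push_cast; congr 1; ring
  rw [Real.summable_nat_rpow] at h2
  linarith

end Cutsets

/-! ### Explicit flows of nearly optimal energy. -/

section ProductFlow

variable {d : ℕ}

/-- The flow transporting the product of the masses `m j` to the product of the masses `m' j`, one
coordinate at a time; `g j` is a one-dimensional flow from `m j` to `m' j`. -/
def prodFlow (g m m' : Fin d → ℤ → ℝ) (e : Edge d) : ℝ :=
  g e.2 (e.1 e.2) * (∏ j with j < e.2, m' j (e.1 j)) * ∏ j with e.2 < j, m j (e.1 j)

/-- The difference of two products telescopes through hybrids in which the coordinates are replaced
one after the other; each summand is the divergence in one direction. -/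
lemma outflow_prodFlow {g m m' : Fin d → ℤ → ℝ}
    (h : ∀ j t, g j t - g j (t - 1) = m j t - m' j t) (x : Vertex d) :
    outflow (prodFlow g m m') x = ∏ j, m j (x j) - ∏ j, m' j (x j) := by
  have key := Finset.prod_sub_ordered Finset.univ (fun j => m j (x j))
    (fun j => m j (x j) - m' j (x j))
  simp only [sub_sub_cancel] at key
  rw [key, sub_sub_cancel, outflow]
  refine Finset.sum_congr rfl fun i _ => ?_
  simp only [prodFlow, Pi.sub_apply, basisVec_same]
  have h1 : ∀ j ∈ Finset.univ.filter (· < i), m' j (x j - basisVec i j) = m' j (x j) := by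
    intro j hj
    rw [basisVec_of_ne (Finset.mem_filter.1 hj).2.ne, sub_zero]
  have h2 : ∀ j ∈ Finset.univ.filter (i < ·), m j (x j - basisVec i j) = m j (x j) := by
    intro j hj
    rw [basisVec_of_ne (Finset.mem_filter.1 hj).2.ne', sub_zero]
  rw [Finset.prod_congr rfl h1, Finset.prod_congr rfl h2, ← h]
  ring

lemma abs_prodFlow_le {g m m' : Fin d → ℤ → ℝ} {γ β : ℝ} (hγ : ∀ j t, |g j t| ≤ γ)
    (hm : ∀ j t, |m j t| ≤ β) (hm' : ∀ j t, |m' j t| ≤ β) (e : Edge d) :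
    |prodFlow g m m' e| ≤ γ * β ^ (d - 1) := by
  have hγ0 : 0 ≤ γ := (abs_nonneg _).trans (hγ e.2 0)
  have hβ0 : 0 ≤ β := (abs_nonneg _).trans (hm e.2 0)
  have hcard : (Finset.univ.filter (· < e.2)).card + (Finset.univ.filter (e.2 < ·)).card
      = d - 1 := by
    rw [← Finset.card_union_of_disjoint]
    · have : Finset.univ.filter (· < e.2) ∪ Finset.univ.filter (e.2 < ·)
          = Finset.univ.erase e.2 := by
        ext j; simp [lt_or_lt_iff_ne]
      rw [this, Finset.card_erase_of_mem (Finset.mem_univ _)]; simp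
    · rw [Finset.disjoint_filter]; intro j _ h; exact h.not_gt
  rw [prodFlow, abs_mul, abs_mul, mul_assoc, ← hcard, pow_add, Finset.abs_prod, Finset.abs_prod]
  refine mul_le_mul (hγ _ _) (mul_le_mul ?_ ?_ (Finset.prod_nonneg fun _ _ => abs_nonneg _)
    (pow_nonneg hβ0 _)) ?_ hγ0
  · exact (Finset.prod_le_prod (fun _ _ => abs_nonneg _) fun j _ => hm' j _).trans (by simp)
  · exact (Finset.prod_le_prod (fun _ _ => abs_nonneg _) fun j _ => hm j _).trans (by simp)
  · exact mul_nonneg (Finset.prod_nonneg fun _ _ => abs_nonneg _)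
      (Finset.prod_nonneg fun _ _ => abs_nonneg _)

lemma mem_of_prodFlow_ne_zero {g m m' : Fin d → ℤ → ℝ} {e : Edge d}
    (h : prodFlow g m m' e ≠ 0) (j : Fin d) :
    g j (e.1 j) ≠ 0 ∧ j = e.2 ∨ m' j (e.1 j) ≠ 0 ∧ j < e.2 ∨ m j (e.1 j) ≠ 0 ∧ e.2 < j := by
  have h3 := right_ne_zero_of_mul h
  have h2 := right_ne_zero_of_mul (left_ne_zero_of_mul h)
  have h1 := left_ne_zero_of_mul (left_ne_zero_of_mul h)
  rw [Finset.prod_ne_zero_iff] at h2 h3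
  rcases lt_trichotomy j e.2 with hj | hj | hj
  · exact Or.inr (Or.inl ⟨h2 j (by simp [hj]), hj⟩)
  · exact Or.inl ⟨by rw [hj]; exact h1, hj⟩
  · exact Or.inr (Or.inr ⟨h3 j (by simp [hj]), hj⟩)

lemma energy_one_eq_sum {p : ℝ} (hp : 1 < p) {θ : Edge d → ℝ} {A : Finset (Edge d)}
    (hA : ∀ e ∉ A, θ e = 0) :
    energy p (fun _ => 1) θ = ENNReal.ofReal (∑ e ∈ A, |θ e| ^ p) := by
  rw [energy, tsum_eq_sum (s := A), ENNReal.ofReal_sum_of_nonneg]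
  · simp
  · intro e _; positivity
  · intro e he; rw [hA e he]; simp [Real.zero_rpow (by linarith : p ≠ 0)]

/-- The unit flow along the lattice path from `x` to `y` that adjusts the coordinates one after
the other. -/
def pathFlow (x y : Vertex d) : Edge d → ℝ :=
  prodFlow (fun j t => (if x j ≤ t then 1 else 0) - (if y j ≤ t then 1 else 0))
    (fun j t => if t = x j then 1 else 0) (fun j t => if t = y j then 1 else 0)

lemma prod_ite_eq_pointMass (x z : Vertex d) :
    ∏ j, (if z j = x j then (1 : ℝ) else 0) = pointMass x z := by
  rw [pointMass, Finset.prod_ite_zero]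
  simp [funext_iff]

lemma outflow_pathFlow (x y z : Vertex d) :
    outflow (pathFlow x y) z = pointMass x z - pointMass y z := by
  rw [pathFlow, outflow_prodFlow, prod_ite_eq_pointMass, prod_ite_eq_pointMass]
  intro j t
  have : ∀ c : ℤ, (if t = c then (1 : ℝ) else 0)
      = (if c ≤ t then 1 else 0) - (if c ≤ t - 1 then 1 else 0) := by
    intro c
    rcases lt_trichotomy t c with h | h | h
    · rw [if_neg h.ne, if_neg (by omega), if_neg (by omega)]; simp
    · rw [if_pos h, if_pos (by omega), if_neg (by omega)]; simp
    · rw [if_neg h.ne', if_pos (by omega), if_pos (by omega)]; simp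
  rw [this, this]; ring

lemma abs_pathFlow_le_one (x y : Vertex d) (e : Edge d) : |pathFlow x y e| ≤ 1 := by
  refine (abs_prodFlow_le (γ := 1) (β := 1) ?_ ?_ ?_ e).trans (by simp)
  all_goals intro j t; split_ifs <;> simp

lemma exists_pathFlow_support (x y : Vertex d) :
    ∃ A : Finset (Edge d), A.card ≤ l1norm (x - y) ∧ ∀ e ∉ A, pathFlow x y e = 0 := by
  classical
  -- While coordinate `i` moves, the earlier coordinates already agree with `y` and the later ones
  -- still agree with `x`.
  let w : Fin d → ℤ → Edge d := fun i t =>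
    (fun j => if j < i then y j else if j = i then t else x j, i)
  refine ⟨Finset.univ.biUnion fun i =>
    (Finset.Ico (min (x i) (y i)) (max (x i) (y i))).image (w i), ?_, ?_⟩
  · refine Finset.card_biUnion_le.trans (Finset.sum_le_sum fun i _ => ?_)
    refine Finset.card_image_le.trans ?_
    rw [Int.card_Ico, Pi.sub_apply]; omega
  · intro e he
    by_contra hne
    apply he
    have h := mem_of_prodFlow_ne_zero hne
    rw [Finset.mem_biUnion]
    refine ⟨e.2, Finset.mem_univ _, Finset.mem_image.2 ⟨e.1 e.2, ?_, ?_⟩⟩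
    · rcases h e.2 with h1 | h1 | h1
      · have := h1.1
        rw [Finset.mem_Ico]
        split_ifs at this <;> first | omega | simp at this
      · exact absurd h1.2 (lt_irrefl _)
      · exact absurd h1.2 (lt_irrefl _)
    · refine Prod.ext (funext fun j => ?_) rfl
      simp only [w]
      rcases h j with ⟨_, h1⟩ | ⟨h0, h1⟩ | ⟨h0, h1⟩
      · simp [h1]
      · rw [if_pos h1]; by_contra hc; exact h0 (if_neg (Ne.symm hc))
      · rw [if_neg h1.not_gt, if_neg h1.ne']; by_contra hc; exact h0 (if_neg (Ne.symm hc))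

lemma energy_pathFlow_le {p : ℝ} (hp : 1 < p) (x y : Vertex d) :
    energy p (fun _ => 1) (pathFlow x y) ≤ ENNReal.ofReal (l1norm (x - y)) := by
  obtain ⟨A, hA, h0⟩ := exists_pathFlow_support x y
  rw [energy_one_eq_sum hp h0]
  refine ENNReal.ofReal_le_ofReal ?_
  calc ∑ e ∈ A, |pathFlow x y e| ^ p ≤ ∑ e ∈ A, (1 : ℝ) :=
        Finset.sum_le_sum fun e _ =>
          Real.rpow_le_one (abs_nonneg _) (abs_pathFlow_le_one x y e) (by linarith)
    _ = A.card := by simp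
    _ ≤ _ := by exact_mod_cast hA

/-- The uniform density on the integer interval `[c, c + k)`. -/
noncomputable def unifDensity (c : ℤ) (k : ℕ) (t : ℤ) : ℝ :=
  if c ≤ t ∧ t < c + k then (k : ℝ)⁻¹ else 0

/-- The distribution function of the uniform law on `[c, c + k)`. -/
noncomputable def unifCdf (c : ℤ) (k : ℕ) (t : ℤ) : ℝ := max 0 (min 1 (((t : ℝ) - c + 1) / k))

lemma unifCdf_of_lt {c : ℤ} {k : ℕ} {t : ℤ} (h : t < c) : unifCdf c k t = 0 := by
  have h1 : (t : ℝ) - c + 1 ≤ 0 := by exact_mod_cast (by omega : t - c + 1 ≤ 0)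
  have h2 : ((t : ℝ) - c + 1) / k ≤ 0 := div_nonpos_of_nonpos_of_nonneg h1 (Nat.cast_nonneg _)
  rw [unifCdf, max_eq_left ((min_le_right _ _).trans h2)]

lemma unifCdf_of_ge {c : ℤ} {k : ℕ} {t : ℤ} (hk : 1 ≤ k) (h : c + k ≤ t + 1) :
    unifCdf c k t = 1 := by
  have hk0 : (0 : ℝ) < k := by exact_mod_cast hk
  have h1 : (k : ℝ) ≤ (t : ℝ) - c + 1 := by exact_mod_cast (by omega : (k : ℤ) ≤ t - c + 1)
  rw [unifCdf, min_eq_left ((one_le_div hk0).2 h1)]; simp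

lemma unifCdf_of_mem {c : ℤ} {k : ℕ} {t : ℤ} (hk : 1 ≤ k) (h : c ≤ t + 1) (h' : t + 1 ≤ c + k) :
    unifCdf c k t = ((t : ℝ) - c + 1) / k := by
  have hk0 : (0 : ℝ) < k := by exact_mod_cast hk
  have h1 : (t : ℝ) - c + 1 ≤ k := by exact_mod_cast (by omega : t - c + 1 ≤ (k : ℤ))
  have h2 : (0 : ℝ) ≤ (t : ℝ) - c + 1 := by exact_mod_cast (by omega : 0 ≤ t - c + 1)
  rw [unifCdf, min_eq_right ((div_le_one hk0).2 h1), max_eq_right (by positivity)]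

lemma unifCdf_sub {k : ℕ} (hk : 1 ≤ k) (c t : ℤ) :
    unifCdf c k t - unifCdf c k (t - 1) = unifDensity c k t := by
  unfold unifDensity
  by_cases h1 : t < c
  · rw [unifCdf_of_lt h1, unifCdf_of_lt (by omega), if_neg (by omega)]; simp
  by_cases h2 : c + k ≤ t
  · rw [unifCdf_of_ge hk (by omega), unifCdf_of_ge hk (by omega), if_neg (by omega)]; simp
  · rw [unifCdf_of_mem hk (by omega) (by omega), unifCdf_of_mem hk (by omega) (by omega),
      if_pos (by omega)]
    push_cast; ring

lemma abs_unifDensity_le (c : ℤ) (k : ℕ) (t : ℤ) : |unifDensity c k t| ≤ (k : ℝ)⁻¹ := by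
  unfold unifDensity
  split_ifs
  · rw [abs_of_nonneg (by positivity)]
  · simp

lemma unifCdf_nonneg (c : ℤ) (k : ℕ) (t : ℤ) : 0 ≤ unifCdf c k t := le_max_left _ _

lemma unifCdf_le_one (c : ℤ) (k : ℕ) (t : ℤ) : unifCdf c k t ≤ 1 :=
  max_le zero_le_one (min_le_left _ _)

lemma mem_of_unifDensity_ne_zero {c : ℤ} {k : ℕ} {t : ℤ} (h : unifDensity c k t ≠ 0) :
    c ≤ t ∧ t < c + k := by
  by_contra hc; exact h (if_neg hc)

/-- Lengthening the interval by one site moves little mass. The bound `1/k`, instead of the trivial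
`1`, is what makes one growth step carry at most `k^{-d}` per edge. -/
lemma unifCdf_sub_succ {k : ℕ} (hk : 1 ≤ k) (c t : ℤ) :
    |unifCdf c k t - unifCdf c (k + 1) t| ≤ (k : ℝ)⁻¹ ∧
      (unifCdf c k t - unifCdf c (k + 1) t ≠ 0 → c ≤ t ∧ t < c + k) := by
  by_cases h1 : t < c
  · rw [unifCdf_of_lt h1, unifCdf_of_lt h1]; simp
  by_cases h2 : c + k ≤ t
  · rw [unifCdf_of_ge hk (by omega), unifCdf_of_ge (by omega) (by push_cast; omega)]; simp
  refine ⟨?_, fun _ => by omega⟩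
  rw [unifCdf_of_mem hk (by omega) (by omega),
    unifCdf_of_mem (by omega) (by omega) (by push_cast; omega)]
  have hk0 : (0 : ℝ) < k := by exact_mod_cast hk
  have h3 : (t : ℝ) - c + 1 ≤ k := by exact_mod_cast (by omega : t - c + 1 ≤ (k : ℤ))
  have h4 : (0 : ℝ) ≤ (t : ℝ) - c + 1 := by exact_mod_cast (by omega : 0 ≤ t - c + 1)
  have e : ((t : ℝ) - c + 1) / k - ((t : ℝ) - c + 1) / ((k + 1 : ℕ) : ℝ)
      = (k : ℝ)⁻¹ * (((t : ℝ) - c + 1) / (k + 1)) := by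
    push_cast; field_simp; ring
  rw [e, abs_of_nonneg (by positivity)]
  refine mul_le_of_le_one_right (by positivity) ?_
  rw [div_le_one (by positivity)]; linarith

/-- The flow from the uniform law on a cube of side `k` to the uniform law on the cube of side
`k + 1` with the same corner. -/
noncomputable def growFlow (c : Vertex d) (k : ℕ) : Edge d → ℝ :=
  prodFlow (fun j t => unifCdf (c j) k t - unifCdf (c j) (k + 1) t)
    (fun j => unifDensity (c j) k) (fun j => unifDensity (c j) (k + 1))

/-- The uniform law on a cube. -/
noncomputable def unifCube (c : Vertex d) (k : ℕ) (x : Vertex d) : ℝ :=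
  ∏ j, unifDensity (c j) k (x j)

lemma unifCube_one (c : Vertex d) : unifCube c 1 = pointMass c := by
  ext x
  rw [← prod_ite_eq_pointMass, unifCube]
  refine Finset.prod_congr rfl fun j _ => ?_
  unfold unifDensity
  by_cases h : x j = c j
  · simp [h]
  · rw [if_neg h, if_neg]; push_cast; omega

lemma outflow_growFlow (c : Vertex d) {k : ℕ} (hk : 1 ≤ k) (x : Vertex d) :
    outflow (growFlow c k) x = unifCube c k x - unifCube c (k + 1) x := by
  rw [growFlow, outflow_prodFlow]
  · rfl
  · intro j t
    rw [← unifCdf_sub hk, ← unifCdf_sub (by omega : 1 ≤ k + 1)]; ring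

lemma abs_growFlow_le (hd : 1 ≤ d) (c : Vertex d) {k : ℕ} (hk : 1 ≤ k) (e : Edge d) :
    |growFlow c k e| ≤ ((k : ℝ) ^ d)⁻¹ := by
  have hk0 : (0 : ℝ) < k := by exact_mod_cast hk
  refine (abs_prodFlow_le (γ := (k : ℝ)⁻¹) (β := (k : ℝ)⁻¹)
    (fun j t => (unifCdf_sub_succ hk _ _).1) (fun j t => abs_unifDensity_le _ _ _)
    (fun j t => (abs_unifDensity_le _ _ _).trans ?_) e).trans (le_of_eq ?_)
  · push_cast; gcongr; linarith
  · obtain ⟨m, rfl⟩ : ∃ m, d = m + 1 := ⟨d - 1, by omega⟩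
    rw [Nat.add_sub_cancel, ← pow_succ', inv_pow]

lemma mem_of_growFlow_ne_zero {c : Vertex d} {k : ℕ} (hk : 1 ≤ k) {e : Edge d}
    (h : growFlow c k e ≠ 0) (j : Fin d) : c j ≤ e.1 j ∧ e.1 j ≤ c j + k := by
  rcases mem_of_prodFlow_ne_zero h j with ⟨h1, -⟩ | ⟨h1, -⟩ | ⟨h1, -⟩
  · have := (unifCdf_sub_succ hk _ _).2 h1; omega
  · have := mem_of_unifDensity_ne_zero h1; push_cast at this; omega
  · have := mem_of_unifDensity_ne_zero h1; omega

/-- The flow from a point to the uniform law on the cube of side `N` with that corner. -/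
noncomputable def spreadFlow (c : Vertex d) (N : ℕ) : Edge d → ℝ :=
  ∑ k ∈ Finset.Ico 1 N, growFlow c k

lemma outflow_spreadFlow (c : Vertex d) {N : ℕ} (hN : 1 ≤ N) (x : Vertex d) :
    outflow (spreadFlow c N) x = pointMass c x - unifCube c N x := by
  rw [spreadFlow, outflow_sum, Finset.sum_congr rfl fun k hk =>
    outflow_growFlow c (Finset.mem_Ico.1 hk).1 x, ← unifCube_one]
  induction N, hN using Nat.le_induction with
  | base => simp
  | succ n hn ih => rw [Finset.sum_Ico_succ_top hn, ih]; ring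

/-- The sup-distance to the corner `c`, for points above `c`. -/
def cornerDist (c x : Vertex d) : ℕ := Finset.univ.sup fun j => (x j - c j).toNat

/-- Only the cubes of side `k ≥ ρ` reach an edge at distance `ρ`, and each contributes at most
`k^{-d}`; the tail of this series has order `ρ^{-(d-1)}`. -/
lemma abs_spreadFlow_le (hd : 2 ≤ d) (c : Vertex d) (N : ℕ) (e : Edge d) :
    |spreadFlow c N e| ≤ 2 ^ d * (((cornerDist c e.1 : ℝ) + 1) ^ (d - 1))⁻¹ := by
  set ρ := cornerDist c e.1 with hρ
  have hρ0 : (0 : ℝ) < (ρ : ℝ) + 1 := by positivity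
  obtain ⟨m, rfl⟩ : ∃ m, d = m + 2 := ⟨d - 2, by omega⟩
  -- Write `k^{-d} = k^{-m} k^{-2}` with `d = m + 2`, bound the first factor using `ρ + 1 ≤ 2k`, and
  -- sum only `k^{-2}`. The open interval encodes `k ≥ max 1 ρ`.
  have h1 : ∀ k ∈ Finset.Ico 1 N, |growFlow c k e|
      ≤ if k ∈ Finset.Ioo (max 1 ρ - 1) N then 2 ^ m * (((ρ : ℝ) + 1) ^ m)⁻¹ * ((k : ℝ) ^ 2)⁻¹
        else 0 := by
    intro k hk
    rw [Finset.mem_Ico] at hk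
    have hk0 : (0 : ℝ) < k := by exact_mod_cast hk.1
    split_ifs with hmem
    · rw [Finset.mem_Ioo] at hmem
      refine (abs_growFlow_le (by omega) c hk.1 e).trans ?_
      rw [pow_add, mul_inv]
      refine mul_le_mul_of_nonneg_right ?_ (by positivity)
      have h2 : (ρ : ℝ) + 1 ≤ 2 * k := by exact_mod_cast (by omega : ρ + 1 ≤ 2 * k)
      rw [← inv_inv ((2 : ℝ) ^ m), ← mul_inv]
      gcongr
      rw [inv_mul_le_iff₀ (by positivity), ← mul_pow]
      gcongr
    · have : growFlow c k e = 0 := by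
        by_contra hne
        have h3 := mem_of_growFlow_ne_zero hk.1 hne
        apply hmem
        rw [Finset.mem_Ioo]
        have : ρ ≤ k := Finset.sup_le fun j _ => by have := h3 j; omega
        omega
      rw [this, abs_zero]
  have h2 : |spreadFlow c N e| ≤ 2 ^ m * (((ρ : ℝ) + 1) ^ m)⁻¹
      * ∑ k ∈ Finset.Ioo (max 1 ρ - 1) N, ((k : ℝ) ^ 2)⁻¹ := by
    rw [spreadFlow, Finset.sum_apply]
    refine (Finset.abs_sum_le_sum_abs _ _).trans ((Finset.sum_le_sum h1).trans ?_)
    rw [← Finset.sum_filter, Finset.mul_sum]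
    refine Finset.sum_le_sum_of_subset_of_nonneg (fun k hk => (Finset.mem_filter.1 hk).2)
      fun k _ _ => by positivity
  refine h2.trans ?_
  have h3 : ∑ k ∈ Finset.Ioo (max 1 ρ - 1) N, ((k : ℝ) ^ 2)⁻¹ ≤ 4 * ((ρ : ℝ) + 1)⁻¹ := by
    refine (sum_Ioo_inv_sq_le _ _).trans ?_
    have : ((max 1 ρ - 1 : ℕ) : ℝ) + 1 = ((max 1 ρ : ℕ) : ℝ) := by
      exact_mod_cast (by omega : max 1 ρ - 1 + 1 = max 1 ρ)
    rw [this, ← div_eq_mul_inv, div_le_div_iff₀ (by positivity) hρ0]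
    have : (ρ : ℝ) + 1 ≤ 2 * (max 1 ρ : ℕ) := by
      exact_mod_cast (by omega : ρ + 1 ≤ 2 * max 1 ρ)
    linarith
  calc _ ≤ 2 ^ m * (((ρ : ℝ) + 1) ^ m)⁻¹ * (4 * ((ρ : ℝ) + 1)⁻¹) := by gcongr
    _ = _ := by
      rw [show m + 2 - 1 = m + 1 from rfl, pow_succ ((ρ : ℝ) + 1), mul_inv]; ring

lemma mem_of_spreadFlow_ne_zero {c : Vertex d} {N : ℕ} {e : Edge d}
    (h : spreadFlow c N e ≠ 0) (j : Fin d) : c j ≤ e.1 j ∧ e.1 j < c j + N := by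
  rw [spreadFlow, Finset.sum_apply] at h
  obtain ⟨k, hk, hne⟩ := Finset.exists_ne_zero_of_sum_ne_zero h
  rw [Finset.mem_Ico] at hk
  have := mem_of_growFlow_ne_zero hk.1 hne j
  omega

lemma card_cornerDist_eq_le (hd : 1 ≤ d) (c : Vertex d) (A : Finset (Vertex d))
    (hA : ∀ x ∈ A, ∀ j, c j ≤ x j) (m : ℕ) :
    (A.filter fun x => cornerDist c x = m).card ≤ d * (m + 1) ^ (d - 1) := by
  classical
  have : Nonempty (Fin d) := ⟨⟨0, hd⟩⟩
  have hsub : (A.filter fun x => cornerDist c x = m) ⊆ Finset.univ.biUnion fun i =>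
      Fintype.piFinset fun j => if j = i then {c i + m} else Finset.Icc (c j) (c j + m) := by
    intro x hx
    obtain ⟨hxA, hxm⟩ := Finset.mem_filter.1 hx
    have hc := hA x hxA
    obtain ⟨i, -, hi⟩ := Finset.exists_mem_eq_sup Finset.univ Finset.univ_nonempty
      fun j => (x j - c j).toNat
    rw [← cornerDist, hxm] at hi
    have hle : ∀ j, (x j - c j).toNat ≤ m := fun j => by
      rw [← hxm]; exact Finset.le_sup (f := fun j => (x j - c j).toNat) (Finset.mem_univ j)
    rw [Finset.mem_biUnion]
    refine ⟨i, Finset.mem_univ _, Fintype.mem_piFinset.2 fun j => ?_⟩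
    split_ifs with hj
    · subst hj; have := hc j; rw [Finset.mem_singleton]; omega
    · have := hc j; have := hle j; rw [Finset.mem_Icc]; omega
  refine (Finset.card_le_card hsub).trans ((Finset.card_biUnion_le_card_mul _ _
    ((m + 1) ^ (d - 1)) fun i _ => ?_).trans (by simp))
  rw [card_piFinset_ite i _ _ (K := m + 1)]
  intro j; rw [Int.card_Icc]; omega

/-- There are `O((m+1)^{d-1})` edges at distance `m`, each dissipating `O((m+1)^{-(d-1)p})`; the
product of the two orders is `(m+1)^{-s}`. -/
lemma energy_spreadFlow_le {p : ℝ} (hp : 1 < p) (hd : 2 ≤ d) (c : Vertex d) (N : ℕ) :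
    energy p (fun _ => 1) (spreadFlow c N)
      ≤ ENNReal.ofReal (d ^ 2 * (2 ^ d) ^ p * partialZeta (((d : ℝ) - 1) * (p - 1)) N) := by
  classical
  set A : Finset (Vertex d) := Fintype.piFinset fun j => Finset.Ico (c j) (c j + N) with hAdef
  have hA : ∀ x ∈ A, ∀ j, c j ≤ x j ∧ x j < c j + N := fun x hx j => by
    simpa using Fintype.mem_piFinset.1 hx j
  have h0 : ∀ e ∉ A ×ˢ (Finset.univ : Finset (Fin d)), spreadFlow c N e = 0 := by
    intro e he
    by_contra hne
    apply he
    rw [Finset.mem_product]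
    exact ⟨Fintype.mem_piFinset.2 fun j =>
      Finset.mem_Ico.2 (mem_of_spreadFlow_ne_zero hne j), Finset.mem_univ _⟩
  rw [energy_one_eq_sum hp h0]
  refine ENNReal.ofReal_le_ofReal ?_
  set φ : ℕ → ℝ := fun m => (2 ^ d * (((m : ℝ) + 1) ^ (d - 1))⁻¹) ^ p with hφ
  have φ0 : ∀ m, 0 ≤ φ m := fun m => by positivity
  have hd1 : (1 : ℕ) ≤ d := by omega
  calc ∑ e ∈ A ×ˢ Finset.univ, |spreadFlow c N e| ^ p
      ≤ ∑ e ∈ A ×ˢ (Finset.univ : Finset (Fin d)), φ (cornerDist c e.1) :=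
        Finset.sum_le_sum fun e _ =>
          Real.rpow_le_rpow (abs_nonneg _) (abs_spreadFlow_le hd c N e) (by linarith)
    _ = d * ∑ x ∈ A, φ (cornerDist c x) := by
        rw [Finset.sum_product]; simp [Finset.mul_sum]
    _ = d * ∑ m ∈ Finset.range N, ∑ x ∈ A with cornerDist c x = m, φ (cornerDist c x) := by
        rw [Finset.sum_fiberwise_of_maps_to]
        intro x hx
        have : Nonempty (Fin d) := ⟨⟨0, hd1⟩⟩
        obtain ⟨i, -, hi⟩ := Finset.exists_mem_eq_sup Finset.univ Finset.univ_nonempty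
          fun j => (x j - c j).toNat
        rw [Finset.mem_range, cornerDist, hi]
        have := hA x hx i; omega
    _ ≤ d * ∑ m ∈ Finset.range N, (d * ((m : ℝ) + 1) ^ (d - 1)) * φ m := by
        refine mul_le_mul_of_nonneg_left (Finset.sum_le_sum fun m _ => ?_) (Nat.cast_nonneg _)
        rw [Finset.sum_congr rfl (g := fun _ => φ m)
          fun x hx => by rw [(Finset.mem_filter.1 hx).2], Finset.sum_const, nsmul_eq_mul]
        refine mul_le_mul_of_nonneg_right ?_ (φ0 m)
        exact_mod_cast card_cornerDist_eq_le hd1 c A (fun x hx j => (hA x hx j).1) m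
    _ = _ := by
        rw [partialZeta, Finset.mul_sum, Finset.mul_sum]
        refine Finset.sum_congr rfl fun m _ => ?_
        have hm : (0 : ℝ) < (m : ℝ) + 1 := by positivity
        rw [hφ]
        simp only
        rw [Real.mul_rpow (by positivity) (by positivity), ← Real.rpow_natCast ((m : ℝ) + 1),
          ← Real.rpow_neg hm.le, ← Real.rpow_mul hm.le]
        have : ((m : ℝ) + 1) ^ (-(((d : ℝ) - 1) * (p - 1)))
            = ((m : ℝ) + 1) ^ (((d - 1 : ℕ) : ℝ)) * ((m : ℝ) + 1) ^ (-((d - 1 : ℕ) : ℝ) * p) := by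
          rw [← Real.rpow_add hm]; congr 1; rw [Nat.cast_sub hd1]; push_cast; ring
        rw [this]; ring

/-- The flow between the uniform laws on two translates of a cube. -/
noncomputable def slideFlow (v : Vertex d) (N : ℕ) : Edge d → ℝ :=
  prodFlow (fun j t => unifCdf 0 N t - unifCdf (v j) N t)
    (fun _ => unifDensity 0 N) (fun j => unifDensity (v j) N)

lemma outflow_slideFlow (v : Vertex d) {N : ℕ} (hN : 1 ≤ N) (x : Vertex d) :
    outflow (slideFlow v N) x = unifCube 0 N x - unifCube v N x := by
  rw [slideFlow, outflow_prodFlow]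
  · rfl
  · intro j t
    rw [← unifCdf_sub hN, ← unifCdf_sub hN]; ring

lemma partialZeta_ge {s : ℝ} (hs : 0 ≤ s) {n : ℕ} (hn : 1 ≤ n) :
    (n : ℝ) ^ (1 - s) ≤ partialZeta s n := by
  have hn0 : (0 : ℝ) < n := by exact_mod_cast hn
  calc (n : ℝ) ^ (1 - s) = ∑ _j ∈ Finset.range n, (n : ℝ) ^ (-s) := by
        rw [Finset.sum_const, Finset.card_range, nsmul_eq_mul, sub_eq_add_neg,
          Real.rpow_add hn0, Real.rpow_one]
    _ ≤ _ := Finset.sum_le_sum fun j hj => by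
        refine Real.rpow_le_rpow_of_nonpos (by positivity) ?_ (by linarith)
        exact_mod_cast Finset.mem_range.1 hj

lemma natAbs_le_l1norm (v : Vertex d) (j : Fin d) : (v j).natAbs ≤ l1norm v :=
  Finset.single_le_sum (f := fun j => (v j).natAbs) (fun _ _ => Nat.zero_le _) (Finset.mem_univ j)

/-- With cubes of side `n = |v|`, the flow lives on `O(n^d)` edges and is at most `n^{-(d-1)}` on
each, so its energy is `O(n^{1-s})`. The `n` summands of `partialZeta s n` are all at least
`n^{-s}`, hence it dominates. -/
lemma energy_slideFlow_le {p : ℝ} (hp : 1 < p) (hd : 1 ≤ d) (v : Vertex d)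
    (hv : 1 ≤ l1norm v) :
    energy p (fun _ => 1) (slideFlow v (l1norm v))
      ≤ ENNReal.ofReal (d * 4 ^ d * partialZeta (((d : ℝ) - 1) * (p - 1)) (l1norm v)) := by
  classical
  set n := l1norm v with hn
  have hn0 : (0 : ℝ) < n := by exact_mod_cast hv
  have hd0 : (1 : ℝ) ≤ d := by exact_mod_cast hd
  set A : Finset (Vertex d) := Fintype.piFinset fun _ => Finset.Ico (-(n : ℤ)) (2 * n) with hAdef
  have h0 : ∀ e ∉ A ×ˢ (Finset.univ : Finset (Fin d)), slideFlow v n e = 0 := by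
    intro e he
    by_contra hne
    apply he
    rw [Finset.mem_product]
    refine ⟨Fintype.mem_piFinset.2 fun j => Finset.mem_Ico.2 ?_, Finset.mem_univ _⟩
    have hj : (v j).natAbs ≤ n := natAbs_le_l1norm v j
    rcases mem_of_prodFlow_ne_zero hne j with ⟨h1, -⟩ | ⟨h1, -⟩ | ⟨h1, -⟩
    · by_contra hc
      apply h1
      by_cases hlt : e.1 j < -(n : ℤ)
      · rw [unifCdf_of_lt (by omega), unifCdf_of_lt (by omega), sub_zero]
      · rw [unifCdf_of_ge hv (by omega), unifCdf_of_ge hv (by omega), sub_self]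
    · have := mem_of_unifDensity_ne_zero h1; omega
    · have := mem_of_unifDensity_ne_zero h1; omega
  rw [energy_one_eq_sum hp h0]
  refine ENNReal.ofReal_le_ofReal ?_
  have hcard : ((A ×ˢ (Finset.univ : Finset (Fin d))).card : ℝ) ≤ d * (4 * n) ^ d := by
    rw [Finset.card_product, Fintype.card_piFinset]
    simp only [Int.card_Ico, Finset.prod_const, Finset.card_univ, Fintype.card_fin]
    have : (2 * (n : ℤ) - -(n : ℤ)).toNat = 3 * n := by omega
    rw [this, mul_comm]
    push_cast
    gcongr; norm_num
  have hb : ∀ e, |slideFlow v n e| ≤ ((n : ℝ)⁻¹) ^ (d - 1) := by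
    intro e
    refine (abs_prodFlow_le (γ := 1) (β := (n : ℝ)⁻¹) (fun j t => ?_)
      (fun j t => abs_unifDensity_le _ _ _) (fun j t => abs_unifDensity_le _ _ _) e).trans
      (by rw [one_mul])
    rw [abs_le]
    have := unifCdf_nonneg 0 n t
    have := unifCdf_le_one 0 n t
    have := unifCdf_nonneg (v j) n t
    have := unifCdf_le_one (v j) n t
    constructor <;> linarith
  calc ∑ e ∈ A ×ˢ Finset.univ, |slideFlow v n e| ^ p
      ≤ ∑ e ∈ A ×ˢ (Finset.univ : Finset (Fin d)), (((n : ℝ)⁻¹) ^ (d - 1)) ^ p :=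
        Finset.sum_le_sum fun e _ => Real.rpow_le_rpow (abs_nonneg _) (hb e) (by linarith)
    _ ≤ d * (4 * n) ^ d * (((n : ℝ)⁻¹) ^ (d - 1)) ^ p := by
        rw [Finset.sum_const, nsmul_eq_mul]
        exact mul_le_mul_of_nonneg_right hcard (by positivity)
    _ = d * 4 ^ d * (n : ℝ) ^ (1 - ((d : ℝ) - 1) * (p - 1)) := by
        have : (n : ℝ) ^ (1 - ((d : ℝ) - 1) * (p - 1))
            = (n : ℝ) ^ (d : ℝ) * (n : ℝ) ^ (-(((d - 1 : ℕ) : ℝ) * p)) := by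
          rw [← Real.rpow_add hn0]; congr 1; rw [Nat.cast_sub hd]; push_cast; ring
        rw [this, mul_pow, inv_pow, Real.rpow_natCast, Real.rpow_neg hn0.le,
          Real.inv_rpow (by positivity), Real.rpow_mul hn0.le, Real.rpow_natCast]
        ring
    _ ≤ _ := by
        refine mul_le_mul_of_nonneg_left (partialZeta_ge ?_ hv) (by positivity)
        exact mul_nonneg (by linarith) (by linarith)

lemma energy_add_le {p : ℝ} (hp : 1 < p) (θ φ : Edge d → ℝ) :
    energy p (fun _ => 1) (θ + φ)
      ≤ ENNReal.ofReal (2 ^ p) * (energy p (fun _ => 1) θ + energy p (fun _ => 1) φ) := by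
  rw [energy, energy, energy, ← ENNReal.tsum_add, ← ENNReal.tsum_mul_left]
  refine ENNReal.tsum_le_tsum fun e => ?_
  rw [← ENNReal.ofReal_add (by positivity) (by positivity), ← ENNReal.ofReal_mul (by positivity)]
  refine ENNReal.ofReal_le_ofReal ?_
  simp only [one_mul, Pi.add_apply]
  have h1 : |θ e + φ e| ≤ 2 * max |θ e| |φ e| := by
    have := abs_add_le (θ e) (φ e)
    have := le_max_left |θ e| |φ e|
    have := le_max_right |θ e| |φ e|
    linarith
  have h2 : (max |θ e| |φ e|) ^ p ≤ |θ e| ^ p + |φ e| ^ p := by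
    have := Real.rpow_nonneg (abs_nonneg (θ e)) p
    have := Real.rpow_nonneg (abs_nonneg (φ e)) p
    rcases max_cases |θ e| |φ e| with h | h <;> rw [h.1] <;> linarith
  calc |θ e + φ e| ^ p ≤ (2 * max |θ e| |φ e|) ^ p :=
        Real.rpow_le_rpow (abs_nonneg _) h1 (by linarith)
    _ = 2 ^ p * (max |θ e| |φ e|) ^ p := Real.mul_rpow (by norm_num) (by positivity)
    _ ≤ _ := mul_le_mul_of_nonneg_left h2 (by positivity)

lemma energy_neg (p : ℝ) (r θ : Edge d → ℝ) : energy p r (-θ) = energy p r θ := by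
  simp [energy]

lemma one_le_l1norm {v : Vertex d} (hv : v ≠ 0) : 1 ≤ l1norm v := by
  obtain ⟨j, hj⟩ := Function.ne_iff.1 hv
  have := natAbs_le_l1norm v j
  have : (v j).natAbs ≠ 0 := by simpa using hj
  omega

/-- There are unit flows whose energy has the order of `∑_{j ≤ |v|} j^{-(d-1)(p-1)}`. -/
theorem exists_unitFlow_energy_le {p : ℝ} (hp : 1 < p) (hd : 1 ≤ d) :
    ∃ C : ℝ, 0 < C ∧ ∀ v : Vertex d, v ≠ 0 → ∃ θ, IsUnitFlow 0 v θ ∧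
      energy p (fun _ => 1) θ
        ≤ ENNReal.ofReal (C * partialZeta (((d : ℝ) - 1) * (p - 1)) (l1norm v)) := by
  rcases hd.eq_or_lt with rfl | hd2
  -- In dimension one `s = 0`, the partial sum is `|v|`, and the straight path already suffices; the
  -- spreading estimate needs `d ≥ 2`.
  · refine ⟨1, one_pos, fun v hv => ⟨pathFlow 0 v,
      (isUnitFlow_iff hv.symm).2 (outflow_pathFlow 0 v), (energy_pathFlow_le hp _ _).trans ?_⟩⟩
    simp [partialZeta, l1norm]
  · have hd0 : (0 : ℝ) < d := by exact_mod_cast hd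
    set K := (d : ℝ) ^ 2 * (2 ^ d) ^ p with hK
    set L := (d : ℝ) * 4 ^ d with hL
    refine ⟨2 ^ p * (2 ^ p * (K + L) + K), by positivity, fun v hv => ?_⟩
    have hv1 := one_le_l1norm hv
    -- From `0` to the uniform law on its cube, to the uniform law on the translate, and then to `v`
    -- by reversed spreading.
    refine ⟨(spreadFlow 0 (l1norm v) + slideFlow v (l1norm v)) + -spreadFlow v (l1norm v),
      (isUnitFlow_iff hv.symm).2 fun z => ?_, ?_⟩
    · rw [outflow_add, outflow_add, outflow_neg, outflow_spreadFlow _ hv1, outflow_spreadFlow _ hv1,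
        outflow_slideFlow _ hv1]
      ring
    · set Z := partialZeta (((d : ℝ) - 1) * (p - 1)) (l1norm v) with hZ
      have Z0 : 0 ≤ Z := Finset.sum_nonneg fun _ _ => by positivity
      have e1 := energy_spreadFlow_le hp hd2 (0 : Vertex d) (l1norm v)
      have e2 := energy_spreadFlow_le hp hd2 v (l1norm v)
      have e3 := energy_slideFlow_le hp hd v hv1
      refine (energy_add_le hp _ _).trans ?_
      rw [energy_neg]
      calc _ ≤ ENNReal.ofReal (2 ^ p) * (ENNReal.ofReal (2 ^ p) *
            (ENNReal.ofReal (K * Z) + ENNReal.ofReal (L * Z)) + ENNReal.ofReal (K * Z)) := by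
            gcongr
            refine (energy_add_le hp _ _).trans ?_
            gcongr
        _ = _ := by
            rw [← ENNReal.ofReal_add (by positivity) (by positivity),
              ← ENNReal.ofReal_mul (by positivity),
              ← ENNReal.ofReal_add (by positivity) (by positivity),
              ← ENNReal.ofReal_mul (by positivity)]
            congr 1; ring

end ProductFlow

/-! ### Existence of flows of minimal energy. -/

section Minimizers

variable {d : ℕ} {p a b : ℝ} {r : Edge d → ℝ} {x y : Vertex d} {θ : Edge d → ℝ}

lemma energy_eq_ofReal (hr : ∀ e, 0 ≤ r e) (hs : Summable fun e => r e * |θ e| ^ p) :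
    energy p r θ = ENNReal.ofReal (∑' e, r e * |θ e| ^ p) :=
  (ENNReal.ofReal_tsum_of_nonneg
    (fun e => mul_nonneg (hr e) (Real.rpow_nonneg (abs_nonneg _) _)) hs).symm

lemma summable_of_energy_ne_top (hr : ∀ e, 0 ≤ r e) (h : energy p r θ ≠ ⊤) :
    Summable fun e => r e * |θ e| ^ p := by
  refine (ENNReal.summable_toReal h).congr fun e => ?_
  rw [ENNReal.toReal_ofReal (mul_nonneg (hr e) (Real.rpow_nonneg (abs_nonneg _) _))]

lemma summable_rpow_of_energy_ne_top (ha : 0 < a) (hr : ∀ e, a ≤ r e) (h : energy p r θ ≠ ⊤) :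
    Summable fun e => |θ e| ^ p := by
  refine Summable.of_nonneg_of_le (fun e => Real.rpow_nonneg (abs_nonneg _) _) (fun e => ?_)
    ((summable_of_energy_ne_top (fun e => ha.le.trans (hr e)) h).mul_left a⁻¹)
  rw [← mul_assoc]
  refine le_mul_of_one_le_left (Real.rpow_nonneg (abs_nonneg _) _) ?_
  rw [inv_mul_eq_div, one_le_div ha]; exact hr e

lemma energy_mono {r' : Edge d → ℝ} (h : ∀ e, r e ≤ r' e) : energy p r θ ≤ energy p r' θ :=
  ENNReal.tsum_le_tsum fun e => ENNReal.ofReal_le_ofReal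
    (mul_le_mul_of_nonneg_right (h e) (Real.rpow_nonneg (abs_nonneg _) _))

lemma energy_const (hb : 0 ≤ b) :
    energy p (fun _ => b) θ = ENNReal.ofReal b * energy p (fun _ => 1) θ := by
  rw [energy, energy, ← ENNReal.tsum_mul_left]
  refine tsum_congr fun e => ?_
  rw [one_mul, ENNReal.ofReal_mul hb]

lemma abs_le_of_energy_le (hp : 1 < p) (ha : 0 < a) (hr : ∀ e, a ≤ r e) {B : ℝ} (hB : 0 ≤ B)
    (h : energy p r θ ≤ ENNReal.ofReal B) (e : Edge d) : |θ e| ≤ (B / a) ^ p⁻¹ := by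
  have h1 : ENNReal.ofReal (r e * |θ e| ^ p) ≤ ENNReal.ofReal B := (ENNReal.le_tsum e).trans h
  rw [ENNReal.ofReal_le_ofReal_iff hB] at h1
  have h2 : |θ e| ^ p ≤ B / a := by
    rw [le_div_iff₀ ha]
    have := Real.rpow_nonneg (abs_nonneg (θ e)) p
    nlinarith [hr e]
  calc |θ e| = (|θ e| ^ p) ^ p⁻¹ := (Real.rpow_rpow_inv (abs_nonneg _) (by linarith)).symm
    _ ≤ _ := Real.rpow_le_rpow (Real.rpow_nonneg (abs_nonneg _) _) h2 (by positivity)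

lemma continuous_outflow (z : Vertex d) : Continuous fun θ : Edge d → ℝ => outflow θ z := by
  unfold outflow; fun_prop

lemma isClosed_unitFlow (x y : Vertex d) : IsClosed {θ : Edge d → ℝ | IsUnitFlow x y θ} := by
  have : {θ : Edge d → ℝ | IsUnitFlow x y θ} = {θ | ∀ z, z ≠ x → z ≠ y → outflow θ z = 0}
      ∩ ({θ | outflow θ x = 1} ∩ {θ | -outflow θ y = 1}) := by
    ext θ; exact ⟨fun h => ⟨h.1, h.2, h.3⟩, fun h => ⟨h.1, h.2.1, h.2.2⟩⟩
  rw [this]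
  refine IsClosed.inter ?_ ((isClosed_eq (continuous_outflow _) continuous_const).inter
    (isClosed_eq (continuous_outflow _).neg continuous_const))
  simp only [Set.ofPred_forall]
  exact isClosed_iInter fun z => isClosed_iInter fun _ => isClosed_iInter fun _ =>
    isClosed_eq (continuous_outflow _) continuous_const

/-- A sum of nonnegative continuous terms. Semicontinuity is joint in resistances and flow because
it is used with fixed resistances for existence and with varying ones for continuity of the
resistance. -/
lemma lowerSemicontinuous_energy (hp : 1 < p) {X : Type*} [TopologicalSpace X]
    {R Θ : X → Edge d → ℝ} (hR : Continuous R) (hΘ : Continuous Θ) :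
    LowerSemicontinuous fun q => energy p (R q) (Θ q) := by
  refine lowerSemicontinuous_tsum fun e => Continuous.lowerSemicontinuous ?_
  refine ENNReal.continuous_ofReal.comp (((continuous_apply e).comp hR).mul ?_)
  exact (((continuous_apply e).comp hΘ).abs).rpow_const fun _ => Or.inr (by linarith)

/-- The unit flows from `x` to `y` with all values in `[-M, M]`. -/
def boundedFlows (x y : Vertex d) (M : ℝ) : Set (Edge d → ℝ) :=
  {θ | IsUnitFlow x y θ} ∩ Set.univ.pi fun _ => Set.Icc (-M) M

lemma isCompact_boundedFlows (x y : Vertex d) (M : ℝ) : IsCompact (boundedFlows x y M) :=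
  (isCompact_univ_pi fun _ => isCompact_Icc).inter_left (isClosed_unitFlow x y)

/-- A unit flow of finite and minimal energy. -/
structure IsMinFlow (p : ℝ) (r : Edge d → ℝ) (x y : Vertex d) (θ : Edge d → ℝ) : Prop where
  unit : IsUnitFlow x y θ
  ne_top : energy p r θ ≠ ⊤
  le : ∀ θ', IsUnitFlow x y θ' → energy p r θ ≤ energy p r θ'

lemma IsMinFlow.iInf_eq (h : IsMinFlow p r x y θ) :
    (⨅ θ : {θ : Edge d → ℝ // IsUnitFlow x y θ}, energy p r θ.1) = energy p r θ :=
  le_antisymm (iInf_le (fun θ : {θ : Edge d → ℝ // IsUnitFlow x y θ} => energy p r θ.1) ⟨θ, h.unit⟩)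
    (le_iInf fun θ' => h.le θ'.1 θ'.2)

lemma IsMinFlow.ofReal_resistance (h : IsMinFlow p r x y θ) :
    ENNReal.ofReal (resistance p r x y) = energy p r θ := by
  rw [resistance, h.iInf_eq, ENNReal.ofReal_toReal h.ne_top]

lemma IsMinFlow.resistance_eq (hr : ∀ e, 0 ≤ r e) (h : IsMinFlow p r x y θ) :
    resistance p r x y = ∑' e, r e * |θ e| ^ p := by
  rw [resistance, h.iInf_eq, energy_eq_ofReal hr (summable_of_energy_ne_top hr h.ne_top),
    ENNReal.toReal_ofReal (tsum_nonneg fun e =>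
      mul_nonneg (hr e) (Real.rpow_nonneg (abs_nonneg _) _))]

lemma resistance_nonneg (p : ℝ) (r : Edge d → ℝ) (x y : Vertex d) : 0 ≤ resistance p r x y :=
  ENNReal.toReal_nonneg

lemma resistance_le_of_energy_le {B : ℝ} (hB : 0 ≤ B) (hθ : IsUnitFlow x y θ)
    (h : energy p r θ ≤ ENNReal.ofReal B) : resistance p r x y ≤ B :=
  ENNReal.toReal_le_of_le_ofReal hB ((iInf_le
    (fun θ : {θ : Edge d → ℝ // IsUnitFlow x y θ} => energy p r θ.1) ⟨θ, hθ⟩).trans h)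

/-- An a priori bound on the values of flows of minimal energy. -/
noncomputable def flowBound (p a b : ℝ) (x y : Vertex d) : ℝ :=
  (b * l1norm (x - y) / a) ^ p⁻¹

lemma energy_pathFlow_le_of_le (hp : 1 < p) (hb : 0 ≤ b) (hr : ∀ e, r e ≤ b) :
    energy p r (pathFlow x y) ≤ ENNReal.ofReal (b * l1norm (x - y)) := by
  refine (energy_mono hr).trans ?_
  rw [energy_const hb, ENNReal.ofReal_mul hb]
  gcongr
  exact energy_pathFlow_le hp x y

lemma mem_boundedFlows_of_energy_le (hp : 1 < p) (ha : 0 < a) (hb : 0 ≤ b)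
    (hr : ∀ e, a ≤ r e) (hθ : IsUnitFlow x y θ)
    (h : energy p r θ ≤ ENNReal.ofReal (b * l1norm (x - y))) :
    θ ∈ boundedFlows x y (flowBound p a b x y) := by
  refine ⟨hθ, fun e _ => ?_⟩
  rw [Set.mem_Icc, ← abs_le]
  exact abs_le_of_energy_le hp ha hr (by positivity) h e

/-- Existence of a flow of minimal energy, with a uniform bound. -/
lemma exists_isMinFlow (hp : 1 < p) (ha : 0 < a) (hr : ∀ e, a ≤ r e ∧ r e ≤ b) (hxy : x ≠ y) :
    ∃ θ ∈ boundedFlows x y (flowBound p a b x y), IsMinFlow p r x y θ := by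
  have hb : 0 ≤ b := by
    obtain ⟨j, -⟩ := Function.ne_iff.1 hxy
    exact ha.le.trans ((hr (0, j)).1.trans (hr (0, j)).2)
  have hunit := (isUnitFlow_iff hxy).2 (outflow_pathFlow x y)
  have hpath := energy_pathFlow_le_of_le (x := x) (y := y) hp hb fun e => (hr e).2
  have hmem := mem_boundedFlows_of_energy_le hp ha hb (fun e => (hr e).1) hunit hpath
  obtain ⟨θ, hθ, hmin⟩ := LowerSemicontinuousOn.exists_isMinOn ⟨_, hmem⟩
    (isCompact_boundedFlows x y _)
    ((lowerSemicontinuous_energy (p := p) (R := fun _ => r) hp continuous_const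
      continuous_id).lowerSemicontinuousOn _)
  have hle : energy p r θ ≤ energy p r (pathFlow x y) := hmin hmem
  refine ⟨θ, hθ, hθ.1, ne_top_of_le_ne_top ENNReal.ofReal_ne_top (hle.trans hpath),
    fun θ' hθ' => ?_⟩
  -- A competitor outside the compact set has more energy than the path flow, so it cannot beat the
  -- minimum found inside.
  by_cases h : energy p r θ' ≤ energy p r (pathFlow x y)
  · exact hmin (mem_boundedFlows_of_energy_le hp ha hb (fun e => (hr e).1) hθ' (h.trans hpath))
  · exact hle.trans (not_le.1 h).le

/-- The potential differences induced by a flow. -/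
noncomputable def voltage (p : ℝ) (r θ : Edge d → ℝ) (e : Edge d) : ℝ :=
  r e * (|θ e| ^ (p - 2) * θ e)

lemma abs_rpow_sub_two_mul_sq (hp : 1 < p) (t : ℝ) : t * (|t| ^ (p - 2) * t) = |t| ^ p := by
  rcases eq_or_ne t 0 with rfl | ht
  · simp [Real.zero_rpow (by linarith : p ≠ 0)]
  · have h : 0 < |t| := abs_pos.2 ht
    have e : t * (|t| ^ (p - 2) * t) = |t| ^ (p - 2) * |t| ^ (2 : ℝ) := by
      rw [show (2 : ℝ) = ((2 : ℕ) : ℝ) by norm_num, Real.rpow_natCast, sq_abs]; ring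
    rw [e, ← Real.rpow_add h]; congr 1; ring

lemma mul_voltage (hp : 1 < p) (e : Edge d) : θ e * voltage p r θ e = r e * |θ e| ^ p := by
  rw [← abs_rpow_sub_two_mul_sq hp (θ e), voltage]; ring

end Minimizers

/-! ### Potentials of minimal flows and their consequences in the recurrent regime. -/

section Potential

variable {d : ℕ} {p a b : ℝ} {r : Edge d → ℝ} {x y : Vertex d} {θ : Edge d → ℝ}

/-- The Euler–Lagrange equation of a flow of minimal energy. -/
lemma IsMinFlow.tsum_voltage_mul_eq_zero (hp : 1 < p) (hr : ∀ e, 0 ≤ r e) (hxy : x ≠ y)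
    (h : IsMinFlow p r x y θ) {η : Edge d → ℝ} (hη : η.support.Finite)
    (h0 : ∀ z, outflow η z = 0) : ∑' e, voltage p r θ e * η e = 0 := by
  classical
  set A := hη.toFinset with hA
  have hA0 : ∀ e ∉ A, η e = 0 := fun e he => by simpa [hA] using he
  -- Energy along `θ + t • η` restricted to the support of `η`: only these finitely many terms vary,
  -- so minimality of the infinite sum gives a minimum of `G` at `0`.
  let G : ℝ → ℝ := fun t => ∑ e ∈ A, r e * |θ e + t * η e| ^ p
  have hmin : ∀ t, G 0 ≤ G t := by
    intro t
    have hunit : IsUnitFlow x y (θ + t • η) := by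
      rw [isUnitFlow_iff hxy]
      intro z
      rw [outflow_add, outflow_smul, h0, mul_zero, add_zero, (isUnitFlow_iff hxy).1 h.unit]
    have hle := h.le _ hunit
    have s1 := summable_of_energy_ne_top hr h.ne_top
    have hδ : ∀ e ∉ A, r e * |(θ + t • η) e| ^ p - r e * |θ e| ^ p = 0 := fun e he => by
      simp [hA0 e he]
    have s2 : Summable fun e => r e * |(θ + t • η) e| ^ p - r e * |θ e| ^ p :=
      summable_of_ne_finset_zero hδ
    have s3 : Summable fun e => r e * |(θ + t • η) e| ^ p := by
      simpa using s1.add s2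
    rw [energy_eq_ofReal hr s1, energy_eq_ofReal hr s3, ENNReal.ofReal_le_ofReal_iff
      (tsum_nonneg fun e => mul_nonneg (hr e) (Real.rpow_nonneg (abs_nonneg _) _)),
      ← sub_nonneg, ← s3.tsum_sub s1, tsum_eq_sum hδ, Finset.sum_sub_distrib, sub_nonneg] at hle
    simpa [G] using hle
  have hder : HasDerivAt G (∑ e ∈ A, r e * (p * |θ e| ^ (p - 2) * θ e * η e)) 0 := by
    refine HasDerivAt.fun_sum fun e _ => HasDerivAt.const_mul _ ?_
    have h1 : HasDerivAt (fun t : ℝ => θ e + t * η e) (η e) 0 := by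
      simpa using ((hasDerivAt_id (0 : ℝ)).mul_const (η e)).const_add (θ e)
    have h2 := hasDerivAt_abs_rpow (θ e + 0 * η e) hp
    have h3 := h2.comp (0 : ℝ) h1
    simpa [Function.comp_def] using h3
  have hz := IsLocalMin.hasDerivAt_eq_zero (Eventually.of_forall hmin) hder
  rw [tsum_eq_sum (s := A) fun e he => by rw [hA0 e he, mul_zero]]
  have : ∑ e ∈ A, r e * (p * |θ e| ^ (p - 2) * θ e * η e)
      = p * ∑ e ∈ A, voltage p r θ e * η e := by
    rw [Finset.mul_sum]
    exact Finset.sum_congr rfl fun e _ => by rw [voltage]; ring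
  rw [this] at hz
  exact (mul_eq_zero.1 hz).resolve_left (by linarith)

lemma finite_support_pathFlow (x y : Vertex d) : (pathFlow x y).support.Finite := by
  obtain ⟨A, -, hA⟩ := exists_pathFlow_support x y
  exact A.finite_toSet.subset fun e he => by
    by_contra h; exact he (hA e (by simpa using h))

lemma outflow_single (e : Edge d) (z : Vertex d) :
    outflow (Pi.single e 1) z = pointMass e.1 z - pointMass (e.1 + basisVec e.2) z := by
  obtain ⟨x, i⟩ := e
  rw [outflow, Finset.sum_eq_single i]
  · simp only [pointMass, Pi.single_apply, Prod.mk.injEq, and_true, sub_eq_iff_eq_add]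
    ring
  · intro j _ hj; simp [hj]
  · simp

/-- The voltage of a flow of minimal energy derives from a potential. -/
lemma IsMinFlow.exists_potential (hp : 1 < p) (hr : ∀ e, 0 ≤ r e) (hxy : x ≠ y)
    (h : IsMinFlow p r x y θ) : ∃ u : Vertex d → ℝ,
      (∀ z w, u z - u w = ∑' e, voltage p r θ e * pathFlow z w e) ∧
      ∀ e : Edge d, u e.1 - u (e.1 + basisVec e.2) = voltage p r θ e := by
  classical
  have hs : ∀ {η : Edge d → ℝ}, η.support.Finite → Summable fun e => voltage p r θ e * η e :=
    fun hη => summable_of_hasFiniteSupport (hη.subset fun e he => right_ne_zero_of_mul he)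
  -- Path independence: `η` and the detour from `z` through `0` to `w` differ by a finitely
  -- supported divergence-free function, which the Euler–Lagrange equation annihilates.
  have key : ∀ (z w : Vertex d) (η : Edge d → ℝ), η.support.Finite →
      (∀ q, outflow η q = pointMass z q - pointMass w q) →
      (-∑' e, voltage p r θ e * pathFlow 0 z e) - (-∑' e, voltage p r θ e * pathFlow 0 w e)
        = ∑' e, voltage p r θ e * η e := by
    intro z w η hη ho
    have f1 := finite_support_pathFlow (0 : Vertex d) z
    have f2 := finite_support_pathFlow (0 : Vertex d) w
    have hf : (pathFlow 0 w - pathFlow 0 z - η).support.Finite := by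
      refine ((f2.union f1).union hη).subset fun e he => ?_
      by_contra hc
      simp only [Set.mem_union, Function.mem_support, not_or, not_not] at hc
      apply he
      simp [hc.1.1, hc.1.2, hc.2]
    have hz := h.tsum_voltage_mul_eq_zero hp hr hxy hf fun q => by
      rw [outflow_sub, outflow_sub, outflow_pathFlow, outflow_pathFlow, ho]; ring
    simp only [Pi.sub_apply, mul_sub] at hz
    rw [((hs f2).sub (hs f1)).tsum_sub (hs hη), (hs f2).tsum_sub (hs f1)] at hz
    linarith
  refine ⟨fun z => -∑' e, voltage p r θ e * pathFlow 0 z e, fun z w =>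
    key z w _ (finite_support_pathFlow z w) (outflow_pathFlow z w), fun e => ?_⟩
  have hfe : (Pi.single e 1 : Edge d → ℝ).support.Finite :=
    (Set.finite_singleton e).subset (Pi.support_single_subset)
  simp only
  rw [key e.1 (e.1 + basisVec e.2) (Pi.single e 1) hfe (outflow_single e), tsum_eq_single e]
  · simp
  · intro e' he'; simp [he']

/-- In the recurrent regime, the energy dissipated by the minimal flow on edges whose endpoints have
potentials in a given interval is at most the length of this interval. -/
lemma IsMinFlow.sum_le_of_potential (hd : 1 ≤ d) (hp : 1 < p) (hdp : ((d : ℝ) - 1) * p ≤ d)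
    (ha : 0 < a) (hr : ∀ e, a ≤ r e) (hxy : x ≠ y) (h : IsMinFlow p r x y θ) {u : Vertex d → ℝ}
    (hu : ∀ e : Edge d, u e.1 - u (e.1 + basisVec e.2) = voltage p r θ e) {α β : ℝ}
    (hαβ : α ≤ β) {A : Finset (Edge d)} (hA : ∀ e ∈ A, u e.1 ∈ Set.Icc α β ∧
      u (e.1 + basisVec e.2) ∈ Set.Icc α β) :
    ∑ e ∈ A, r e * |θ e| ^ p ≤ β - α := by
  classical
  -- The potential clipped to `[α, β]` and shifted to start at `0`. It agrees with `u - α` at the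
  -- endpoints of edges of `A`, where `θ` times its gradient is exactly the dissipated energy.
  let k : Vertex d → ℝ := fun z => max 0 (min (β - α) (u z - α))
  have k0 : ∀ z, 0 ≤ k z := fun z => le_max_left _ _
  have kK : ∀ z, k z ≤ β - α := fun z => max_le (by linarith) (min_le_left _ _)
  have kmono : ∀ {z w}, u z ≤ u w → k z ≤ k w := fun hzw =>
    max_le_max le_rfl (min_le_min le_rfl (by linarith))
  have keq : ∀ {z}, u z ∈ Set.Icc α β → k z = u z - α := fun {z} hz => by
    have h1 := hz.1
    have h2 := hz.2
    simp only [k]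
    rw [min_eq_right (by linarith), max_eq_right (by linarith)]
  -- The minimal flow goes down the potential, and clipping is monotone, so no edge contributes
  -- negatively.
  have hpos : ∀ e : Edge d, 0 ≤ θ e * (k e.1 - k (e.1 + basisVec e.2)) := by
    intro e
    have hv := hu e
    have hc : 0 ≤ r e * |θ e| ^ (p - 2) :=
      mul_nonneg (ha.le.trans (hr e)) (Real.rpow_nonneg (abs_nonneg _) _)
    have hv' : u e.1 - u (e.1 + basisVec e.2) = (r e * |θ e| ^ (p - 2)) * θ e := by
      rw [hv, voltage]; ring
    rcases le_total 0 (θ e) with ht | ht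
    · have := mul_nonneg hc ht
      have := kmono (z := e.1 + basisVec e.2) (w := e.1) (by linarith)
      exact mul_nonneg ht (by linarith)
    · have := mul_nonpos_of_nonneg_of_nonpos hc ht
      have := kmono (z := e.1) (w := e.1 + basisVec e.2) (by linarith)
      exact mul_nonneg_of_nonpos_of_nonpos ht (by linarith)
  have hsumA : ∑ e ∈ A, θ e * (k e.1 - k (e.1 + basisVec e.2)) = ∑ e ∈ A, r e * |θ e| ^ p := by
    refine Finset.sum_congr rfl fun e he => ?_
    rw [keq (hA e he).1, keq (hA e he).2, sub_sub_sub_cancel_right, hu, mul_voltage hp]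
  let S : Finset (Vertex d) := {x, y} ∪ (A.image Prod.fst ∪ A.image fun e => e.1 + basisVec e.2)
  let N₀ : ℕ := S.sup l1norm
  have hS : ∀ z ∈ S, ∀ N, N₀ ≤ N → z ∈ box d N := by
    intro z hz N hN
    have h1 : l1norm z ≤ N := (Finset.le_sup (f := l1norm) hz).trans hN
    rw [mem_box]
    intro j
    have := natAbs_le_l1norm z j
    omega
  refine le_of_forall_pos_le_add fun ε hε => ?_
  -- Recurrence makes the truncation error at infinity at most `ε`. The `+ 1` keeps the denominator
  -- positive when `α = β`.
  obtain ⟨N, hN, hNε⟩ := exists_sum_boxBdry_lt hd hp hdp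
    (summable_rpow_of_energy_ne_top ha hr h.ne_top)
    (div_pos hε (by linarith : 0 < β - α + 1)) N₀
  have hmain := sum_box_mul_outflow_ge θ k0 kK N (A := A) (fun e he =>
    ⟨hS _ (Finset.mem_union_right _ (Finset.mem_union_left _ (Finset.mem_image_of_mem _ he))) N hN,
      hS _ (Finset.mem_union_right _ (Finset.mem_union_right _
        (Finset.mem_image_of_mem (fun e : Edge d => e.1 + basisVec e.2) he))) N hN⟩) hpos
  have hrhs : ∑ z ∈ box d N, k z * outflow θ z = k x - k y := by
    simp only [(isUnitFlow_iff hxy).1 h.unit, mul_sub, Finset.sum_sub_distrib]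
    rw [sum_box_mul_pointMass (hS x (by simp [S]) N hN),
      sum_box_mul_pointMass (hS y (by simp [S]) N hN)]
  rw [hsumA, hrhs] at hmain
  have h1 : (β - α) * ∑ e ∈ boxBdry d N, |θ e| ≤ ε := by
    rw [lt_div_iff₀ (by linarith)] at hNε
    have : 0 ≤ ∑ e ∈ boxBdry d N, |θ e| := Finset.sum_nonneg fun _ _ => abs_nonneg _
    nlinarith
  linarith [kK x, k0 y]

lemma abs_voltage (hp : 1 < p) (hr : ∀ e, 0 ≤ r e) (e : Edge d) :
    |voltage p r θ e| = r e * |θ e| ^ (p - 1) := by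
  rw [voltage, abs_mul, abs_of_nonneg (hr e), abs_mul,
    abs_of_nonneg (Real.rpow_nonneg (abs_nonneg _) _)]
  rcases eq_or_ne (θ e) 0 with h | h
  · simp [h, Real.zero_rpow (by linarith : p - 1 ≠ 0)]
  · rw [← Real.rpow_add_one (abs_pos.2 h).ne']; congr 2; ring

/-- In the recurrent regime the minimal flow sends at most one unit through any edge. -/
lemma IsMinFlow.abs_le_one (hd : 1 ≤ d) (hp : 1 < p) (hdp : ((d : ℝ) - 1) * p ≤ d)
    (ha : 0 < a) (hr : ∀ e, a ≤ r e) (hxy : x ≠ y) (h : IsMinFlow p r x y θ) (e : Edge d) :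
    |θ e| ≤ 1 := by
  have hr0 : ∀ e, 0 ≤ r e := fun e => ha.le.trans (hr e)
  obtain ⟨u, -, hu⟩ := h.exists_potential hp hr0 hxy
  -- Take the interval between the potentials of the two endpoints: `r |θ|^p` is at most the
  -- potential drop `r |θ|^(p-1)`, which is impossible if `|θ| > 1`.
  have h1 := h.sum_le_of_potential hd hp hdp ha hr hxy hu
    (α := min (u e.1) (u (e.1 + basisVec e.2))) (β := max (u e.1) (u (e.1 + basisVec e.2)))
    (min_le_left _ _ |>.trans (le_max_left _ _)) (A := {e}) (by
      intro e' he'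
      rw [Finset.mem_singleton] at he'
      subst he'
      exact ⟨⟨min_le_left _ _, le_max_left _ _⟩, ⟨min_le_right _ _, le_max_right _ _⟩⟩)
  rw [Finset.sum_singleton, max_sub_min_eq_abs', hu, abs_voltage hp hr0] at h1
  by_contra! hlt
  have h2 := le_of_mul_le_mul_left h1 (ha.trans_le (hr e))
  exact absurd (Real.rpow_lt_rpow_of_exponent_lt hlt (by linarith : p - 1 < p)) h2.not_gt

/-- In the recurrent regime the energy of the minimal flow in a ball grows at most linearly. -/
lemma IsMinFlow.sum_le_of_l1norm_le (hd : 1 ≤ d) (hp : 1 < p) (hdp : ((d : ℝ) - 1) * p ≤ d)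
    (ha : 0 < a) (hr : ∀ e, a ≤ r e ∧ r e ≤ b) (hxy : x ≠ y) (h : IsMinFlow p r x y θ)
    {A : Finset (Edge d)} {c : Vertex d} {R : ℕ}
    (hA : ∀ e ∈ A, l1norm (e.1 - c) ≤ R ∧ l1norm (e.1 + basisVec e.2 - c) ≤ R) :
    ∑ e ∈ A, r e * |θ e| ^ p ≤ 2 * b * R := by
  have hr0 : ∀ e, 0 ≤ r e := fun e => ha.le.trans (hr e).1
  obtain ⟨u, hpath, hu⟩ := h.exists_potential hp hr0 hxy
  have hb : 0 ≤ b := (hr0 (0, ⟨0, hd⟩)).trans (hr _).2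
  -- Since `|θ| ≤ 1`, the potential drops by at most `b` across an edge. It is therefore
  -- `b`-Lipschitz for the `ℓ¹` distance, and on a ball of radius `R` it stays in an interval of
  -- length `2bR`.
  have hvb : ∀ e, |voltage p r θ e| ≤ b := fun e => by
    rw [abs_voltage hp hr0]
    have h1 := Real.rpow_le_one (abs_nonneg _)
      (h.abs_le_one hd hp hdp ha (fun e => (hr e).1) hxy e) (by linarith : 0 ≤ p - 1)
    nlinarith [(hr e).2, hr0 e]
  have hLip : ∀ z, l1norm (z - c) ≤ R → u z ∈ Set.Icc (u c - b * R) (u c + b * R) := by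
    intro z hz
    obtain ⟨B, hB, hB0⟩ := exists_pathFlow_support z c
    have h1 : |u z - u c| ≤ b * R := by
      rw [hpath, tsum_eq_sum (s := B) fun e he => by rw [hB0 e he, mul_zero]]
      calc |∑ e ∈ B, voltage p r θ e * pathFlow z c e| ≤ ∑ e ∈ B, b := by
            refine (Finset.abs_sum_le_sum_abs _ _).trans (Finset.sum_le_sum fun e _ => ?_)
            rw [abs_mul]
            have := abs_pathFlow_le_one z c e
            have := abs_nonneg (pathFlow z c e)
            nlinarith [hvb e, abs_nonneg (voltage p r θ e)]
        _ = b * B.card := by rw [Finset.sum_const, nsmul_eq_mul, mul_comm]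
        _ ≤ b * R := by
            gcongr; exact hB.trans hz
    rw [abs_le] at h1
    constructor <;> linarith [h1.1, h1.2]
  have hbR : 0 ≤ b * R := by positivity
  refine (h.sum_le_of_potential hd hp hdp ha (fun e => (hr e).1) hxy hu
    (α := u c - b * R) (β := u c + b * R) (by linarith)
    fun e he => ⟨hLip _ (hA e he).1, hLip _ (hA e he).2⟩).trans (by linarith)

/-- Moving the endpoints changes the resistance at most linearly in the displacement. -/
lemma resistance_le_add (hd : 1 ≤ d) (hp : 1 < p) (hdp : ((d : ℝ) - 1) * p ≤ d)
    (ha : 0 < a) (hr : ∀ e, a ≤ r e ∧ r e ≤ b) (hxy : x ≠ y) {x' y' : Vertex d} (hxy' : x' ≠ y') :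
    resistance p r x' y' ≤ resistance p r x y
      + b * 3 ^ p * (l1norm (x' - x) + l1norm (y - y')) := by
  classical
  have hr0 : ∀ e, 0 ≤ r e := fun e => ha.le.trans (hr e).1
  have hb : 0 ≤ b := (hr0 (0, ⟨0, hd⟩)).trans (hr _).2
  obtain ⟨θ, -, h⟩ := exists_isMinFlow hp ha hr hxy
  obtain ⟨B, hB, hB0⟩ := exists_pathFlow_support x' x
  obtain ⟨B', hB', hB0'⟩ := exists_pathFlow_support y y'
  -- Reroute the old minimal flow by paths from `x'` to `x` and from `y` to `y'`. All three pieces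
  -- are bounded by `1`, so `|φ| ≤ 3` on the paths, and nothing changes elsewhere.
  set φ : Edge d → ℝ := θ + pathFlow x' x + pathFlow y y' with hφ
  have hunit : IsUnitFlow x' y' φ := by
    rw [isUnitFlow_iff hxy']
    intro z
    rw [hφ, outflow_add, outflow_add, outflow_pathFlow, outflow_pathFlow,
      (isUnitFlow_iff hxy).1 h.unit]
    ring
  have hc : ((B ∪ B').card : ℝ) ≤ l1norm (x' - x) + l1norm (y - y') := by
    exact_mod_cast (Finset.card_union_le _ _).trans (add_le_add hB hB')
  have hφb : ∀ e, r e * |φ e| ^ p ≤ r e * |θ e| ^ p + if e ∈ B ∪ B' then b * 3 ^ p else 0 := by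
    intro e
    split_ifs with he
    · have h3 : |φ e| ≤ 3 := by
        have h1 := h.abs_le_one hd hp hdp ha (fun e => (hr e).1) hxy e
        have h2 := abs_pathFlow_le_one x' x e
        have h4 := abs_pathFlow_le_one y y' e
        have := abs_add_three (θ e) (pathFlow x' x e) (pathFlow y y' e)
        simp only [hφ, Pi.add_apply]; linarith
      have h5 : r e * |φ e| ^ p ≤ b * 3 ^ p :=
        mul_le_mul (hr e).2 (Real.rpow_le_rpow (abs_nonneg _) h3 (by linarith))
          (Real.rpow_nonneg (abs_nonneg _) _) hb
      have := mul_nonneg (hr0 e) (Real.rpow_nonneg (abs_nonneg (θ e)) p)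
      linarith
    · rw [Finset.mem_union, not_or] at he
      simp [hφ, hB0 e he.1, hB0' e he.2]
  have s1 := summable_of_energy_ne_top hr0 h.ne_top
  have s2 : Summable fun e : Edge d => if e ∈ B ∪ B' then b * 3 ^ p else 0 :=
    summable_of_ne_finset_zero (s := B ∪ B') fun e he => if_neg he
  have s3 : Summable fun e => r e * |φ e| ^ p :=
    Summable.of_nonneg_of_le (fun e => mul_nonneg (hr0 e) (Real.rpow_nonneg (abs_nonneg _) _))
      hφb (s1.add s2)
  have hnn := resistance_nonneg p r x y
  refine resistance_le_of_energy_le (by positivity) hunit ?_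
  rw [energy_eq_ofReal hr0 s3]
  refine ENNReal.ofReal_le_ofReal ((s3.tsum_le_tsum hφb (s1.add s2)).trans ?_)
  rw [s1.tsum_add s2, h.resistance_eq hr0, tsum_eq_sum (s := B ∪ B') fun e he => if_neg he]
  gcongr
  rw [Finset.sum_congr rfl (g := fun _ => b * 3 ^ p) fun e he => if_pos he, Finset.sum_const,
    nsmul_eq_mul, mul_comm]
  gcongr

end Potential

/-! ### The resistance as a continuous function of coin tosses, and its influences. -/

section CoinSpace

variable {d : ℕ} {p a b : ℝ} {x y : Vertex d}

/-- The resistances read off from coin tosses. -/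
def coinResistances (a b : ℝ) (ω : Edge d → Bool) (e : Edge d) : ℝ := if ω e then b else a

lemma coinResistances_mem (hab : a ≤ b) (ω : Edge d → Bool) (e : Edge d) :
    a ≤ coinResistances a b ω e ∧ coinResistances a b ω e ≤ b := by
  unfold coinResistances; split_ifs <;> simp [hab]

lemma continuous_coinResistances (a b : ℝ) :
    Continuous (coinResistances a b : (Edge d → Bool) → Edge d → ℝ) :=
  continuous_pi fun e =>
    (continuous_of_discreteTopology (f := fun t : Bool => if t then b else a)).comp
      (continuous_apply e)

/-- The resistance between two points as a function of the coin tosses. -/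
noncomputable def coinRes (p a b : ℝ) (x y : Vertex d) (ω : Edge d → Bool) : ℝ :=
  resistance p (coinResistances a b ω) x y

/-- Lower semicontinuity: sublevel sets are projections of compact sets of pairs (configuration,
bounded flow). Upper semicontinuity: the minimal flow at a given configuration is a competitor at
every other one, with energy continuous in the configuration by domination. -/
lemma continuous_coinRes (hp : 1 < p) (ha : 0 < a) (hab : a ≤ b) (hxy : x ≠ y) :
    Continuous (coinRes p a b x y) := by
  have hb : 0 ≤ b := ha.le.trans hab
  have hr := coinResistances_mem (d := d) hab
  have hr0 : ∀ (ω : Edge d → Bool) e, 0 ≤ coinResistances a b ω e :=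
    fun ω e => ha.le.trans (hr ω e).1
  rw [continuous_iff_lower_upperSemicontinuous]
  constructor
  · rw [lowerSemicontinuous_iff_isClosed_preimage]
    intro c
    rcases lt_or_ge c 0 with hc | hc
    · have : coinRes p a b x y ⁻¹' Set.Iic c = ∅ := by
        ext ω
        simp only [Set.mem_preimage, Set.mem_Iic, Set.mem_empty_iff_false, iff_false, not_le]
        exact hc.trans_le (resistance_nonneg _ _ _ _)
      rw [this]; exact isClosed_empty
    · let Z : Set ((Edge d → Bool) × (Edge d → ℝ)) :=
        (Set.univ ×ˢ boundedFlows x y (flowBound p a b x y)) ∩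
          {q | energy p (coinResistances a b q.1) q.2 ≤ ENNReal.ofReal c}
      have hZ : IsCompact Z := by
        refine (isCompact_univ.prod (isCompact_boundedFlows x y _)).inter_right ?_
        exact (lowerSemicontinuous_energy (p := p)
          (R := fun q : (Edge d → Bool) × (Edge d → ℝ) => coinResistances a b q.1)
          (Θ := Prod.snd) hp ((continuous_coinResistances a b).comp continuous_fst)
          continuous_snd).isClosed_preimage (ENNReal.ofReal c)
      have : coinRes p a b x y ⁻¹' Set.Iic c = Prod.fst '' Z := by
        ext ω
        constructor
        · intro hω
          obtain ⟨θ, hθ, hmin⟩ := exists_isMinFlow hp ha (hr ω) hxy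
          refine ⟨(ω, θ), ⟨⟨Set.mem_univ _, hθ⟩, ?_⟩, rfl⟩
          change energy p (coinResistances a b ω) θ ≤ _
          rw [← hmin.ofReal_resistance]
          exact ENNReal.ofReal_le_ofReal hω
        · rintro ⟨⟨ω', θ⟩, ⟨⟨-, hθ⟩, hle⟩, rfl⟩
          exact resistance_le_of_energy_le hc hθ.1 hle
      rw [this]
      exact (hZ.image continuous_fst).isClosed
  · intro ω₀ c hc
    obtain ⟨θ, -, hmin⟩ := exists_isMinFlow hp ha (hr ω₀) hxy
    have hs := summable_rpow_of_energy_ne_top ha (fun e => (hr ω₀ e).1) hmin.ne_top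
    have hle : ∀ (ω : Edge d → Bool) e, coinResistances a b ω e * |θ e| ^ p ≤ b * |θ e| ^ p :=
      fun ω e => mul_le_mul_of_nonneg_right (hr ω e).2 (Real.rpow_nonneg (abs_nonneg _) _)
    have hnn : ∀ (ω : Edge d → Bool) e, 0 ≤ coinResistances a b ω e * |θ e| ^ p :=
      fun ω e => mul_nonneg (hr0 ω e) (Real.rpow_nonneg (abs_nonneg _) _)
    have hcont : Continuous fun ω : Edge d → Bool =>
        ∑' e, coinResistances a b ω e * |θ e| ^ p := by
      refine continuous_tsum (u := fun e => b * |θ e| ^ p) (fun e => ?_) (hs.mul_left b) ?_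
      · exact ((continuous_apply e).comp (continuous_coinResistances a b)).mul continuous_const
      · intro e ω
        rw [Real.norm_eq_abs, abs_of_nonneg (hnn ω e)]
        exact hle ω e
    have h0 : ∑' e, coinResistances a b ω₀ e * |θ e| ^ p < c := by
      rw [← hmin.resistance_eq (hr0 ω₀)]; exact hc
    filter_upwards [hcont.continuousAt.eventually_lt continuousAt_const h0] with ω hω
    refine lt_of_le_of_lt ?_ hω
    refine resistance_le_of_energy_le (tsum_nonneg (hnn ω)) hmin.unit (le_of_eq ?_)
    exact energy_eq_ofReal (hr0 ω) (Summable.of_nonneg_of_le (hnn ω) (hle ω) (hs.mul_left b))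

/-- The minimal flow before the flip remains a competitor after it, and only the term of the flipped
edge changes. -/
lemma coinRes_flip_le (ha : 0 < a) (hab : a ≤ b) {ω : Edge d → Bool}
    {θ : Edge d → ℝ} (h : IsMinFlow p (coinResistances a b ω) x y θ) {e : Edge d}
    (he : ω e = false) :
    coinRes p a b x y (flip e ω) ≤ coinRes p a b x y ω + (b - a) * |θ e| ^ p := by
  classical
  have hr0 : ∀ (ω : Edge d → Bool) e, 0 ≤ coinResistances a b ω e :=
    fun ω e => ha.le.trans (coinResistances_mem hab ω e).1
  have s1 := summable_of_energy_ne_top (hr0 ω) h.ne_top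
  have s2 : Summable fun e' : Edge d => if e' = e then (b - a) * |θ e| ^ p else 0 :=
    summable_of_ne_finset_zero (s := {e}) fun e' he' => if_neg (by simpa using he')
  have hfl : ∀ e', coinResistances a b (flip e ω) e' * |θ e'| ^ p
      = coinResistances a b ω e' * |θ e'| ^ p + if e' = e then (b - a) * |θ e| ^ p else 0 := by
    intro e'
    by_cases h' : e' = e
    · subst h'; simp [coinResistances, flip_same, he]; ring
    · simp [coinResistances, flip_of_ne h', h']
  have s3 : Summable fun e' => coinResistances a b (flip e ω) e' * |θ e'| ^ p := by
    simp only [hfl]; exact s1.add s2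
  have hnn := mul_nonneg (sub_nonneg.2 hab) (Real.rpow_nonneg (abs_nonneg (θ e)) p)
  refine resistance_le_of_energy_le (add_nonneg (resistance_nonneg _ _ _ _) hnn) h.unit ?_
  rw [energy_eq_ofReal (hr0 _) s3]
  refine ENNReal.ofReal_le_ofReal (le_of_eq ?_)
  simp only [hfl]
  rw [s1.tsum_add s2, tsum_ite_eq, coinRes, h.resistance_eq (hr0 ω)]

/-- Rayleigh monotonicity, tested with the minimal flow for the larger resistances. -/
lemma coinRes_le_flip (hp : 1 < p) (ha : 0 < a) (hab : a ≤ b) (hxy : x ≠ y)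
    {ω : Edge d → Bool} {e : Edge d} (he : ω e = false) :
    coinRes p a b x y ω ≤ coinRes p a b x y (flip e ω) := by
  obtain ⟨θ, -, h⟩ := exists_isMinFlow hp ha (coinResistances_mem hab (flip e ω)) hxy
  refine resistance_le_of_energy_le (resistance_nonneg _ _ _ _) h.unit ?_
  rw [coinRes, h.ofReal_resistance]
  refine energy_mono fun e' => ?_
  by_cases h' : e' = e
  · subst h'; simp [coinResistances, flip_same, he, hab]
  · simp [coinResistances, flip_of_ne h']

lemma abs_coinRes_sub_flip_le (hp : 1 < p) (ha : 0 < a) (hab : a ≤ b) (hxy : x ≠ y)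
    {ω : Edge d → Bool} {θ : Edge d → ℝ} (h : IsMinFlow p (coinResistances a b ω) x y θ)
    {e : Edge d} (he : ω e = false) :
    |coinRes p a b x y ω - coinRes p a b x y (flip e ω)| ≤ (b - a) * |θ e| ^ p := by
  rw [abs_sub_comm, abs_of_nonneg (sub_nonneg.2 (coinRes_le_flip hp ha hab hxy he))]
  linarith [coinRes_flip_le ha hab h he]

lemma abs_coinRes_sub_flip_le_sub (hd : 1 ≤ d) (hp : 1 < p) (hdp : ((d : ℝ) - 1) * p ≤ d)
    (ha : 0 < a) (hab : a ≤ b) (hxy : x ≠ y) (ω : Edge d → Bool) (e : Edge d) :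
    |coinRes p a b x y ω - coinRes p a b x y (flip e ω)| ≤ b - a := by
  have key : ∀ ω : Edge d → Bool, ω e = false →
      |coinRes p a b x y ω - coinRes p a b x y (flip e ω)| ≤ b - a := by
    intro ω he
    obtain ⟨θ, -, h⟩ := exists_isMinFlow hp ha (coinResistances_mem hab ω) hxy
    refine (abs_coinRes_sub_flip_le hp ha hab hxy h he).trans ?_
    exact mul_le_of_le_one_right (sub_nonneg.2 hab) (Real.rpow_le_one (abs_nonneg _)
      (h.abs_le_one hd hp hdp ha (fun e => (coinResistances_mem hab ω e).1) hxy e) (by linarith))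
  cases he : ω e
  · exact key ω he
  · have := key (flip e ω) (by rw [flip_same, he]; rfl)
    rwa [flip_flip, abs_sub_comm] at this

variable {P : Measure (Edge d → Bool)} [IsProbabilityMeasure P]

/-- The flip exchanges the two halves of the cube. Influences may thus be computed on the half where
the edge has resistance `a`, the only case in which the minimal flow at `ω` bounds the increment
directly. -/
lemma integral_eq_two_mul_of_flip {ι : Type*} [DecidableEq ι] [Countable ι]
    {P : Measure (ι → Bool)} [IsProbabilityMeasure P]
    (hP : ∀ i, MeasurePreserving (flip i) P P) (i : ι) {g : (ι → Bool) → ℝ} (hg : Continuous g)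
    (h : ∀ ω, g (flip i ω) = g ω) :
    ∫ ω, g ω ∂P = 2 * ∫ ω, (if ω i then 0 else 1) * g ω ∂P := by
  have c0 : Continuous fun ω : ι → Bool => (if ω i then (0 : ℝ) else 1) * g ω :=
    ((continuous_of_discreteTopology (f := fun t : Bool => if t then (0 : ℝ) else 1)).comp
      (continuous_apply i)).mul hg
  have c1 : Continuous fun ω : ι → Bool => (if ω i then (1 : ℝ) else 0) * g ω :=
    ((continuous_of_discreteTopology (f := fun t : Bool => if t then (1 : ℝ) else 0)).comp
      (continuous_apply i)).mul hg
  have e1 := integral_comp_flip hP i c1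
  have e2 : ∀ ω : ι → Bool, (if flip i ω i then (1 : ℝ) else 0) * g (flip i ω)
      = (if ω i then 0 else 1) * g ω := fun ω => by
    rw [h, flip_same]; cases ω i <;> simp
  simp only [e2] at e1
  have e3 : ∀ ω : ι → Bool, g ω
      = (if ω i then (0 : ℝ) else 1) * g ω + (if ω i then (1 : ℝ) else 0) * g ω := fun ω => by
    cases ω i <;> simp
  calc ∫ ω, g ω ∂P = ∫ ω, ((if ω i then (0 : ℝ) else 1) * g ω
        + (if ω i then (1 : ℝ) else 0) * g ω) ∂P := integral_congr_ae (Eventually.of_forall e3)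
    _ = _ := by
      rw [integral_add (integrable_of_continuous c0) (integrable_of_continuous c1), ← e1]; ring

/-- The total influence of a finite set of edges is controlled by the energy dissipated there. -/
lemma sum_influence_le (hP : ∀ i, MeasurePreserving (flip i) P P) (hp : 1 < p) (ha : 0 < a)
    (hab : a ≤ b) (hxy : x ≠ y) {A : Finset (Edge d)} {B : ℝ}
    (hB : ∀ ω θ, IsMinFlow p (coinResistances a b ω) x y θ →
      ∑ e ∈ A, coinResistances a b ω e * |θ e| ^ p ≤ B) :
    ∑ e ∈ A, ∫ ω, |coinRes p a b x y ω - coinRes p a b x y (flip e ω)| ∂P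
      ≤ 2 * ((b - a) / a * B) := by
  have hF := continuous_coinRes (a := a) (b := b) hp ha hab hxy
  have hG : ∀ e, Continuous fun ω => |coinRes p a b x y ω - coinRes p a b x y (flip e ω)| :=
    fun e => (hF.sub (hF.comp (continuous_flip e))).abs
  have hc : ∀ e, Continuous fun ω : Edge d → Bool => (if ω e then (0 : ℝ) else 1) *
      |coinRes p a b x y ω - coinRes p a b x y (flip e ω)| := fun e =>
    ((continuous_of_discreteTopology (f := fun t : Bool => if t then (0 : ℝ) else 1)).comp
      (continuous_apply e)).mul (hG e)
  have e1 : ∀ e ∈ A, ∫ ω, |coinRes p a b x y ω - coinRes p a b x y (flip e ω)| ∂P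
      = 2 * ∫ ω, (if ω e then (0 : ℝ) else 1) *
        |coinRes p a b x y ω - coinRes p a b x y (flip e ω)| ∂P := fun e _ =>
    integral_eq_two_mul_of_flip hP e (hG e) fun ω => by rw [flip_flip, abs_sub_comm]
  rw [Finset.sum_congr rfl e1, ← Finset.mul_sum,
    ← integral_finsetSum _ fun e _ => integrable_of_continuous (hc e)]
  refine mul_le_mul_of_nonneg_left ?_ zero_le_two
  have hle : ∀ ω : Edge d → Bool, ∑ e ∈ A, (if ω e then (0 : ℝ) else 1) *
      |coinRes p a b x y ω - coinRes p a b x y (flip e ω)| ≤ (b - a) / a * B := by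
    intro ω
    have hr := coinResistances_mem hab ω
    obtain ⟨θ, -, h⟩ := exists_isMinFlow hp ha hr hxy
    have hnn : 0 ≤ (b - a) / a := div_nonneg (sub_nonneg.2 hab) ha.le
    refine le_trans (Finset.sum_le_sum fun e _ => ?_)
      ((Finset.mul_sum _ _ _).symm.le.trans (mul_le_mul_of_nonneg_left (hB ω θ h) hnn))
    have h0 := Real.rpow_nonneg (abs_nonneg (θ e)) p
    cases he : ω e
    -- Here the edge has resistance `a`, so `(b - a)|θ|^p` is `(b - a)/a` times the energy
    -- dissipated on it.
    · simp only [Bool.false_eq_true, if_false, one_mul]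
      refine (abs_coinRes_sub_flip_le hp ha hab hxy h he).trans ?_
      rw [coinResistances, he, if_neg Bool.false_ne_true, ← mul_assoc, div_mul_cancel₀ _ ha.ne']
    · simp only [if_true, zero_mul]
      exact mul_nonneg hnn (mul_nonneg (ha.le.trans (hr e).1) h0)
  calc _ ≤ ∫ _, (b - a) / a * B ∂P :=
        integral_mono (integrable_of_continuous (continuous_finsetSum _ fun e _ => hc e))
          (integrable_const _) hle
    _ = _ := by simp

/-- Translate a configuration by `z`. -/
def shiftEdge (z : Vertex d) : Edge d ≃ Edge d where
  toFun e := (e.1 + z, e.2)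
  invFun e := (e.1 - z, e.2)
  left_inv e := by simp
  right_inv e := by simp

lemma outflow_comp_shiftEdge (z : Vertex d) (θ : Edge d → ℝ) (q : Vertex d) :
    outflow (θ ∘ shiftEdge z) q = outflow θ (q + z) := by
  simp only [outflow, Function.comp, shiftEdge, Equiv.coe_fn_mk]
  refine Finset.sum_congr rfl fun i _ => ?_
  rw [sub_add_eq_add_sub]

lemma isUnitFlow_comp_shiftEdge (hxy : x ≠ y) (z : Vertex d) (θ : Edge d → ℝ) :
    IsUnitFlow (x + z) (y + z) θ ↔ IsUnitFlow x y (θ ∘ shiftEdge z) := by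
  rw [isUnitFlow_iff hxy, isUnitFlow_iff (by simpa using hxy)]
  constructor
  · intro h q
    rw [outflow_comp_shiftEdge, h]; simp [pointMass]
  · intro h q
    have := h (q - z)
    rw [outflow_comp_shiftEdge, sub_add_cancel] at this
    rw [this]; simp [pointMass, sub_eq_iff_eq_add]

lemma resistance_shift (p : ℝ) (r : Edge d → ℝ) (hxy : x ≠ y) (z : Vertex d) :
    resistance p r (x + z) (y + z) = resistance p (r ∘ shiftEdge z) x y := by
  unfold resistance
  congr 1
  refine Equiv.iInf_congr (((shiftEdge z).symm.arrowCongr (Equiv.refl ℝ)).subtypeEquiv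
    fun θ => isUnitFlow_comp_shiftEdge hxy z θ) fun θ => ?_
  rw [energy, energy]
  conv_rhs => rw [← (shiftEdge z).tsum_eq]
  rfl

lemma coinRes_comp_shift (p a b : ℝ) (hxy : x ≠ y) (z : Vertex d) (ω : Edge d → Bool) :
    coinRes p a b x y (ω ∘ shiftEdge z) = coinRes p a b (x + z) (y + z) ω := by
  rw [coinRes, coinRes, resistance_shift p _ hxy]; rfl

lemma flip_comp_shift (z : Vertex d) (e : Edge d) (ω : Edge d → Bool) :
    flip e ω ∘ shiftEdge z = flip ((shiftEdge z).symm e) (ω ∘ shiftEdge z) := by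
  ext e'
  by_cases h : shiftEdge z e' = e
  · have h' : e' = (shiftEdge z).symm e := by rw [← h]; simp
    rw [h', flip_same]; simp [flip_same]
  · have h' : e' ≠ (shiftEdge z).symm e := fun h' => h (by rw [h']; simp)
    rw [flip_of_ne h']; simp [flip_of_ne h]

end CoinSpace

/-! ### Independent fair coins and the invariances of their law. -/

section CoinLaw

/-- A fair coin. -/
noncomputable def coin : Measure Bool :=
  (2⁻¹ : ℝ≥0∞) • Measure.dirac false + (2⁻¹ : ℝ≥0∞) • Measure.dirac true

instance : IsProbabilityMeasure coin :=
  ⟨by simp [coin, ENNReal.inv_two_add_inv_two]⟩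

/-- The law of independent fair coins on the edges. -/
noncomputable def coinLaw (d : ℕ) : Measure (Edge d → Bool) :=
  Measure.infinitePi fun _ : Edge d => coin

instance (d : ℕ) : IsProbabilityMeasure (coinLaw d) := by
  unfold coinLaw; infer_instance

lemma coin_map_ite (a b : ℝ) : coin.map (fun t : Bool => if t then b else a) = bernoulliLaw a b := by
  have hm : Measurable fun t : Bool => if t then b else a := measurable_of_countable _
  rw [coin, Measure.map_add _ _ hm, Measure.map_smul, Measure.map_smul,
    Measure.map_dirac' hm, Measure.map_dirac' hm]
  simp [bernoulliLaw]

lemma coin_map_not : coin.map (fun t : Bool => !t) = coin := by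
  have hm : Measurable fun t : Bool => !t := measurable_of_countable _
  rw [coin, Measure.map_add _ _ hm, Measure.map_smul, Measure.map_smul,
    Measure.map_dirac' hm, Measure.map_dirac' hm, add_comm]
  simp

lemma measurable_coinResistances (d : ℕ) (a b : ℝ) :
    Measurable (coinResistances a b : (Edge d → Bool) → Edge d → ℝ) :=
  (continuous_coinResistances a b).measurable

/-- Only this push-forward identity is needed to change spaces, so the degenerate case `a = b`,
where resistances do not determine the coins, is included. -/
lemma coinLaw_map_coinResistances (d : ℕ) (a b : ℝ) :
    (coinLaw d).map (coinResistances a b) = resistanceLaw d a b := by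
  have h := Measure.infinitePi_map_pi (fun _ : Edge d => coin)
    (f := fun _ (t : Bool) => if t then b else a) fun _ => measurable_of_countable _
  rw [coinLaw]
  refine h.trans ?_
  rw [resistanceLaw]
  congr 1
  funext _; exact coin_map_ite a b

lemma measurePreserving_flip (d : ℕ) (e : Edge d) :
    MeasurePreserving (flip e) (coinLaw d) (coinLaw d) := by
  refine ⟨(continuous_flip e).measurable, ?_⟩
  have h := Measure.infinitePi_map_pi (fun _ : Edge d => coin)
    (f := fun e' (t : Bool) => if e' = e then !t else t) fun _ => measurable_of_countable _
  have h1 : (fun (ω : Edge d → Bool) e' => if e' = e then !ω e' else ω e') = flip e := by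
    funext ω e'
    by_cases h' : e' = e
    · subst h'; simp [flip_same]
    · simp [h', flip_of_ne h']
  rw [h1] at h
  rw [coinLaw, h]
  congr 1
  funext e'
  by_cases h' : e' = e
  · simp only [h', if_true]; exact coin_map_not
  · simp only [h', if_false]; exact Measure.map_id

lemma measurePreserving_shift (d : ℕ) (z : Vertex d) :
    MeasurePreserving (fun ω : Edge d → Bool => ω ∘ shiftEdge z) (coinLaw d) (coinLaw d) := by
  have hm : Measurable fun ω : Edge d → Bool => ω ∘ shiftEdge z :=
    measurable_pi_lambda _ fun e => measurable_pi_apply _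
  refine ⟨hm, Measure.eq_infinitePi _ fun s t ht => ?_⟩
  rw [Measure.map_apply hm (.pi s.countable_toSet fun _ _ => ht _)]
  have : (fun ω : Edge d → Bool => ω ∘ shiftEdge z) ⁻¹' (Set.pi s t)
      = Set.pi (s.map (shiftEdge z).toEmbedding) fun e => t ((shiftEdge z).symm e) := by
    ext ω
    simp only [Set.mem_preimage, Set.mem_pi, Finset.mem_coe, Finset.mem_map_equiv]
    exact ⟨fun h e he => by simpa using h _ he, fun h e he => by
      simpa using h (shiftEdge z e) (by simpa using he)⟩
  rw [this, coinLaw, Measure.infinitePi_pi _ fun e _ => ht _, Finset.prod_map]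
  simp

end CoinLaw

/-! ### Averaging over translations and the resulting variance bound. -/

section Averaging

variable {d : ℕ} {p a b : ℝ} {v : Vertex d}

/-- The cube of translations `[0, m)^d`. -/
noncomputable def shiftCube (d m : ℕ) : Finset (Vertex d) :=
  Fintype.piFinset fun _ => Finset.Ico 0 (m : ℤ)

lemma card_shiftCube (d m : ℕ) : (shiftCube d m).card = m ^ d := by
  simp [shiftCube, Fintype.card_piFinset]

lemma mem_shiftCube {m : ℕ} {z : Vertex d} : z ∈ shiftCube d m ↔ ∀ j, 0 ≤ z j ∧ z j < m := by
  simp [shiftCube]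

lemma l1norm_le_of_natAbs_le {m : ℕ} {z : Vertex d} (h : ∀ j, (z j).natAbs ≤ m) :
    l1norm z ≤ d * m := by
  refine (Finset.sum_le_card_nsmul _ _ m fun j _ => h j).trans ?_
  simp

/-- The resistance averaged over translations of its endpoints. -/
noncomputable def avgRes (p a b : ℝ) (v : Vertex d) (m : ℕ) (ω : Edge d → Bool) : ℝ :=
  ((m : ℝ) ^ d)⁻¹ * ∑ z ∈ shiftCube d m, coinRes p a b 0 v (ω ∘ shiftEdge z)

lemma continuous_avgRes (hp : 1 < p) (ha : 0 < a) (hab : a ≤ b) (hv : v ≠ 0) (m : ℕ) :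
    Continuous (avgRes p a b v m) := by
  refine continuous_const.mul (continuous_finsetSum _ fun z _ => ?_)
  refine (continuous_coinRes hp ha hab hv.symm).comp ?_
  exact continuous_pi fun e => continuous_apply _

/-- Each translation moves both endpoints by at most `d m` in `ℓ¹`, and in the recurrent regime the
resistance varies at most linearly with its endpoints. -/
lemma abs_avgRes_sub_le (hd : 1 ≤ d) (hp : 1 < p) (hdp : ((d : ℝ) - 1) * p ≤ d) (ha : 0 < a)
    (hab : a ≤ b) (hv : v ≠ 0) {m : ℕ} (hm : 1 ≤ m) (ω : Edge d → Bool) :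
    |coinRes p a b 0 v ω - avgRes p a b v m ω| ≤ b * 3 ^ p * (2 * (d * m)) := by
  have hb : 0 ≤ b := ha.le.trans hab
  have hm0 : (0 : ℝ) < m := by exact_mod_cast hm
  have hr := coinResistances_mem hab ω
  have key : ∀ z ∈ shiftCube d m,
      |coinRes p a b 0 v ω - coinRes p a b 0 v (ω ∘ shiftEdge z)|
        ≤ b * 3 ^ p * (2 * (d * m)) := by
    intro z hz
    rw [mem_shiftCube] at hz
    rw [coinRes_comp_shift p a b hv.symm]
    have hne : 0 + z ≠ v + z := by simpa using hv
    have h1 := resistance_le_add hd hp hdp ha hr hv.symm hne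
    have h2 := resistance_le_add hd hp hdp ha hr hne hv.symm
    have n1 : ∀ q : Vertex d, (∀ j, (q j).natAbs = (z j).natAbs) → (l1norm q : ℝ) ≤ d * m := by
      intro q hq
      exact_mod_cast l1norm_le_of_natAbs_le fun j => by rw [hq]; have := hz j; omega
    have e1 := n1 (0 + z - 0) fun j => by simp
    have e2 := n1 (v - (v + z)) fun j => by simp
    have e3 := n1 (0 - (0 + z)) fun j => by simp
    have e4 := n1 (v + z - v) fun j => by simp
    have hK : 0 ≤ b * 3 ^ p := by positivity
    have h1' : b * 3 ^ p * ((l1norm (0 + z - 0) : ℝ) + l1norm (v - (v + z)))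
        ≤ b * 3 ^ p * (2 * (d * m)) := mul_le_mul_of_nonneg_left (by linarith) hK
    have h2' : b * 3 ^ p * ((l1norm (0 - (0 + z)) : ℝ) + l1norm (v + z - v))
        ≤ b * 3 ^ p * (2 * (d * m)) := mul_le_mul_of_nonneg_left (by linarith) hK
    rw [abs_le, coinRes, coinRes]
    constructor <;> linarith
  have hcard : (((shiftCube d m).card : ℝ)) = (m : ℝ) ^ d := by rw [card_shiftCube]; push_cast; rfl
  have hmd : (0 : ℝ) < (m : ℝ) ^ d := by positivity
  have e : coinRes p a b 0 v ω - avgRes p a b v m ω = ((m : ℝ) ^ d)⁻¹ *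
      ∑ z ∈ shiftCube d m, (coinRes p a b 0 v ω - coinRes p a b 0 v (ω ∘ shiftEdge z)) := by
    rw [Finset.sum_sub_distrib, Finset.sum_const, nsmul_eq_mul, hcard, avgRes]
    field_simp
  rw [e, abs_mul, abs_of_pos (inv_pos.2 hmd), inv_mul_le_iff₀ hmd, ← hcard]
  refine (Finset.abs_sum_le_sum_abs _ _).trans ((Finset.sum_le_sum key).trans ?_)
  rw [Finset.sum_const, nsmul_eq_mul]

lemma abs_avgRes_sub_flip_le (ω : Edge d → Bool) (e : Edge d) (m : ℕ) :
    |avgRes p a b v m ω - avgRes p a b v m (flip e ω)| ≤ ((m : ℝ) ^ d)⁻¹ *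
      ∑ z ∈ shiftCube d m, |coinRes p a b 0 v (ω ∘ shiftEdge z)
        - coinRes p a b 0 v (flip ((shiftEdge z).symm e) (ω ∘ shiftEdge z))| := by
  rw [avgRes, avgRes, ← mul_sub, ← Finset.sum_sub_distrib, abs_mul,
    abs_of_nonneg (by positivity)]
  simp only [flip_comp_shift]
  exact mul_le_mul_of_nonneg_left (Finset.abs_sum_le_sum_abs _ _) (by positivity)

/-- By translation invariance, the influence of `e` on a translated resistance is the influence of a
translated edge on the original one, so averaging spreads influence over a cube of edges. -/
lemma integral_avgRes_sub_flip_le (hp : 1 < p) (ha : 0 < a) (hab : a ≤ b) (hv : v ≠ 0)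
    (e : Edge d) (m : ℕ) :
    ∫ ω, |avgRes p a b v m ω - avgRes p a b v m (flip e ω)| ∂(coinLaw d) ≤ ((m : ℝ) ^ d)⁻¹ *
      ∑ z ∈ shiftCube d m, ∫ ω, |coinRes p a b 0 v ω
        - coinRes p a b 0 v (flip ((shiftEdge z).symm e) ω)| ∂(coinLaw d) := by
  have hF := continuous_coinRes (a := a) (b := b) hp ha hab hv.symm
  have hA := continuous_avgRes hp ha hab hv m
  have hG : ∀ e, Continuous fun ω => |coinRes p a b 0 v ω - coinRes p a b 0 v (flip e ω)| :=
    fun e => (hF.sub (hF.comp (continuous_flip e))).abs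
  have hsh : ∀ z : Vertex d, Continuous fun ω : Edge d → Bool => ω ∘ shiftEdge z := fun z =>
    continuous_pi fun e => continuous_apply _
  have hGs : ∀ z, Continuous fun ω : Edge d → Bool => |coinRes p a b 0 v (ω ∘ shiftEdge z)
      - coinRes p a b 0 v (flip ((shiftEdge z).symm e) (ω ∘ shiftEdge z))| := fun z =>
    (hG _).comp (hsh z)
  have hinv : ∀ z : Vertex d, ∫ ω, |coinRes p a b 0 v (ω ∘ shiftEdge z)
      - coinRes p a b 0 v (flip ((shiftEdge z).symm e) (ω ∘ shiftEdge z))| ∂(coinLaw d)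
      = ∫ ω, |coinRes p a b 0 v ω
        - coinRes p a b 0 v (flip ((shiftEdge z).symm e) ω)| ∂(coinLaw d) := by
    intro z
    conv_rhs => rw [← (measurePreserving_shift d z).map_eq]
    rw [integral_map (measurePreserving_shift d z).measurable.aemeasurable
      (hG _).aestronglyMeasurable]
  calc _ ≤ ∫ ω, ((m : ℝ) ^ d)⁻¹ *
      ∑ z ∈ shiftCube d m, |coinRes p a b 0 v (ω ∘ shiftEdge z)
        - coinRes p a b 0 v (flip ((shiftEdge z).symm e) (ω ∘ shiftEdge z))| ∂(coinLaw d) :=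
        integral_mono (integrable_of_continuous (hA.sub (hA.comp (continuous_flip e))).abs)
          (integrable_of_continuous (continuous_const.mul
            (continuous_finsetSum _ fun z _ => hGs z)))
          fun ω => abs_avgRes_sub_flip_le ω e m
    _ = _ := by
        rw [integral_const_mul, integral_finsetSum _ fun z _ => integrable_of_continuous (hGs z)]
        simp only [hinv]

/-- Bound the variance of `f` by its second moment about the mean of `g`, and use `(x + y)² ≤ 2x² +
2y²`. -/
lemma variance_le_of_abs_sub_le {ι : Type*} [DecidableEq ι] [Countable ι]
    {P : Measure (ι → Bool)} [IsProbabilityMeasure P] {f g : (ι → Bool) → ℝ} (hf : Continuous f)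
    (hg : Continuous g) {D : ℝ} (h : ∀ ω, |f ω - g ω| ≤ D) :
    variance f P ≤ 2 * D ^ 2 + 2 * variance g P := by
  set c := ∫ ω, g ω ∂P with hc
  have hgv : variance g P = ∫ ω, (g ω - c) ^ 2 ∂P :=
    variance_eq_integral hg.aestronglyMeasurable.aemeasurable
  rw [← variance_sub_const hf.aestronglyMeasurable c]
  have hfc : Continuous fun ω => f ω - c := hf.sub continuous_const
  refine (variance_le_expectation_sq hfc.aestronglyMeasurable).trans ?_
  have i2 : Integrable (fun ω => 2 * (g ω - c) ^ 2) P := integrable_of_continuous (by fun_prop)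
  calc ∫ ω, ((fun ω => f ω - c) ^ 2) ω ∂P ≤ ∫ ω, (2 * D ^ 2 + 2 * (g ω - c) ^ 2) ∂P := by
        refine integral_mono (integrable_of_continuous (hfc.pow 2))
          ((integrable_const _).add i2) fun ω => ?_
        simp only [Pi.pow_apply]
        have h1 : (f ω - g ω) ^ 2 ≤ D ^ 2 := sq_le_sq' (abs_le.1 (h ω)).1 (abs_le.1 (h ω)).2
        nlinarith [sq_nonneg ((f ω - g ω) - (g ω - c))]
    _ = _ := by
        rw [integral_add (integrable_const _) i2, hgv, ← integral_const_mul]; simp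

/-- The variance bound obtained by averaging over translations in a cube of side `m` and splitting
frequencies at level `k`. -/
theorem variance_coinRes_le (hd : 2 ≤ d) (hp : 1 < p) (hdp : ((d : ℝ) - 1) * p ≤ d) (ha : 0 < a)
    (hab : a ≤ b) (hv : v ≠ 0) {B : ℝ} (hB : ∀ ω, coinRes p a b 0 v ω ≤ B) {m k : ℕ}
    (hm : 1 ≤ m) (hk : 1 ≤ k) :
    variance (coinRes p a b 0 v) (coinLaw d) ≤ 2 * (b * 3 ^ p * (2 * (d * m))) ^ 2
      + 2 * (b ^ 2 * (2 * B / a / k + 3 ^ k * √(4 * b * d / a / m) * (2 * B / a))) := by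
  have hd1 : 1 ≤ d := by omega
  have hb : 0 < b := ha.trans_le hab
  have hm0 : (0 : ℝ) < m := by exact_mod_cast hm
  have hmd : (0 : ℝ) < (m : ℝ) ^ d := by positivity
  have hB0 : 0 ≤ B := (resistance_nonneg _ _ _ _).trans (hB fun _ => false)
  have hF := continuous_coinRes (a := a) (b := b) hp ha hab hv.symm
  have hA := continuous_avgRes hp ha hab hv m
  have hcard : (((shiftCube d m).card : ℝ)) = (m : ℝ) ^ d := by rw [card_shiftCube]; push_cast; rfl
  refine (variance_le_of_abs_sub_le hF hA
    (abs_avgRes_sub_le hd1 hp hdp ha hab hv hm)).trans ?_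
  gcongr
  -- Dividing by `b` makes all increments at most `(b - a)/b ≤ 1`, as the influence inequality
  -- requires.
  set f : (Edge d → Bool) → ℝ := fun ω => b⁻¹ * avgRes p a b v m ω with hf
  have hvar : variance (avgRes p a b v m) (coinLaw d) = b ^ 2 * variance f (coinLaw d) := by
    rw [hf, variance_const_mul]; field_simp
  rw [hvar]
  refine mul_le_mul_of_nonneg_left ?_ (by positivity)
  have hdiff : ∀ e ω, |f ω - f (flip e ω)|
      = b⁻¹ * |avgRes p a b v m ω - avgRes p a b v m (flip e ω)| := fun e ω => by
    rw [hf, ← mul_sub, abs_mul, abs_of_pos (inv_pos.2 hb)]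
  have hba : b⁻¹ * (b - a) ≤ 1 := by
    rw [inv_mul_le_iff₀ hb]; linarith
  set J : Edge d → ℝ := fun e => ∫ ω, |coinRes p a b 0 v ω - coinRes p a b 0 v (flip e ω)|
    ∂(coinLaw d) with hJ
  have hinfl : ∀ e, ∫ ω, |f ω - f (flip e ω)| ∂(coinLaw d)
      ≤ b⁻¹ * (((m : ℝ) ^ d)⁻¹ * ∑ z ∈ shiftCube d m, J ((shiftEdge z).symm e)) := fun e => by
    simp only [hdiff]
    rw [integral_const_mul]
    exact mul_le_mul_of_nonneg_left (integral_avgRes_sub_flip_le hp ha hab hv e m) (by positivity)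
  have hscale : ∀ {Y : ℝ}, 0 ≤ Y → b⁻¹ * (2 * ((b - a) / a * Y)) ≤ 2 * Y / a := by
    intro Y hY
    have : b⁻¹ * (2 * ((b - a) / a * Y)) = (b⁻¹ * (b - a)) * (2 * Y / a) := by ring
    rw [this]
    exact mul_le_of_le_one_left (by positivity) hba
  refine variance_le_of_influences (f := f) (measurePreserving_flip d) (continuous_const.mul hA)
    ?_ ?_ ?_ hk
  · intro e ω
    rw [hdiff]
    refine le_trans (mul_le_mul_of_nonneg_left ?_ (by positivity)) hba
    refine (abs_avgRes_sub_flip_le ω e m).trans ?_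
    rw [inv_mul_le_iff₀ hmd, ← hcard, ← nsmul_eq_mul, ← Finset.sum_const]
    exact Finset.sum_le_sum fun z _ =>
      abs_coinRes_sub_flip_le_sub hd1 hp hdp ha hab hv.symm _ _
  -- Total influence: for every translate, the minimal flow dissipates in all at most `B`.
  · intro A
    refine (Finset.sum_le_sum fun e _ => hinfl e).trans ?_
    rw [← Finset.mul_sum, ← Finset.mul_sum, Finset.sum_comm]
    have h1 : ∀ z ∈ shiftCube d m, ∑ e ∈ A, J ((shiftEdge z).symm e) ≤ 2 * ((b - a) / a * B) := by
      intro z _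
      have hmap := Finset.sum_map A (shiftEdge z).symm.toEmbedding J
      simp only [Equiv.coe_toEmbedding] at hmap
      rw [← hmap]
      refine sum_influence_le (measurePreserving_flip d) hp ha hab hv.symm fun ω θ h => ?_
      have hr0 : ∀ e, 0 ≤ coinResistances a b ω e :=
        fun e => ha.le.trans (coinResistances_mem hab ω e).1
      refine ((summable_of_energy_ne_top hr0 h.ne_top).sum_le_tsum _ fun e _ =>
        mul_nonneg (hr0 e) (Real.rpow_nonneg (abs_nonneg _) _)).trans ?_
      rw [← h.resistance_eq hr0]; exact hB ω
    refine le_trans (mul_le_mul_of_nonneg_left ?_ (by positivity)) (hscale hB0)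
    rw [inv_mul_le_iff₀ hmd, ← hcard, ← nsmul_eq_mul, ← Finset.sum_const]
    exact Finset.sum_le_sum h1
  -- Maximal influence: the translates of `e` are distinct edges within distance `d m` of it, where
  -- the minimal flow dissipates only `O(m)`.
  · intro e
    refine (hinfl e).trans ?_
    have hinj : Set.InjOn (fun z : Vertex d => (shiftEdge z).symm e) (shiftCube d m) := by
      intro z _ z' _ h
      have := congrArg Prod.fst h
      simpa [shiftEdge] using this
    have h1 : ∑ z ∈ shiftCube d m, J ((shiftEdge z).symm e)
        ≤ 2 * ((b - a) / a * (2 * b * ((d * m : ℕ) : ℝ))) := by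
      rw [← Finset.sum_image (f := J) hinj]
      refine sum_influence_le (measurePreserving_flip d) hp ha hab hv.symm fun ω θ h => ?_
      refine h.sum_le_of_l1norm_le hd1 hp hdp ha (coinResistances_mem hab ω) hv.symm
        (c := e.1) fun e' he' => ?_
      obtain ⟨z, hz, rfl⟩ := Finset.mem_image.1 he'
      rw [mem_shiftCube] at hz
      constructor
      · refine l1norm_le_of_natAbs_le fun j => ?_
        have := hz j
        simp only [shiftEdge, Equiv.coe_fn_symm_mk, Pi.sub_apply]; omega
      · refine l1norm_le_of_natAbs_le fun j => ?_
        have := hz j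
        have hbv : basisVec e.2 j = 0 ∨ basisVec e.2 j = 1 := by
          by_cases hj : j = e.2
          · subst hj; right; exact basisVec_same _
          · left; exact basisVec_of_ne hj
        simp only [shiftEdge, Equiv.coe_fn_symm_mk, Pi.sub_apply, Pi.add_apply]; omega
    have h2 : b⁻¹ * ∑ z ∈ shiftCube d m, J ((shiftEdge z).symm e) ≤ 4 * b * d / a * m := by
      refine (mul_le_mul_of_nonneg_left h1 (by positivity)).trans ((hscale (by positivity)).trans
        (le_of_eq ?_))
      push_cast; ring
    calc b⁻¹ * (((m : ℝ) ^ d)⁻¹ * ∑ z ∈ shiftCube d m, J ((shiftEdge z).symm e))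
        = ((m : ℝ) ^ d)⁻¹ * (b⁻¹ * ∑ z ∈ shiftCube d m, J ((shiftEdge z).symm e)) := by ring
      -- Dimension at least two enters here: averaging divides by `m^d ≥ m²`, which beats the local
      -- energy of order `m`.
      _ ≤ ((m : ℝ) ^ 2)⁻¹ * (4 * b * d / a * m) := by
          refine mul_le_mul ?_ h2 ?_ (by positivity)
          · gcongr
            exact_mod_cast hm
          · refine mul_nonneg (by positivity) (Finset.sum_nonneg fun z _ => ?_)
            exact integral_nonneg fun _ => abs_nonneg _
      _ = 4 * b * d / a / m := by field_simp

end Averaging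

/-! ### Comparison of the partial sums with the rate, and choice of parameters. -/

section Rates

variable {d : ℕ} {p a b s : ℝ}

lemma partialZeta_nonneg (s : ℝ) (n : ℕ) : 0 ≤ partialZeta s n :=
  Finset.sum_nonneg fun _ _ => by positivity

lemma partialZeta_mono (s : ℝ) : Monotone (partialZeta s) := fun _ _ h =>
  Finset.sum_le_sum_of_subset_of_nonneg (Finset.range_mono h) fun _ _ _ => by positivity

/-- Cut the sum into blocks of `d` consecutive terms, each dominated by one term of the shorter sum.
This absorbs the passage between the sup-norm and the `ℓ¹`-norm. -/
lemma partialZeta_mul_le (hs : 0 ≤ s) (hd : 1 ≤ d) (M : ℕ) :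
    partialZeta s (d * M) ≤ d * partialZeta s M := by
  induction M with
  | zero => simp [partialZeta]
  | succ M ih =>
    have h1 : partialZeta s (d * (M + 1)) ≤ partialZeta s (d * M) + d * ((M : ℝ) + 1) ^ (-s) := by
      rw [partialZeta, partialZeta, mul_add, mul_one, Finset.sum_range_add]
      gcongr
      have : ∀ i ∈ Finset.range d, (((d * M + i : ℕ) : ℝ) + 1) ^ (-s) ≤ ((M : ℝ) + 1) ^ (-s) := by
        intro i _
        refine Real.rpow_le_rpow_of_nonpos (by positivity) ?_ (by linarith)
        have : M ≤ d * M + i := by nlinarith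
        gcongr
      refine (Finset.sum_le_sum this).trans ?_
      simp
    have h2 : partialZeta s (M + 1) = partialZeta s M + ((M : ℝ) + 1) ^ (-s) := by
      rw [partialZeta, Finset.sum_range_succ, ← partialZeta]
    rw [h2]; linarith

/-- Induction in place of an integral comparison: the increment of `n^{1-s}` is controlled by
Bernoulli's inequality for an exponent at most one. -/
lemma partialZeta_le_of_lt_one (hs : 0 ≤ s) (hs1 : s < 1) (n : ℕ) :
    (1 - s) * partialZeta s n ≤ (n : ℝ) ^ (1 - s) := by
  induction n with
  | zero => simp [partialZeta, Real.zero_rpow (by linarith : 1 - s ≠ 0)]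
  | succ n ih =>
    have h2 : partialZeta s (n + 1) = partialZeta s n + ((n : ℝ) + 1) ^ (-s) := by
      rw [partialZeta, Finset.sum_range_succ, ← partialZeta]
    have hn : (0 : ℝ) < (n : ℝ) + 1 := by positivity
    have h3 : (n : ℝ) ^ (1 - s) ≤ ((n : ℝ) + 1) ^ (1 - s) * (1 + (1 - s) * (-((n : ℝ) + 1)⁻¹)) := by
      have e : (n : ℝ) = ((n : ℝ) + 1) * (1 + -((n : ℝ) + 1)⁻¹) := by field_simp; ring
      have hle : -1 ≤ -((n : ℝ) + 1)⁻¹ := by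
        rw [neg_le_neg_iff]; exact inv_le_one_of_one_le₀ (by linarith [n.cast_nonneg (α := ℝ)])
      calc (n : ℝ) ^ (1 - s) = (((n : ℝ) + 1) * (1 + -((n : ℝ) + 1)⁻¹)) ^ (1 - s) := by rw [← e]
        _ = ((n : ℝ) + 1) ^ (1 - s) * (1 + -((n : ℝ) + 1)⁻¹) ^ (1 - s) :=
            Real.mul_rpow hn.le (by linarith)
        _ ≤ _ := by
            gcongr
            exact rpow_one_add_le_one_add_mul_self hle (by linarith) (by linarith)
    have h4 : ((n : ℝ) + 1) ^ (-s) = ((n : ℝ) + 1) ^ (1 - s) * ((n : ℝ) + 1)⁻¹ := by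
      rw [sub_eq_add_neg, Real.rpow_add hn, Real.rpow_one]; field_simp
    rw [h2, h4]; push_cast; nlinarith

lemma partialZeta_one_eq (n : ℕ) : partialZeta 1 n = (harmonic n : ℝ) := by
  simp [partialZeta, harmonic, Real.rpow_neg_one]

/-- The rate `a_d(n, p)` is comparable with the partial sums of `j^{-(d-1)(p-1)}`. -/
lemma exists_rate_bounds (hd : 1 ≤ d) (hp : 1 < p) : ∃ C : ℝ, 0 < C ∧ ∀ n : ℕ, 3 ≤ n →
    rate d n p ≤ partialZeta (((d : ℝ) - 1) * (p - 1)) n ∧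
    partialZeta (((d : ℝ) - 1) * (p - 1)) n ≤ C * rate d n p := by
  have hd0 : (1 : ℝ) ≤ d := by exact_mod_cast hd
  set s := ((d : ℝ) - 1) * (p - 1) with hs
  have hs0 : 0 ≤ s := mul_nonneg (by linarith) (by linarith)
  -- Comparing `(d-1)p` with `d` amounts to comparing `s` with `1`, so the three cases of the rate
  -- are the three regimes of the partial sums.
  have hsp : ((d : ℝ) - 1) * p = s + d - 1 := by rw [hs]; ring
  rcases lt_trichotomy s 1 with h1 | h1 | h1
  · refine ⟨(1 - s)⁻¹, inv_pos.2 (by linarith), fun n hn => ?_⟩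
    rw [rate, if_pos (by rw [hsp]; linarith)]
    refine ⟨partialZeta_ge hs0 (by omega), ?_⟩
    rw [le_inv_mul_iff₀ (by linarith)]
    exact partialZeta_le_of_lt_one hs0 h1 n
  · refine ⟨2, two_pos, fun n hn => ?_⟩
    have hn3 : (3 : ℝ) ≤ n := by exact_mod_cast hn
    rw [rate, if_neg (by rw [hsp]; linarith), if_pos (by rw [hsp]; linarith), h1,
      partialZeta_one_eq]
    constructor
    · refine le_trans ?_ (log_add_one_le_harmonic n)
      exact Real.log_le_log (by linarith) (by push_cast; linarith)
    · refine (harmonic_le_one_add_log n).trans ?_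
      have : 1 ≤ Real.log n := by
        rw [Real.le_log_iff_exp_le (by linarith)]
        linarith [Real.exp_one_lt_d9]
      linarith
  · have hsum : Summable fun n : ℕ => ((n : ℝ) + 1) ^ (-s) := by
      have := (summable_nat_add_iff 1).2 (Real.summable_nat_rpow.2 (by linarith : -s < -1))
      simpa using this
    have hnn : ∀ n : ℕ, 0 ≤ ((n : ℝ) + 1) ^ (-s) := fun n => by positivity
    refine ⟨∑' n : ℕ, ((n : ℝ) + 1) ^ (-s), hsum.tsum_pos hnn 0 (by simp), fun n hn => ?_⟩
    rw [rate, if_neg (by rw [hsp]; linarith), if_neg (by rw [hsp]; linarith)]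
    constructor
    · have := partialZeta_mono s (by omega : 1 ≤ n)
      simpa [partialZeta] using this
    · rw [mul_one]; exact hsum.sum_le_tsum _ fun _ _ => hnn _

lemma tendsto_rate (hdp : ((d : ℝ) - 1) * p ≤ d) :
    Tendsto (fun n => rate d n p) atTop atTop := by
  rcases hdp.lt_or_eq with h | h
  · simp only [rate, if_pos h]
    exact (tendsto_rpow_atTop (by linarith)).comp tendsto_natCast_atTop_atTop
  · simp only [rate, h, lt_irrefl, if_false, if_true]
    exact Real.tendsto_log_atTop.comp tendsto_natCast_atTop_atTop

lemma tendsto_l1norm (d : ℕ) : Tendsto (l1norm : Vertex d → ℕ) cofinite atTop := by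
  rw [← Nat.cofinite_eq_atTop]
  refine Tendsto.cofinite_of_finite_preimage_singleton fun n => ?_
  refine (box d n).finite_toSet.subset fun x hx => ?_
  have hx' : l1norm x = n := hx
  rw [Finset.mem_coe, mem_box]
  intro j
  have := natAbs_le_l1norm x j
  omega

/-- Two-sided bounds on the resistance for bounded resistances. -/
theorem exists_resistance_bounds (hd : 1 ≤ d) (hp : 1 < p) (ha : 0 < a) (hab : a ≤ b) :
    ∃ c C : ℝ, 0 < c ∧ 0 < C ∧ ∀ (r : Edge d → ℝ), (∀ e, a ≤ r e ∧ r e ≤ b) →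
      ∀ v : Vertex d, v ≠ 0 →
      c * partialZeta (((d : ℝ) - 1) * (p - 1)) (l1norm v) ≤ resistance p r 0 v ∧
      resistance p r 0 v ≤ C * partialZeta (((d : ℝ) - 1) * (p - 1)) (l1norm v) := by
  have hd0 : (1 : ℝ) ≤ d := by exact_mod_cast hd
  have hb : 0 < b := ha.trans_le hab
  set s := ((d : ℝ) - 1) * (p - 1) with hs
  have hs0 : 0 ≤ s := mul_nonneg (by linarith) (by linarith)
  obtain ⟨C, hC, hflow⟩ := exists_unitFlow_energy_le (d := d) hp hd
  set κ := ((d : ℝ) * 2 ^ d) ^ (-(p - 1)) with hκ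
  have κ0 : 0 < κ := by positivity
  refine ⟨a * κ / d, b * C, by positivity, by positivity, fun r hr v hv => ⟨?_, ?_⟩⟩
  · have hr0 : ∀ e, 0 ≤ r e := fun e => ha.le.trans (hr e).1
    obtain ⟨θ, -, h⟩ := exists_isMinFlow hp ha hr hv.symm
    have hsm := summable_rpow_of_energy_ne_top ha (fun e => (hr e).1) h.ne_top
    have : Nonempty (Fin d) := ⟨⟨0, hd⟩⟩
    obtain ⟨i, -, hi⟩ := Finset.exists_mem_eq_sup Finset.univ Finset.univ_nonempty
      fun j => (v j).natAbs
    -- The sup-norm of `v`: exactly the balls of radius below `M` separate `0` from `v`, and `|v| ≤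
    -- d M`.
    set M := (v i).natAbs with hM
    have hle : l1norm v ≤ d * M := l1norm_le_of_natAbs_le fun j => by
      rw [← hi]; exact Finset.le_sup (f := fun j => (v j).natAbs) (Finset.mem_univ j)
    have hlow := partialZeta_le_tsum hd hp hv.symm h.unit hsm (M := M) fun N hN hmem => by
      have := mem_box.1 hmem i; omega
    have h1 : partialZeta s (l1norm v) ≤ d * partialZeta s M :=
      (partialZeta_mono s hle).trans (partialZeta_mul_le hs0 hd M)
    rw [h.resistance_eq hr0]
    calc a * κ / d * partialZeta s (l1norm v) ≤ a * κ / d * (d * partialZeta s M) := by gcongr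
      _ = a * (κ * partialZeta s M) := by field_simp
      _ ≤ a * ∑' e, |θ e| ^ p := by gcongr
      _ = ∑' e, a * |θ e| ^ p := tsum_mul_left.symm
      _ ≤ _ := (hsm.mul_left a).tsum_le_tsum (fun e =>
          mul_le_mul_of_nonneg_right (hr e).1 (Real.rpow_nonneg (abs_nonneg _) _))
          (summable_of_energy_ne_top hr0 h.ne_top)
  · obtain ⟨θ, hθ, hE⟩ := hflow v hv
    refine resistance_le_of_energy_le
      (mul_nonneg (by positivity) (partialZeta_nonneg _ _)) hθ ?_
    refine (energy_mono fun e => (hr e).2).trans ?_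
    rw [energy_const hb.le, mul_assoc b, ENNReal.ofReal_mul hb.le]
    gcongr

/-- The choice of the parameters `m` and `k` in terms of the rate. -/
lemma exists_parameters : ∃ C : ℝ, 0 < C ∧ ∀ ρ : ℝ, 3 ≤ ρ → ∃ m k : ℕ, 1 ≤ m ∧ 1 ≤ k ∧
    (m : ℝ) ^ 2 ≤ C * (ρ / Real.log ρ) ∧ ρ / k ≤ C * (ρ / Real.log ρ) ∧
    3 ^ k * √(1 / m) * ρ ≤ C * (ρ / Real.log ρ) := by
  refine ⟨48, by norm_num, fun ρ hρ => ?_⟩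
  have hρ0 : 0 < ρ := by linarith
  have hρ1 : 1 ≤ ρ := by linarith
  set L := Real.log ρ with hL
  have hL1 : 1 ≤ L := by
    rw [hL, Real.le_log_iff_exp_le hρ0]; linarith [Real.exp_one_lt_d9]
  have hL0 : 0 < L := by linarith
  have hq : 1 ≤ ρ ^ (1 / 4 : ℝ) := Real.one_le_rpow hρ1 (by norm_num)
  have hlog : ∀ t : ℝ, 0 < t → L ≤ ρ ^ t / t := fun t ht => Real.log_le_rpow_div hρ0.le ht
  -- With `m` of order `ρ^{1/4}`, `m²` is `O(ρ^{1/2})` and `√(1/m) ≤ ρ^{-1/8}`. With `k` of order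
  -- `log ρ / 32`, `3 ≤ e²` gives `3^k ≤ 3 ρ^{1/16}`. The spare `ρ^{-1/16}` absorbs the logarithm
  -- via `log ρ ≤ 16 ρ^{1/16}`, whence `48 = 3 · 16`.
  refine ⟨⌈ρ ^ (1 / 4 : ℝ)⌉₊, ⌊L / 32⌋₊ + 1, ?_, by omega, ?_, ?_, ?_⟩
  · exact Nat.one_le_ceil_iff.2 (by linarith)
  · have h1 : (⌈ρ ^ (1 / 4 : ℝ)⌉₊ : ℝ) ≤ 2 * ρ ^ (1 / 4 : ℝ) := by
      have := Nat.ceil_lt_add_one (by linarith : 0 ≤ ρ ^ (1 / 4 : ℝ)); linarith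
    have h2 : (⌈ρ ^ (1 / 4 : ℝ)⌉₊ : ℝ) ^ 2 ≤ 4 * ρ ^ (1 / 2 : ℝ) := by
      calc _ ≤ (2 * ρ ^ (1 / 4 : ℝ)) ^ 2 := pow_le_pow_left₀ (Nat.cast_nonneg _) h1 2
        _ = 4 * (ρ ^ (1 / 4 : ℝ)) ^ (2 : ℕ) := by ring
        _ = _ := by rw [← Real.rpow_natCast, ← Real.rpow_mul hρ0.le]; norm_num
    refine h2.trans ?_
    rw [← mul_div_assoc, le_div_iff₀ hL0]
    have h3 := hlog (1 / 2) (by norm_num)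
    have h4 : ρ ^ (1 / 2 : ℝ) * ρ ^ (1 / 2 : ℝ) = ρ := by
      rw [← Real.rpow_add hρ0]; norm_num
    have h5 : 0 ≤ ρ ^ (1 / 2 : ℝ) := by positivity
    nlinarith
  · have h1 : L / 32 ≤ ((⌊L / 32⌋₊ + 1 : ℕ) : ℝ) := by
      push_cast; exact (Nat.lt_floor_add_one _).le
    calc ρ / ((⌊L / 32⌋₊ + 1 : ℕ) : ℝ) ≤ ρ / (L / 32) := by gcongr
      _ = 32 * (ρ / L) := by field_simp
      _ ≤ _ := by
        have : 0 ≤ ρ / L := by positivity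
        linarith
  · have h1 : (3 : ℝ) ^ (⌊L / 32⌋₊ + 1) ≤ 3 * ρ ^ (1 / 16 : ℝ) := by
      rw [pow_succ, mul_comm]
      gcongr
      have h3 : (3 : ℝ) ≤ Real.exp 2 := by
        have := Real.add_one_le_exp (2 : ℝ); linarith
      calc (3 : ℝ) ^ ⌊L / 32⌋₊ ≤ Real.exp 2 ^ ⌊L / 32⌋₊ := by gcongr
        _ = Real.exp (⌊L / 32⌋₊ * 2) := by rw [← Real.exp_nat_mul]
        _ ≤ Real.exp (L * (1 / 16)) := by
          refine Real.exp_le_exp.2 ?_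
          have := Nat.floor_le (by positivity : 0 ≤ L / 32)
          linarith
        _ = ρ ^ (1 / 16 : ℝ) := by rw [Real.rpow_def_of_pos hρ0]
    have h2 : √(1 / (⌈ρ ^ (1 / 4 : ℝ)⌉₊ : ℝ)) ≤ ρ ^ (-(1 / 8) : ℝ) := by
      rw [Real.sqrt_le_left (by positivity), ← Real.rpow_natCast, ← Real.rpow_mul hρ0.le,
        show (-(1 / 8) : ℝ) * ((2 : ℕ) : ℝ) = -(1 / 4) by norm_num, Real.rpow_neg hρ0.le, one_div]
      gcongr
      exact Nat.le_ceil _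
    have h3 := hlog (1 / 16) (by norm_num)
    have h4 : ρ ^ (1 / 16 : ℝ) * ρ ^ (-(1 / 8) : ℝ) * ρ ^ (1 / 16 : ℝ) = 1 := by
      rw [← Real.rpow_add hρ0, ← Real.rpow_add hρ0]; norm_num
    calc _ ≤ 3 * ρ ^ (1 / 16 : ℝ) * ρ ^ (-(1 / 8) : ℝ) * ρ := by gcongr
      _ ≤ 48 * (ρ / L) := by
        rw [← mul_div_assoc, le_div_iff₀ hL0]
        have h5 : ρ ^ (1 / 16 : ℝ) * ρ ^ (-(1 / 8) : ℝ) * L ≤ 16 := by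
          calc _ ≤ ρ ^ (1 / 16 : ℝ) * ρ ^ (-(1 / 8) : ℝ) * (ρ ^ (1 / 16 : ℝ) / (1 / 16)) := by
                gcongr
            _ = 16 * (ρ ^ (1 / 16 : ℝ) * ρ ^ (-(1 / 8) : ℝ) * ρ ^ (1 / 16 : ℝ)) := by ring
            _ = 16 := by rw [h4]; norm_num
        nlinarith

end Rates

/-! ### Return from coin tosses to the law of the resistances, and conclusions. -/

section Transfer

variable {d : ℕ} {p a b : ℝ} {v : Vertex d}

lemma ae_resistanceLaw (d : ℕ) (a b : ℝ) :
    ∀ᵐ r ∂(resistanceLaw d a b), ∀ e : Edge d, r e = a ∨ r e = b := by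
  rw [ae_all_iff]
  intro e
  have h : ∀ᵐ t ∂(bernoulliLaw a b), t = a ∨ t = b := by
    rw [bernoulliLaw, ae_add_measure_iff]
    constructor <;> refine Measure.ae_smul_measure ?_ _ <;> simp [ae_dirac_eq]
  exact (measurePreserving_eval_infinitePi (fun _ : Edge d => bernoulliLaw a b)
    e).quasiMeasurePreserving.ae h

/-- Almost surely all resistances are `a` or `b`, and there the resistance is a continuous function
of the indicators of `r e = b`. -/
lemma aestronglyMeasurable_resistance (hp : 1 < p) (ha : 0 < a) (hab : a ≤ b) (hv : v ≠ 0) :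
    AEStronglyMeasurable (fun r => resistance p r 0 v) (resistanceLaw d a b) := by
  classical
  have hm : Measurable fun (r : Edge d → ℝ) (e : Edge d) => decide (r e = b) := by
    refine measurable_pi_lambda _ fun e => measurable_to_bool ?_
    have : (fun r : Edge d → ℝ => decide (r e = b)) ⁻¹' {true} = (fun r => r e) ⁻¹' {b} := by
      ext r; simp
    rw [this]
    exact measurable_pi_apply e (measurableSet_singleton b)
  refine ⟨fun r => coinRes p a b 0 v fun e => decide (r e = b),
    ((continuous_coinRes hp ha hab hv.symm).measurable.comp hm).stronglyMeasurable, ?_⟩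
  filter_upwards [ae_resistanceLaw d a b] with r hr
  rw [coinRes]
  congr 1
  funext e
  rcases hr e with h | h
  · by_cases hab' : a = b
    · simp [coinResistances, h, hab']
    · simp [coinResistances, h, hab']
  · simp [coinResistances, h]

lemma integral_resistance (hp : 1 < p) (ha : 0 < a) (hab : a ≤ b) (hv : v ≠ 0) :
    ∫ r, resistance p r 0 v ∂(resistanceLaw d a b) = ∫ ω, coinRes p a b 0 v ω ∂(coinLaw d) := by
  have h := aestronglyMeasurable_resistance hp ha hab hv
  rw [← coinLaw_map_coinResistances] at h ⊢
  exact integral_map (measurable_coinResistances d a b).aemeasurable h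

lemma variance_resistance (hp : 1 < p) (ha : 0 < a) (hab : a ≤ b) (hv : v ≠ 0) :
    variance (fun r => resistance p r 0 v) (resistanceLaw d a b)
      = variance (coinRes p a b 0 v) (coinLaw d) := by
  have h := aestronglyMeasurable_resistance hp ha hab hv
  rw [← coinLaw_map_coinResistances] at h ⊢
  exact variance_map h.aemeasurable (measurable_coinResistances d a b).aemeasurable

/-- No unit flow exists, the infimum over the empty type is `⊤`, and `toReal` sends it to `0`. This
covers `v = 0` in the integrability statement. -/
lemma resistance_self (p : ℝ) (r : Edge d → ℝ) (x : Vertex d) : resistance p r x x = 0 := by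
  have : IsEmpty {θ : Edge d → ℝ // IsUnitFlow x x θ} :=
    ⟨fun θ => by linarith [θ.2.source, θ.2.sink]⟩
  rw [resistance, iInf_of_empty, ENNReal.toReal_top]

theorem memLp_resistance (hd : 1 ≤ d) (hp : 1 < p) (ha : 0 < a) (hab : a ≤ b) (v : Vertex d) :
    MemLp (fun r => resistance p r 0 v) 2 (resistanceLaw d a b) := by
  have : IsProbabilityMeasure (resistanceLaw d a b) := by unfold resistanceLaw; infer_instance
  rcases eq_or_ne v 0 with rfl | hv
  · simp only [resistance_self]; exact MemLp.zero'
  obtain ⟨_, C, -, -, hb⟩ := exists_resistance_bounds (d := d) hd hp ha hab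
  refine MemLp.of_bound (aestronglyMeasurable_resistance hp ha hab hv)
    (C * partialZeta (((d : ℝ) - 1) * (p - 1)) (l1norm v)) ?_
  filter_upwards [ae_resistanceLaw d a b] with r hr
  rw [Real.norm_eq_abs, abs_of_nonneg (resistance_nonneg _ _ _ _)]
  refine (hb r (fun e => ?_) v hv).2
  rcases hr e with h | h <;> rw [h] <;> simp [hab]

lemma eventually_three_le_l1norm (d : ℕ) : ∀ᶠ v : Vertex d in cofinite, 3 ≤ l1norm v ∧ v ≠ 0 := by
  filter_upwards [(tendsto_l1norm d).eventually_ge_atTop 3] with v hv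
  exact ⟨hv, by rintro rfl; simp [l1norm] at hv⟩

theorem isTheta_integral_resistance (hd : 1 ≤ d) (hp : 1 < p) (ha : 0 < a) (hab : a ≤ b) :
    (fun v : Vertex d => ∫ r, resistance p r 0 v ∂(resistanceLaw d a b))
      =Θ[cofinite] fun v => rate d (l1norm v) p := by
  obtain ⟨c, C, hc, hC, hb⟩ := exists_resistance_bounds (d := d) hd hp ha hab
  obtain ⟨K, hK, hrate⟩ := exists_rate_bounds hd hp
  have key : ∀ v : Vertex d, 3 ≤ l1norm v → v ≠ 0 → 0 ≤ rate d (l1norm v) p ∧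
      c * rate d (l1norm v) p ≤ ∫ ω, coinRes p a b 0 v ω ∂(coinLaw d) ∧
      ∫ ω, coinRes p a b 0 v ω ∂(coinLaw d) ≤ C * K * rate d (l1norm v) p := by
    intro v hv3 hv
    obtain ⟨h1, h2⟩ := hrate _ hv3
    have hi : Integrable (coinRes p a b 0 v) (coinLaw d) :=
      integrable_of_continuous (continuous_coinRes hp ha hab hv.symm)
    have hb' := fun ω : Edge d → Bool => hb _ (coinResistances_mem hab ω) v hv
    refine ⟨?_, ?_, ?_⟩
    · exact nonneg_of_mul_nonneg_right ((partialZeta_nonneg _ _).trans h2) hK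
    · calc c * rate d (l1norm v) p ≤ ∫ _, c * rate d (l1norm v) p ∂(coinLaw d) := by simp
        _ ≤ _ := integral_mono (integrable_const _) hi fun ω =>
          (mul_le_mul_of_nonneg_left h1 hc.le).trans (hb' ω).1
    · calc _ ≤ ∫ _, C * K * rate d (l1norm v) p ∂(coinLaw d) :=
          integral_mono hi (integrable_const _) fun ω => (hb' ω).2.trans (by
            rw [mul_assoc]; exact mul_le_mul_of_nonneg_left h2 hC.le)
        _ = _ := by simp
  constructor
  · refine IsBigO.of_bound (C * K) ?_
    filter_upwards [eventually_three_le_l1norm d] with v hv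
    obtain ⟨h0, h1, h2⟩ := key v hv.1 hv.2
    rw [integral_resistance hp ha hab hv.2, Real.norm_eq_abs, Real.norm_eq_abs,
      abs_of_nonneg h0, abs_of_nonneg (le_trans (by positivity) h1)]
    exact h2
  · refine IsBigO.of_bound c⁻¹ ?_
    filter_upwards [eventually_three_le_l1norm d] with v hv
    obtain ⟨h0, h1, h2⟩ := key v hv.1 hv.2
    rw [integral_resistance hp ha hab hv.2, Real.norm_eq_abs, Real.norm_eq_abs,
      abs_of_nonneg h0, abs_of_nonneg (le_trans (by positivity) h1), le_inv_mul_iff₀ hc]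
    exact h1

theorem isBigO_variance_of_recurrent (hd : 2 ≤ d) (hp : 1 < p) (hdp : ((d : ℝ) - 1) * p ≤ d)
    (ha : 0 < a) (hab : a ≤ b) :
    (fun v : Vertex d => variance (fun r => resistance p r 0 v) (resistanceLaw d a b))
      =O[cofinite] fun v => rate d (l1norm v) p / Real.log (rate d (l1norm v) p) := by
  have hd1 : 1 ≤ d := by omega
  have hb0 : 0 < b := ha.trans_le hab
  obtain ⟨c, C, hc, hC, hb⟩ := exists_resistance_bounds (d := d) hd1 hp ha hab
  obtain ⟨K, hK, hrate⟩ := exists_rate_bounds hd1 hp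
  obtain ⟨C', hC', hpar⟩ := exists_parameters
  set K₁ := 2 * (b * 3 ^ p * (2 * d)) ^ 2 with hK₁
  set K₂ := 2 * (b ^ 2 * (2 * (C * K) / a)) with hK₂
  set K₃ := 2 * (b ^ 2 * (√(4 * b * d / a) * (2 * (C * K) / a))) with hK₃
  refine IsBigO.of_bound ((K₁ + K₂ + K₃) * C') ?_
  -- In this regime the rate tends to infinity, so `ρ ≥ 3` outside a finite set and its logarithm is
  -- positive.
  filter_upwards [eventually_three_le_l1norm d,
    ((tendsto_rate hdp).comp (tendsto_l1norm d)).eventually_ge_atTop 3] with v hv hρ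
  simp only [Function.comp] at hρ
  set ρ := rate d (l1norm v) p with hρdef
  have hL : 0 < Real.log ρ := Real.log_pos (by linarith)
  obtain ⟨m, k, hm, hk, h1, h2, h3⟩ := hpar ρ hρ
  have hm0 : (0 : ℝ) < m := by exact_mod_cast hm
  have hB : ∀ ω, coinRes p a b 0 v ω ≤ C * K * ρ := fun ω =>
    (hb _ (coinResistances_mem hab ω) v hv.2).2.trans (by
      rw [mul_assoc]; exact mul_le_mul_of_nonneg_left (hrate _ hv.1).2 hC.le)
  have hmain := variance_coinRes_le hd hp hdp ha hab hv.2 hB hm hk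
  have hsqrt : √(4 * b * d / a / m) = √(4 * b * d / a) * √(1 / m) := by
    rw [← Real.sqrt_mul (by positivity)]; congr 1; ring
  rw [variance_resistance hp ha hab hv.2, Real.norm_eq_abs, Real.norm_eq_abs,
    abs_of_nonneg (variance_nonneg _ _), abs_of_nonneg (div_nonneg (by linarith) hL.le)]
  calc variance (coinRes p a b 0 v) (coinLaw d)
      ≤ K₁ * (m : ℝ) ^ 2 + K₂ * (ρ / k) + K₃ * (3 ^ k * √(1 / m) * ρ) := by
        refine hmain.trans (le_of_eq ?_)
        rw [hsqrt, hK₁, hK₂, hK₃]; ring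
    _ ≤ K₁ * (C' * (ρ / Real.log ρ)) + K₂ * (C' * (ρ / Real.log ρ))
        + K₃ * (C' * (ρ / Real.log ρ)) := by gcongr
    _ = _ := by ring

/-- The partial sums converge, so the resistance is bounded uniformly in `v` and in the
configuration, and so is its second moment. -/
theorem isBigO_variance_of_transient (hd : 1 ≤ d) (hp : 1 < p) (hdp : (d : ℝ) < ((d : ℝ) - 1) * p)
    (ha : 0 < a) (hab : a ≤ b) :
    (fun v : Vertex d => variance (fun r => resistance p r 0 v) (resistanceLaw d a b))
      =O[cofinite] fun _ => (1 : ℝ) := by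
  obtain ⟨c, C, hc, hC, hb⟩ := exists_resistance_bounds (d := d) hd hp ha hab
  obtain ⟨K, hK, hrate⟩ := exists_rate_bounds hd hp
  refine IsBigO.of_bound ((C * K) ^ 2) ?_
  filter_upwards [eventually_three_le_l1norm d] with v hv
  have hr1 : rate d (l1norm v) p = 1 := by
    rw [rate, if_neg (by linarith), if_neg (by linarith)]
  have hB : ∀ ω, coinRes p a b 0 v ω ≤ C * K := fun ω =>
    (hb _ (coinResistances_mem hab ω) v hv.2).2.trans (by
      have := (hrate _ hv.1).2
      rw [hr1, mul_one] at this
      exact mul_le_mul_of_nonneg_left this hC.le)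
  have hF := continuous_coinRes (a := a) (b := b) hp ha hab hv.2.symm
  rw [variance_resistance hp ha hab hv.2, norm_one, mul_one, Real.norm_eq_abs,
    abs_of_nonneg (variance_nonneg _ _)]
  refine (variance_le_expectation_sq hF.aestronglyMeasurable).trans ?_
  calc _ ≤ ∫ _, (C * K) ^ 2 ∂(coinLaw d) :=
        integral_mono (integrable_of_continuous (hF.pow 2)) (integrable_const _) fun ω =>
          pow_le_pow_left₀ (resistance_nonneg _ _ _ _) (hB ω) 2
    _ = _ := by simp

end Transfer

end PResistance

theorem proposition3 (d : ℕ) (hd : 1 ≤ d) (a b : ℝ) (ha : 0 < a) (hab : a ≤ b)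
    (p : ℝ) (hp : 1 < p) :
    (∀ v : PResistance.Vertex d,
      MemLp (fun r => PResistance.resistance p r 0 v) 2 (PResistance.resistanceLaw d a b)) ∧
    ((fun v : PResistance.Vertex d =>
        ∫ r, PResistance.resistance p r 0 v ∂(PResistance.resistanceLaw d a b))
      =Θ[cofinite] fun v => PResistance.rate d (PResistance.l1norm v) p) ∧
    (2 ≤ d → p ≤ (d : ℝ) / ((d : ℝ) - 1) →
      (fun v : PResistance.Vertex d =>
        variance (fun r => PResistance.resistance p r 0 v) (PResistance.resistanceLaw d a b))
      =O[cofinite] fun v => PResistance.rate d (PResistance.l1norm v) p /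
        Real.log (PResistance.rate d (PResistance.l1norm v) p)) ∧
    (2 ≤ d → (d : ℝ) / ((d : ℝ) - 1) < p →
      (fun v : PResistance.Vertex d =>
        variance (fun r => PResistance.resistance p r 0 v) (PResistance.resistanceLaw d a b))
      =O[cofinite] fun _ => (1 : ℝ)) := by
  have hpos : 2 ≤ d → (0 : ℝ) < (d : ℝ) - 1 := fun h => by
    have : (2 : ℝ) ≤ d := by exact_mod_cast h
    linarith
  refine ⟨PResistance.memLp_resistance hd hp ha hab,
    PResistance.isTheta_integral_resistance hd hp ha hab, fun h2 hpd => ?_, fun h2 hpd => ?_⟩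
  · rw [le_div_iff₀ (hpos h2), mul_comm] at hpd
    exact PResistance.isBigO_variance_of_recurrent h2 hp hpd ha hab
  · rw [div_lt_iff₀ (hpos h2), mul_comm] at hpd
    exact PResistance.isBigO_variance_of_transient hd hp hpd ha hab
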